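/- **Conventions.** Let $n\ge 1$, write $x=(\bar x,x_n)\in\mathbb R^n$ with $\bar x\in\mathbb R^{n-1}$. Functions are real valued. For $l\in\mathbb N$, $l\ge1$, $p\in[1,\infty[$ and $\Omega\subset\mathbb R^n$ open, $W^{l,p}(\Omega)$ is the space of $f\in L^p(\Omega)$ with weak derivatives $D^\alpha f\in L^p(\Omega)$ for all $|\alpha|\le l$. For $\phi:]0,\infty[\to]0,\infty[$ and $\delta\in]0,\infty]$ put $$\|f\|_{M^{\phi,\delta}_p(\Omega)}=\sup_{x\in\Omega}\ \sup_{0<r<\delta}\Big(\frac1{\phi(r)}\int_{B_r(x)\cap\Omega}|f|^p\,dy\Big)^{1/p}\in[0,\infty],\qquad \|f\|_{M^{\phi}_p(\Omega)}=\|f\|_{M^{\phi,\infty}_p(\Omega)} .$$ For $C\subset\mathbb R^n$ and $d>0$ put $C_d=\{x\in C:\operatorname{dist}(x,\partial C)>d\}$. **Atlas.** An atlas $\mathcal A=(s,d,\{V_j\}_{j=1}^s,\{\lambda_j\}_{j=1}^s)$ consists of $s\in\mathbb N\cup\{\infty\}$, $d>0$, sets $V_j$ and isometries $\lambda_j$ of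 $\mathbb R^n$ with $\lambda_j(V_j)=\prod_{i=1}^n]a_{i,j},b_{i,j}[$, $0<a_{i,j}<a_{i,j}+d<b_{i,j}$, such that $D:=\sup_j\operatorname{diam}V_j<\infty$, $(V_j)_d\neq\emptyset$ for all $j$, and the multiplicity of $\{V_j\}_j$ is finite. Let $W_j=\prod_{i=1}^{n-1}]a_{i,j},b_{i,j}[$. **Class $C^{0,1}_M(\mathcal A)$.** An open set $\Omega$ is of class $C^{0,1}_M(\mathcal A)$ if $\Omega\cap(V_j)_d\ne\emptyset$ for all $j$, $\Omega\subset\bigcup_j(V_j)_d$, and for every $j$ the set $\mathcal H_j=\lambda_j(\Omega\cap V_j)$ either equals $\prod_{i=1}^n]a_{i,j},b_{i,j}[$, or satisfies $\operatorname{diam}\mathcal H_j<D$ and $$\mathcal H_j=\{x:\bar x\in W_j,\ a_{n,j}<x_n<\varphi_j(\bar x)\}$$ with $\varphi_j:W_j\to\mathbb R$ Lipschitz, $\operatorname{Lip}\varphi_j\le M$, $a_{n,j}+d<\varphi_j$. **The operator on a subgraph.** Let $M>0$, $A=16(M+1)$. Let $F:\mathbb R^{n-1}\to\mathbb R$ be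 Lipschitz with $\operatorname{Lip}F\le M$, $\Omega_F=\{x_n<F(\bar x)\}$, $G=\{x_n>F(\bar x)\}$, $G_k=\{x: 2^{-k-1}<x_n-F(\bar x)\le2^{-k}\}$ for $k\in\mathbb Z$. A *layer partition* for $F$ with constants $(C_\alpha)_{\alpha\in\mathbb N_0^n}$ is a family of nonnegative $\psi_k\in C^\infty(\mathbb R^n)$, $k\in\mathbb Z$, with $\sum_k\psi_k=1$ on $G$ and $0$ off $G$; $G=\bigcup_k\operatorname{supp}\psi_k$ with multiplicity $2$; $G_k\subset\operatorname{supp}\psi_k\subset G_{k-1}\cup G_k\cup G_{k+1}$; and $|D^\alpha\psi_k|\le C_\alpha2^{k|\alpha|}$. A *kernel* of order $l$ is $\omega\in C_c^\infty(\mathbb R^n)$ with $\operatorname{supp}\omega\subset\{x\in\overline{B(0,1)}:x_n\ge\frac12\}$, $\int\omega=1$ and $\int\omega(z)z^\alpha dz=0$ for $0<|\alpha|\le l$. Given these, for $g\in W^{l,p}(\Omega_F)$ put $T_Fg=g$ on $\Omega_F$ and $$T_Fg(x)=\sum_{k\in\mathbb Z}\psi_k(x)\int_{\mathbb R^n}g(\bar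 x-2^{-k}\bar z,\ x_n-A2^{-k}z_n)\,\omega(z)\,dz\qquad(x\in G).$$ **Burenkov's operator.** Let $\Omega$ be of class $C^{0,1}_M(\mathcal A)$ and let $P$ be a constant. Choose: for every $j$ with $V_j\cap\partial\Omega\ne\emptyset$, an extension $F_j:\mathbb R^{n-1}\to\mathbb R$ of $\varphi_j$ with $\operatorname{Lip}F_j=\operatorname{Lip}\varphi_j$ and a layer partition for $F_j$ with constants $(C_\alpha)$; and functions $\chi_j\in C_c^\infty(\mathbb R^n)$, $j=1,\dots,s$, with $\operatorname{supp}\chi_j\subset V_j$, $0\le\chi_j\le1$, $\sum_j\chi_j^2=1$ on $\Omega$ and $|D^\alpha\chi_j|\le P$ for $|\alpha|\le l$. For $u$ on $\Omega\cap V_j$ whose support has positive distance from $\partial V_j$, let $u_j$ be the extension by zero of $u\circ\lambda_j^{-1}$ from $\mathcal H_j$, and let $T_ju=(T_{F_j}u_j)\circ\lambda_j$ if $V_j\cap\partial\Omega\ne\emptyset$, $T_ju=u_j\circ\lambda_j$ if $V_j\subset\Omega$. Burenkov's extension operator is $$Tf=\sum_{j=1}^s\chi_j\,T_j(f\chi_j),\qquad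 f\in W^{l,p}(\Omega).$$ **Theorem.** Let $\mathcal A$ be an atlas in $\mathbb R^n$, $M>0$, $l\in\mathbb N$, $l\ge 1$, $p\in[1,\infty[$; let a kernel $\omega$ of order $l$ and constants $(C_\alpha)$, $P$ be fixed. For every open set $\Omega$ of class $C^{0,1}_M(\mathcal A)$, let $T$ be Burenkov's extension operator, for any choices as above. Then $Tf\in W^{l,p}(\mathbb R^n)$ for all $f\in W^{l,p}(\Omega)$, and: 1. For every $\delta\in]0,\infty[$ there is $c>0$, depending only on $n,\mathcal A,M,l,p,\delta$ (and on the fixed $\omega,(C_\alpha),P$), such that for every $\phi:]0,\infty[\to]0,\infty[$ and every $\Omega$ of class $C^{0,1}_M(\mathcal A)$ $$\|D^\alpha Tf\|_{M^{\phi,\delta}_p(\mathbb R^n)}\le c\sum_{0\le|\beta|\le|\alpha|}\|D^\beta f\|_{M^{\phi,\delta}_p(\Omega)}\qquad\text{for all } f\in W^{l,p}(\Omega),\ |\alpha|\le l .$$ 2. For bounded $\Omega$ the constant can be chosen independent of $\delta$: there is $c>0$, depending only on $n,\mathcal A,M,l,p$ (and on $\omega,(C_\alpha),P$), such that the same estimate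 holds for every $\phi$, every bounded $\Omega$ of class $C^{0,1}_M(\mathcal A)$ and every $\delta\in]0,\infty]$; in particular $$\|D^\alpha Tf\|_{M^{\phi}_p(\mathbb R^n)}\le c\sum_{0\le|\beta|\le|\alpha|}\|D^\beta f\|_{M^{\phi}_p(\Omega)}\qquad\text{for all } f\in W^{l,p}(\Omega),\ |\alpha|\le l .$$ -/

import Mathlib

open MeasureTheory Set
open scoped NNReal ENNReal

noncomputable section

namespace BurenkovMorrey

/-- Euclidean space of dimension `m + 1`; the last coordinate is the distinguished one. -/
abbrev E (m : ℕ) : Type := EuclideanSpace ℝ (Fin (m + 1))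

/-- The first `m` coordinates of a point of the `m + 1` dimensional space. -/
def bar {m : ℕ} (x : E m) : EuclideanSpace ℝ (Fin m) :=
  WithLp.toLp 2 (fun i => x i.castSucc)

/-- The last coordinate. -/
def lastCoord {m : ℕ} (x : E m) : ℝ := x (Fin.last m)

/-! ### Derivatives, Sobolev spaces, Morrey norms -/

abbrev MultiIndex (m : ℕ) : Type := Fin (m + 1) → ℕ

def MultiIndex.order {m : ℕ} (α : MultiIndex m) : ℕ := ∑ i, α i

/-- The finite set of all multi-indices of order at most `k`. -/
def multiIndexLE (m k : ℕ) : Finset (MultiIndex m) :=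
  (Fintype.piFinset (fun _ : Fin (m + 1) => Finset.range (k + 1))).filter
    (fun β => ∑ i, β i ≤ k)

theorem mem_multiIndexLE {m k : ℕ} (β : MultiIndex m) :
    β ∈ multiIndexLE m k ↔ β.order ≤ k := by
  unfold multiIndexLE MultiIndex.order
  simp only [Finset.mem_filter, Fintype.mem_piFinset, Finset.mem_range, and_iff_right_iff_imp]
  intro h i
  have := Finset.single_le_sum (f := β) (fun j _ => Nat.zero_le _) (Finset.mem_univ i)
  omega

/-- The partial derivative in the direction of the `i`-th coordinate. -/
def partialD {m : ℕ} (i : Fin (m + 1)) (f : E m → ℝ) : E m → ℝ :=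
  fun x => fderiv ℝ f x (EuclideanSpace.single i 1)

/-- The classical derivative `D^α f` (used for smooth functions only). -/
def classicalD {m : ℕ} (α : MultiIndex m) (f : E m → ℝ) : E m → ℝ :=
  (List.finRange (m + 1)).foldr (fun i g => (partialD i)^[α i] g) f

/-- `g` is a weak derivative `D^β f` on the open set `Ω`. -/
def HasWeakDeriv {m : ℕ} (Ω : Set (E m)) (β : MultiIndex m) (f g : E m → ℝ) : Prop :=
  LocallyIntegrableOn f Ω ∧ LocallyIntegrableOn g Ω ∧
    ∀ η : E m → ℝ, ContDiff ℝ (⊤ : ℕ∞) η → HasCompactSupport η → tsupport η ⊆ Ω →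
      ∫ x in Ω, f x * classicalD β η x = (-1 : ℝ) ^ β.order * ∫ x in Ω, g x * η x

open Classical in
/-- A representative of the weak derivative `D^β f` on `Ω` (zero if there is none). -/
def weakD {m : ℕ} (Ω : Set (E m)) (β : MultiIndex m) (f : E m → ℝ) : E m → ℝ :=
  if h : ∃ g, HasWeakDeriv Ω β f g then h.choose else 0

/-- Membership in `W^{l,p}(Ω)`. The values of `f` outside `Ω` are irrelevant. -/
def MemSobolev {m : ℕ} (l : ℕ) (p : ℝ) (Ω : Set (E m)) (f : E m → ℝ) : Prop :=
  MemLp f (ENNReal.ofReal p) (volume.restrict Ω) ∧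
    ∀ β : MultiIndex m, β.order ≤ l →
      ∃ g, HasWeakDeriv Ω β f g ∧ MemLp g (ENNReal.ofReal p) (volume.restrict Ω)

/-- The (possibly infinite) generalized Morrey norm: the supremum over `x ∈ Ω`, `0 < r < δ` of
`((1 / φ r) ∫_{B_r(x) ∩ Ω} |f|^p)^{1/p}`. -/
def morreyNorm {m : ℕ} (φ : ℝ → ℝ) (δ : ℝ≥0∞) (p : ℝ) (Ω : Set (E m)) (f : E m → ℝ) : ℝ≥0∞ :=
  ⨆ x ∈ Ω, ⨆ r : ℝ, ⨆ (_ : 0 < r ∧ ENNReal.ofReal r < δ),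
    (ENNReal.ofReal (1 / φ r) * ∫⁻ y in Metric.ball x r ∩ Ω, ‖f y‖ₑ ^ p) ^ (1 / p)

/-! ### Lipschitz domains -/

/-- The open box `∏ ]a_i, b_i[`. -/
def box {m : ℕ} (a b : Fin (m + 1) → ℝ) : Set (E m) := {x | ∀ i, a i < x i ∧ x i < b i}

/-- The base `W = ∏_{i < n} ]a_i, b_i[` of the box. -/
def boxBase {m : ℕ} (a b : Fin (m + 1) → ℝ) : Set (EuclideanSpace ℝ (Fin m)) :=
  {y | ∀ i : Fin m, a i.castSucc < y i ∧ y i < b i.castSucc}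

/-- `C_d`, the set of points of `C` at distance greater than `d` from the boundary of `C`. -/
def innerPart {m : ℕ} (C : Set (E m)) (d : ℝ) : Set (E m) :=
  {x ∈ C | d < Metric.infDist x (frontier C)}

/-- `H` is the bounded elementary domain with Lipschitz boundary and parameters `d`, `D`, `M`
that lies over the base of the box of `a`, `b` and below the graph of `φ`. Only the values of
`φ` on the base matter. -/
structure IsElementaryDomain {m : ℕ} (H : Set (E m)) (a b : Fin (m + 1) → ℝ) (d D : ℝ) (M : ℝ≥0)
    (φ : EuclideanSpace ℝ (Fin m) → ℝ) : Prop where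
  lt : ∀ i, a i < b i
  eq : H = {x | bar x ∈ boxBase a b ∧ a (Fin.last m) < lastCoord x ∧ lastCoord x < φ (bar x)}
  diam_lt : Metric.diam H < D
  lipschitz : LipschitzOnWith M φ (boxBase a b)
  lower : ∀ y ∈ boxBase a b, a (Fin.last m) + d < φ y

/-- An atlas: countably many cuboids `V j`, indexed by the natural numbers below `s ≤ ∞`. -/
structure Atlas (m : ℕ) where
  s : ℕ∞
  d : ℝ
  V : {j : ℕ // (j : ℕ∞) < s} → Set (E m)
  lam : {j : ℕ // (j : ℕ∞) < s} → (E m ≃ᵢ E m)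
  a : {j : ℕ // (j : ℕ∞) < s} → Fin (m + 1) → ℝ
  b : {j : ℕ // (j : ℕ∞) < s} → Fin (m + 1) → ℝ
  d_pos : 0 < d
  image_eq : ∀ j, lam j '' V j = box (a j) (b j)
  a_pos : ∀ j i, 0 < a j i
  a_add_lt : ∀ j i, a j i + d < b j i
  bddAbove_diam : BddAbove (range fun j => Metric.diam (V j))
  inner_nonempty : ∀ j, (innerPart (V j) d).Nonempty
  finite_multiplicity : ∃ κ : ℕ, ∀ x, {j | x ∈ V j}.encard ≤ κ

/-- The index set of the cuboids of an atlas. -/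
abbrev Atlas.Idx {m : ℕ} (𝒜 : Atlas m) : Type := {j : ℕ // (j : ℕ∞) < 𝒜.s}

/-- The supremum of the diameters of the cuboids. -/
def Atlas.D {m : ℕ} (𝒜 : Atlas m) : ℝ := ⨆ j, Metric.diam (𝒜.V j)

/-- The set `H_j = λ_j (Ω ∩ V_j)`. -/
def Atlas.H {m : ℕ} (𝒜 : Atlas m) (Ω : Set (E m)) (j : 𝒜.Idx) : Set (E m) :=
  𝒜.lam j '' (Ω ∩ 𝒜.V j)

/-- The open set `Ω` is of class `C^{0,1}_M(𝒜)`. -/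
structure IsLipschitzClass {m : ℕ} (𝒜 : Atlas m) (M : ℝ≥0) (Ω : Set (E m)) : Prop where
  isOpen : IsOpen Ω
  meets : ∀ j, (Ω ∩ innerPart (𝒜.V j) 𝒜.d).Nonempty
  covered : Ω ⊆ ⋃ j, innerPart (𝒜.V j) 𝒜.d
  local_form : ∀ j, 𝒜.H Ω j = box (𝒜.a j) (𝒜.b j) ∨
    ∃ φ, IsElementaryDomain (𝒜.H Ω j) (𝒜.a j) (𝒜.b j) 𝒜.d 𝒜.D M φ

/-! ### The extension operator on the subgraph of a Lipschitz function -/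

/-- The domain strictly below the graph of `F`. -/
def subgraph {m : ℕ} (F : EuclideanSpace ℝ (Fin m) → ℝ) : Set (E m) :=
  {x | lastCoord x < F (bar x)}

/-- The complement of the closed subgraph (for continuous `F`). -/
def above {m : ℕ} (F : EuclideanSpace ℝ (Fin m) → ℝ) : Set (E m) :=
  {x | F (bar x) < lastCoord x}

/-- The layer `G_k` of points above the graph at vertical height in `]2^{-k-1}, 2^{-k}]`. -/
def layer {m : ℕ} (F : EuclideanSpace ℝ (Fin m) → ℝ) (k : ℤ) : Set (E m) :=
  {x | (2 : ℝ) ^ (-k - 1) < lastCoord x - F (bar x) ∧ lastCoord x - F (bar x) ≤ (2 : ℝ) ^ (-k)}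

/-- A smooth partition of unity on the region above the graph of `F`, subordinate to the layers,
with derivative constants `C α`. -/
structure IsLayerPartition {m : ℕ} (F : EuclideanSpace ℝ (Fin m) → ℝ) (C : MultiIndex m → ℝ)
    (ψ : ℤ → E m → ℝ) : Prop where
  smooth : ∀ k, ContDiff ℝ (⊤ : ℕ∞) (ψ k)
  nonneg : ∀ k x, 0 ≤ ψ k x
  sum_above : ∀ x ∈ above F, ∑' k, ψ k x = 1
  sum_outside : ∀ x, x ∉ above F → ∑' k, ψ k x = 0
  union : above F = ⋃ k, tsupport (ψ k)
  -- the multiplicity is then equal to two, by the first inclusion below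
  multiplicity : ∀ x, {k | x ∈ tsupport (ψ k)}.encard ≤ 2
  layer_subset : ∀ k, layer F k ⊆ tsupport (ψ k)
  subset_layers : ∀ k, tsupport (ψ k) ⊆ layer F (k - 1) ∪ layer F k ∪ layer F (k + 1)
  deriv_le : ∀ α k x, |classicalD α (ψ k) x| ≤ C α * (2 : ℝ) ^ (k * (α.order : ℤ))

/-- A mollification kernel supported in the upper part of the unit ball, with vanishing moments
of orders `1, …, l`. -/
structure IsKernel {m : ℕ} (l : ℕ) (ω : E m → ℝ) : Prop where
  smooth : ContDiff ℝ (⊤ : ℕ∞) ω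
  compact : HasCompactSupport ω
  supp : tsupport ω ⊆ {x | x ∈ Metric.closedBall 0 1 ∧ 1 / 2 ≤ lastCoord x}
  integral_eq_one : ∫ z in Metric.ball (0 : E m) 1, ω z = 1
  moments : ∀ α : MultiIndex m, 0 < α.order → α.order ≤ l →
    ∫ z in Metric.ball (0 : E m) 1, ω z * ∏ i, z i ^ α i = 0

/-- The point `(x̄ - 2^{-k} z̄, x_n - A 2^{-k} z_n)`. -/
def reflected {m : ℕ} (A : ℝ) (k : ℤ) (x z : E m) : E m :=
  WithLp.toLp 2 (fun i => if i = Fin.last m then x i - A * (2 : ℝ) ^ (-k) * z i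
    else x i - (2 : ℝ) ^ (-k) * z i)

/-- The mollification `f_k`. -/
def mollified {m : ℕ} (A : ℝ) (ω : E m → ℝ) (f : E m → ℝ) (k : ℤ) (x : E m) : ℝ :=
  ∫ z, f (reflected A k x z) * ω z

open Classical in
/-- Burenkov's extension operator for the subgraph of `F`: the function is kept on the subgraph,
and is `∑ₖ ψ_k f_k` elsewhere (all `ψ_k` vanish on the graph itself, a null set). -/
def subgraphExt {m : ℕ} (A : ℝ) (ω : E m → ℝ) (F : EuclideanSpace ℝ (Fin m) → ℝ)
    (ψ : ℤ → E m → ℝ) (f : E m → ℝ) (x : E m) : ℝ :=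
  if x ∈ subgraph F then f x else ∑' k : ℤ, ψ k x * mollified A ω f k x

/-! ### The extension operator on a general Lipschitz open set -/

/-- The auxiliary choices that enter the construction of the extension operator on `Ω`, beside
the kernel. For every cuboid that meets the boundary of `Ω`: a Lipschitz function `F j` on the
whole of `ℝ^{n-1}` which extends, with the same Lipschitz constant, the function whose subgraph
is `H_j`, and a layer partition `ψ j` for it. Then a family `χ` with `∑ⱼ χ_j² = 1` on `Ω`.
The numbers `C α` and `P` bound the derivatives of the two partitions. -/
structure ExtensionData {m : ℕ} (𝒜 : Atlas m) (M : ℝ≥0) (l : ℕ) (C : MultiIndex m → ℝ) (P : ℝ)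
    (Ω : Set (E m)) where
  F : 𝒜.Idx → EuclideanSpace ℝ (Fin m) → ℝ
  ψ : 𝒜.Idx → ℤ → E m → ℝ
  χ : 𝒜.Idx → E m → ℝ
  elementary : ∀ j, (𝒜.V j ∩ frontier Ω).Nonempty →
    IsElementaryDomain (𝒜.H Ω j) (𝒜.a j) (𝒜.b j) 𝒜.d 𝒜.D M (F j)
  same_lipschitz : ∀ j, (𝒜.V j ∩ frontier Ω).Nonempty →
    ∀ K : ℝ≥0, LipschitzOnWith K (F j) (boxBase (𝒜.a j) (𝒜.b j)) → LipschitzWith K (F j)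
  partition : ∀ j, (𝒜.V j ∩ frontier Ω).Nonempty → IsLayerPartition (F j) C (ψ j)
  χ_smooth : ∀ j, ContDiff ℝ (⊤ : ℕ∞) (χ j)
  χ_compact : ∀ j, HasCompactSupport (χ j)
  χ_supp : ∀ j, tsupport (χ j) ⊆ 𝒜.V j
  χ_nonneg : ∀ j x, 0 ≤ χ j x
  χ_le_one : ∀ j x, χ j x ≤ 1
  χ_sum : ∀ x ∈ Ω, ∑' j, χ j x ^ 2 = 1
  χ_deriv : ∀ j (α : MultiIndex m), α.order ≤ l → ∀ x, |classicalD α (χ j) x| ≤ P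

variable {m : ℕ} {𝒜 : Atlas m} {M : ℝ≥0} {l : ℕ} {C : MultiIndex m → ℝ} {P : ℝ} {Ω : Set (E m)}

/-- The extension-by-zero of the push-forward `u ∘ λ_j⁻¹` from `H_j` to the whole space. -/
def pushZero (𝒜 : Atlas m) (Ω : Set (E m)) (j : 𝒜.Idx) (u : E m → ℝ) : E m → ℝ :=
  (𝒜.H Ω j).indicator (fun y => u ((𝒜.lam j).symm y))

open Classical in
/-- The local operator `T_j`: push forward to `H_j`, extend, and pull back. The extension is
the one for subgraphs, with `A = 16 (M + 1)`, if `V_j` meets the boundary of `Ω`, and is the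
extension by zero if `V_j ⊆ Ω`. -/
def ExtensionData.localExt (B : ExtensionData 𝒜 M l C P Ω) (ω : E m → ℝ) (j : 𝒜.Idx)
    (u : E m → ℝ) (x : E m) : ℝ :=
  if (𝒜.V j ∩ frontier Ω).Nonempty then
    subgraphExt (16 * ((M : ℝ) + 1)) ω (B.F j) (B.ψ j) (pushZero 𝒜 Ω j u) (𝒜.lam j x)
  else pushZero 𝒜 Ω j u (𝒜.lam j x)

/-- Burenkov's extension operator `T f = ∑ⱼ χ_j T_j (f χ_j)`. -/
def ExtensionData.T (B : ExtensionData 𝒜 M l C P Ω) (ω : E m → ℝ) (f : E m → ℝ) (x : E m) : ℝ :=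
  ∑' j, B.χ j x * B.localExt ω j (fun y => f y * B.χ j y) x

end BurenkovMorrey

end

noncomputable section

namespace BurenkovMorrey

/-! ### Partial derivatives of smooth functions -/

variable {m : ℕ}

/-! The operator is a locally finite sum of local extensions, so everything rests on one subgraph.
Above the graph of `F` the extension is `∑ ψ_k u_k`, where `u_k` averages `u` at scale `2^{-k}`,
comparable to the height of the point, over a piece of a downward cone that stays below the graph.
When a derivative of order `i` is taken, a common reference average may be subtracted from all
`u_k`, because the `ψ_k` add up to one. Each term `D^b ψ_k · D^{i-b}(u_k - u_{k₁})` costs `2^{kb}`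
through the first factor. The vanishing moments of the kernel repay this exactly, since `D^{i-b}` of
a difference of averages at comparable scales is at most `2^{-kb}` times an average of derivatives
of order `i` (`IsConeKernel.enorm_integral_sub_le`, `enorm_iteratedFDeriv_mol_sub_le`). Hence
derivatives of order `i` of the extension are pointwise dominated by averages of derivatives of
order `i` of `u` over the points `x - 2^{-k} q`, with `q` in a fixed box
(`enorm_iteratedFDeriv_approxExt_le`).

By Hölder and Fubini the `L^p` estimate reduces to a fixed `q`. The translations by `2^{-k} q` then
have bounded overlap, because the depth of `x - 2^{-k} q` below the graph determines `k` up to a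
bounded error (`exists_finset_scaleRegion`, `setLIntegral_approxExt_le`). On a ball of radius `r`
there is a dichotomy (`lintegral_ball_approxExt_le`). If all relevant heights are at most a multiple
of `r`, then all translations have length at most a multiple of `r` and land in one enlarged ball.
Otherwise the heights in the ball are comparable to each other, only three scales occur, and each of
them merely translates the ball.

Regularity across the graph is obtained by approximation. In `approxExt` the scales stop at
`2^{-K}`, which gives a function that is smooth on the whole space and satisfies the same bounds
uniformly in `K`. These functions are Cauchy in `L¹` together with their derivatives of order at
most `l` (`tendsto_lintegral_approxExt_sub`) and converge to the extension. Weak derivatives are the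
limits, and integral bounds survive by Fatou (`exists_hasWeakDeriv_of_tendsto`). Weak derivatives of
the data enter only through pointwise majorants (`WeakBound`), which are stable under products with
cut-offs and under isometries.

To sum over the cuboids, fix a ball of radius `r` (`exists_hasWeakDeriv_extension`). If `r` is at
most a fixed size, boundedly many cuboids meet the ball and each local ball estimate applies. If `r`
exceeds the diameters of the cuboids, all cuboids that meet the ball lie in the ball of radius `2r`,
and the global local estimates are added by means of the finite multiplicity. Enlarged balls are
covered by a fixed number of balls of radius `r` centred in `Ω` (`exists_measure_ball_inter_le`).
The result compares integrals over balls of the same radius `r`, with a constant free of `r`, so the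
weight `φ r` factors out and the Morrey estimate holds with a constant independent of `φ` and `δ`.
-/

theorem norm_single_one (i : Fin (m + 1)) : ‖(EuclideanSpace.single i 1 : E m)‖ = 1 := by
  simp

theorem sum_single_eq (v : E m) : ∑ i, v i • (EuclideanSpace.single i 1 : E m) = v := by
  ext j
  simp [Finset.sum_apply, Pi.single_apply]

theorem fderiv_apply_eq_sum (f : E m → ℝ) (x v : E m) :
    fderiv ℝ f x v = ∑ i, v i * partialD i f x := by
  conv_lhs => rw [← sum_single_eq v]
  simp [partialD]

theorem contDiff_partialD {f : E m → ℝ} (hf : ContDiff ℝ (⊤ : ℕ∞) f) (i : Fin (m + 1)) :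
    ContDiff ℝ (⊤ : ℕ∞) (partialD i f) := by
  have : ContDiff ℝ (⊤ : ℕ∞) (fderiv ℝ f) := hf.fderiv_right (by simp)
  exact this.clm_apply contDiff_const

theorem contDiff_iterate_partialD {f : E m → ℝ} (hf : ContDiff ℝ (⊤ : ℕ∞) f) (i : Fin (m + 1))
    (k : ℕ) : ContDiff ℝ (⊤ : ℕ∞) ((partialD i)^[k] f) := by
  induction k with
  | zero => exact hf
  | succ k ih => rw [Function.iterate_succ_apply']; exact contDiff_partialD ih i

theorem partialD_comm {f : E m → ℝ} (hf : ContDiff ℝ (⊤ : ℕ∞) f) (i j : Fin (m + 1)) :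
    partialD i (partialD j f) = partialD j (partialD i f) := by
  have h1 : ∀ k (x v : E m), fderiv ℝ (partialD k f) x v
      = fderiv ℝ (fderiv ℝ f) x v (EuclideanSpace.single k 1) := by
    intro k x v
    have hd : DifferentiableAt ℝ (fderiv ℝ f) x :=
      ((hf.fderiv_right (m := (⊤ : ℕ∞)) (by simp)).differentiable (by simp)) x
    have : HasFDerivAt (partialD k f) ((ContinuousLinearMap.apply ℝ ℝ
        (EuclideanSpace.single k 1 : E m)).comp (fderiv ℝ (fderiv ℝ f) x)) x :=
      (ContinuousLinearMap.apply ℝ ℝ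
        (EuclideanSpace.single k 1 : E m)).hasFDerivAt.comp x hd.hasFDerivAt
    rw [this.fderiv]; rfl
  funext x
  have hs : IsSymmSndFDerivAt ℝ f x :=
    (hf.contDiffAt).isSymmSndFDerivAt (by
      rw [minSmoothness_of_isRCLikeNormedField]; exact WithTop.coe_le_coe.2 le_top)
  change fderiv ℝ (partialD j f) x _ = fderiv ℝ (partialD i f) x _
  rw [h1, h1]
  exact hs.eq _ _

theorem partialD_iterate_comm {f : E m → ℝ} (hf : ContDiff ℝ (⊤ : ℕ∞) f) (i j : Fin (m + 1))
    (k : ℕ) : partialD i ((partialD j)^[k] f) = (partialD j)^[k] (partialD i f) := by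
  induction k with
  | zero => rfl
  | succ k ih =>
    rw [Function.iterate_succ_apply', Function.iterate_succ_apply', ← ih,
      partialD_comm (contDiff_iterate_partialD hf j k)]

/-- The iterated partial derivatives along a list of coordinates. -/
def listD (L : List (Fin (m + 1))) (α : MultiIndex m) (f : E m → ℝ) : E m → ℝ :=
  L.foldr (fun i g => (partialD i)^[α i] g) f

theorem contDiff_listD {f : E m → ℝ} (hf : ContDiff ℝ (⊤ : ℕ∞) f) (L : List (Fin (m + 1)))
    (α : MultiIndex m) : ContDiff ℝ (⊤ : ℕ∞) (listD L α f) := by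
  induction L with
  | nil => exact hf
  | cons i L ih => exact contDiff_iterate_partialD ih i _

theorem contDiff_classicalD {f : E m → ℝ} (hf : ContDiff ℝ (⊤ : ℕ∞) f) (α : MultiIndex m) :
    ContDiff ℝ (⊤ : ℕ∞) (classicalD α f) := contDiff_listD hf _ α

theorem partialD_listD {f : E m → ℝ} (hf : ContDiff ℝ (⊤ : ℕ∞) f) (L : List (Fin (m + 1)))
    (α : MultiIndex m) (i : Fin (m + 1)) :
    partialD i (listD L α f) = listD L α (partialD i f) := by
  induction L with
  | nil => rfl
  | cons j L ih =>
    change partialD i ((partialD j)^[α j] (listD L α f)) =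
      (partialD j)^[α j] (listD L α (partialD i f))
    rw [← ih, partialD_iterate_comm (contDiff_listD hf L α)]

theorem listD_add_single_of_notMem {f : E m → ℝ} (L : List (Fin (m + 1)))
    (α : MultiIndex m) (i : Fin (m + 1)) (hi : i ∉ L) :
    listD L (α + Pi.single i 1) f = listD L α f := by
  induction L with
  | nil => rfl
  | cons j L ih =>
    rw [List.mem_cons, not_or] at hi
    change (partialD j)^[(α + Pi.single i 1 : MultiIndex m) j] (listD L (α + Pi.single i 1) f) =
      (partialD j)^[α j] (listD L α f)
    rw [ih hi.2]
    simp [Ne.symm hi.1]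

theorem listD_add_single {f : E m → ℝ} (hf : ContDiff ℝ (⊤ : ℕ∞) f) (L : List (Fin (m + 1)))
    (hL : L.Nodup) (α : MultiIndex m) (i : Fin (m + 1)) (hi : i ∈ L) :
    listD L (α + Pi.single i 1) f = partialD i (listD L α f) := by
  induction L with
  | nil => simp at hi
  | cons j L ih =>
    rw [List.nodup_cons] at hL
    change (partialD j)^[(α + Pi.single i 1 : MultiIndex m) j] (listD L (α + Pi.single i 1) f) =
      partialD i ((partialD j)^[α j] (listD L α f))
    rcases List.mem_cons.1 hi with rfl | hi'
    · rw [listD_add_single_of_notMem L α i hL.1]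
      simp [Function.iterate_succ_apply']
    · have hne : j ≠ i := fun h => hL.1 (h ▸ hi')
      rw [ih hL.2 hi', partialD_iterate_comm (contDiff_listD hf L α)]
      simp [hne]

/-- `D^{α + e_i} f = ∂_i D^α f`. -/
theorem classicalD_add_single {f : E m → ℝ} (hf : ContDiff ℝ (⊤ : ℕ∞) f) (α : MultiIndex m)
    (i : Fin (m + 1)) : classicalD (α + Pi.single i 1) f = partialD i (classicalD α f) :=
  listD_add_single hf _ (List.nodup_finRange _) α i (List.mem_finRange i)

/-- `D^{α + e_i} f = D^α ∂_i f`. -/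
theorem classicalD_add_single' {f : E m → ℝ} (hf : ContDiff ℝ (⊤ : ℕ∞) f) (α : MultiIndex m)
    (i : Fin (m + 1)) : classicalD (α + Pi.single i 1) f = classicalD α (partialD i f) := by
  rw [classicalD_add_single hf]
  exact partialD_listD hf _ α i

theorem classicalD_zero (f : E m → ℝ) : classicalD 0 f = f := by
  have : ∀ L, listD L (0 : MultiIndex m) f = f := by
    intro L
    induction L with
    | nil => rfl
    | cons j L ih =>
      change (partialD j)^[0] (listD L 0 f) = f
      simpa using ih
  exact this _

theorem order_zero : MultiIndex.order (0 : MultiIndex m) = 0 := by simp [MultiIndex.order]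

theorem order_add_single (α : MultiIndex m) (i : Fin (m + 1)) :
    MultiIndex.order (α + Pi.single i 1) = α.order + 1 := by
  simp [MultiIndex.order, Finset.sum_add_distrib]

theorem eq_zero_of_order_eq_zero {α : MultiIndex m} (h : α.order = 0) : α = 0 := by
  funext i
  simpa using (Finset.sum_eq_zero_iff.1 h) i (Finset.mem_univ i)

theorem exists_eq_add_single {α : MultiIndex m} {k : ℕ} (h : α.order = k + 1) :
    ∃ (β : MultiIndex m) (i : Fin (m + 1)), β.order = k ∧ α = β + Pi.single i 1 := by
  have : ∃ i, α i ≠ 0 := by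
    by_contra! h0
    have : α.order = 0 := Finset.sum_eq_zero (fun i _ => h0 i)
    omega
  obtain ⟨i, hi⟩ := this
  have e : α = (Function.update α i (α i - 1)) + Pi.single i 1 := by
    funext j
    by_cases hj : j = i
    · subst hj; simp; omega
    · simp [hj]
  refine ⟨_, i, ?_, e⟩
  have := order_add_single (Function.update α i (α i - 1)) i
  rw [← e] at this
  omega

/-- Induction on multi-indices by adding one derivative at a time. -/
theorem multiIndex_induction {p : MultiIndex m → Prop} (h0 : p 0)
    (hs : ∀ α i, p α → p (α + Pi.single i 1)) (α : MultiIndex m) : p α := by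
  generalize hk : α.order = k
  induction k generalizing α with
  | zero => rw [eq_zero_of_order_eq_zero hk]; exact h0
  | succ k ih =>
    obtain ⟨β, i, hβ, rfl⟩ := exists_eq_add_single hk
    exact hs β i (ih β hβ)

/-! ### Partial derivatives against iterated Fréchet derivatives. -/

/-- The functional `c ↦ c • v ↦ c * v i`. -/
def smulProj (i : Fin (m + 1)) : ℝ →L[ℝ] (E m →L[ℝ] ℝ) :=
  ContinuousLinearMap.smulRight (1 : ℝ →L[ℝ] ℝ) (EuclideanSpace.proj i : E m →L[ℝ] ℝ)

theorem norm_smulProj_le (i : Fin (m + 1)) : ‖(smulProj i : ℝ →L[ℝ] (E m →L[ℝ] ℝ))‖ ≤ 1 := by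
  refine ContinuousLinearMap.opNorm_le_bound _ zero_le_one fun c => ?_
  refine ContinuousLinearMap.opNorm_le_bound _ (by positivity) fun v => ?_
  have : ‖v i‖ ≤ ‖v‖ := PiLp.norm_apply_le v i
  simp only [smulProj, ContinuousLinearMap.smulRight_apply, one_apply_eq_self,
    smul_apply, EuclideanSpace.coe_proj, norm_smul, one_mul]
  gcongr

theorem fderiv_eq_sum_smulProj (f : E m → ℝ) :
    fderiv ℝ f = fun x => ∑ i, smulProj i (partialD i f x) := by
  funext x
  ext v
  rw [fderiv_apply_eq_sum]
  simp [smulProj, mul_comm]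

/-- The gradient is the sum of the images of the partial derivatives under the contractions
`smulProj i`. The bounds on the partitions are given for partial derivatives, while the Leibniz rule
and changes of coordinates are cleaner for iterated Fréchet derivatives; this is the bridge. -/
theorem norm_iteratedFDeriv_succ_le {f : E m → ℝ} (hf : ContDiff ℝ (⊤ : ℕ∞) f) (k : ℕ) (x : E m) :
    ‖iteratedFDeriv ℝ (k + 1) f x‖ ≤ ∑ i, ‖iteratedFDeriv ℝ k (partialD i f) x‖ := by
  rw [← norm_iteratedFDeriv_fderiv, fderiv_eq_sum_smulProj]
  have hc : ∀ i, ContDiff ℝ k (fun x => smulProj i (partialD i f x)) := fun i =>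
    (smulProj i).contDiff.comp ((contDiff_partialD hf i).of_le (by exact_mod_cast le_top))
  rw [iteratedFDeriv_fun_sum_apply (fun i _ => (hc i).contDiffAt)]
  refine (norm_sum_le _ _).trans (Finset.sum_le_sum fun i _ => ?_)
  refine ((smulProj i).norm_iteratedFDeriv_comp_left
    ((contDiff_partialD hf i).contDiffAt (x := x)) (by exact_mod_cast le_top)).trans ?_
  exact mul_le_of_le_one_left (norm_nonneg _) (norm_smulProj_le i)

theorem norm_iteratedFDeriv_fderiv_apply_le {f : E m → ℝ} (hf : ContDiff ℝ (⊤ : ℕ∞) f) (k : ℕ)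
    (x v : E m) :
    ‖iteratedFDeriv ℝ k (fun y => fderiv ℝ f y v) x‖ ≤ ‖v‖ * ‖iteratedFDeriv ℝ (k + 1) f x‖ := by
  have h1 : ContDiff ℝ (⊤ : ℕ∞) (fderiv ℝ f) := hf.fderiv_right (by simp)
  rw [← norm_iteratedFDeriv_fderiv]
  refine ((ContinuousLinearMap.apply ℝ ℝ v).norm_iteratedFDeriv_comp_left
    (h1.contDiffAt (x := x)) (by exact_mod_cast le_top)).trans ?_
  gcongr
  refine ContinuousLinearMap.opNorm_le_bound _ (norm_nonneg _) fun c => ?_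
  rw [mul_comm]
  exact c.le_opNorm v

/-- Each partial derivative is the evaluation of one slot of the Fréchet derivative at a unit
vector, so nothing is lost in this direction. -/
theorem norm_iteratedFDeriv_classicalD_le {f : E m → ℝ} (hf : ContDiff ℝ (⊤ : ℕ∞) f)
    (α : MultiIndex m) (k : ℕ) (x : E m) :
    ‖iteratedFDeriv ℝ k (classicalD α f) x‖ ≤ ‖iteratedFDeriv ℝ (k + α.order) f x‖ := by
  induction α using multiIndex_induction generalizing k with
  | h0 => rw [classicalD_zero, order_zero, add_zero]
  | hs α i ih =>
    rw [classicalD_add_single hf, order_add_single]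
    refine (norm_iteratedFDeriv_fderiv_apply_le (contDiff_classicalD hf α) k x _).trans ?_
    rw [norm_single_one, one_mul]
    refine (ih (k + 1)).trans (le_of_eq ?_)
    rw [add_right_comm, add_assoc]

theorem abs_classicalD_le {f : E m → ℝ} (hf : ContDiff ℝ (⊤ : ℕ∞) f)
    (α : MultiIndex m) (x : E m) :
    |classicalD α f x| ≤ ‖iteratedFDeriv ℝ α.order f x‖ := by
  have := norm_iteratedFDeriv_classicalD_le hf α 0 x
  rwa [norm_iteratedFDeriv_zero, zero_add] at this

/-- Bounds on the partial derivatives of order `k` bound the `k`-th iterated derivative. -/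
theorem norm_iteratedFDeriv_le_of_classicalD {f : E m → ℝ} (hf : ContDiff ℝ (⊤ : ℕ∞) f) (k : ℕ)
    (x : E m) {c : ℝ} (h : ∀ α : MultiIndex m, α.order = k → |classicalD α f x| ≤ c) :
    ‖iteratedFDeriv ℝ k f x‖ ≤ (m + 1 : ℝ) ^ k * c := by
  induction k generalizing f with
  | zero =>
    rw [norm_iteratedFDeriv_zero]
    have := h 0 order_zero
    rw [classicalD_zero] at this
    simpa using this
  | succ k ih =>
    refine (norm_iteratedFDeriv_succ_le hf k x).trans ?_
    refine (Finset.sum_le_sum fun i _ => ih (contDiff_partialD hf i) fun α hα => ?_).trans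
      (le_of_eq ?_)
    · rw [← classicalD_add_single' hf]
      exact h _ (by rw [order_add_single, hα])
    · rw [Finset.sum_const, Finset.card_univ, Fintype.card_fin, nsmul_eq_mul, pow_succ]
      push_cast; ring

theorem partialD_sub {f g : E m → ℝ} (hf : ContDiff ℝ (⊤ : ℕ∞) f) (hg : ContDiff ℝ (⊤ : ℕ∞) g)
    (i : Fin (m + 1)) : partialD i (f - g) = partialD i f - partialD i g := by
  funext x
  have h1 := hf.differentiable (by simp) x
  have h2 := hg.differentiable (by simp) x
  simp [partialD, fderiv_sub h1 h2]

theorem classicalD_sub {f g : E m → ℝ} (hf : ContDiff ℝ (⊤ : ℕ∞) f)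
    (hg : ContDiff ℝ (⊤ : ℕ∞) g) (α : MultiIndex m) :
    classicalD α (f - g) = classicalD α f - classicalD α g := by
  induction α using multiIndex_induction with
  | h0 => simp [classicalD_zero]
  | hs α i ih =>
    rw [classicalD_add_single (f := f - g) (hf.sub hg), classicalD_add_single hf, classicalD_add_single hg, ih,
      partialD_sub (contDiff_classicalD hf α) (contDiff_classicalD hg α)]

theorem tsupport_partialD_subset (f : E m → ℝ) (i : Fin (m + 1)) :
    tsupport (partialD i f) ⊆ tsupport f := by
  refine closure_minimal ?_ (isClosed_tsupport f)
  intro x hx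
  exact support_fderiv_subset ℝ (fun h => hx (by simp [partialD, h]))

theorem tsupport_classicalD_subset {f : E m → ℝ} (hf : ContDiff ℝ (⊤ : ℕ∞) f) (α : MultiIndex m) :
    tsupport (classicalD α f) ⊆ tsupport f := by
  induction α using multiIndex_induction with
  | h0 => rw [classicalD_zero]
  | hs α i ih =>
    rw [classicalD_add_single hf]
    exact (tsupport_partialD_subset _ i).trans ih

theorem hasCompactSupport_classicalD {f : E m → ℝ} (hf : ContDiff ℝ (⊤ : ℕ∞) f)
    (hc : HasCompactSupport f) (α : MultiIndex m) : HasCompactSupport (classicalD α f) :=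
  hc.of_isClosed_subset (isClosed_tsupport _) (tsupport_classicalD_subset hf α)

/-- Source of the positive powers of the scale: the moment estimate is applied to a function
rescaled by `τ`, and each derivative then yields one factor `τ`. -/
theorem norm_iteratedFDeriv_comp_affine_le {f : E m → ℝ} (hf : ContDiff ℝ (⊤ : ℕ∞) f) (k : ℕ)
    (x q : E m) (τ : ℝ) :
    ‖iteratedFDeriv ℝ k (fun q => f (x - τ • q)) q‖ ≤
      |τ| ^ k * ‖iteratedFDeriv ℝ k f (x - τ • q)‖ := by
  set L : E m →L[ℝ] E m := -(τ • ContinuousLinearMap.id ℝ (E m)) with hL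
  have e : (fun q => f (x - τ • q)) = (fun y => f (x + y)) ∘ L := by
    funext q; simp [hL, sub_eq_add_neg]
  have hs : ContDiff ℝ k (fun y => f (x + y)) :=
    (hf.comp (contDiff_const.add contDiff_id)).of_le (by exact_mod_cast le_top)
  rw [e, L.iteratedFDeriv_comp_right hs q (i := k) le_rfl, iteratedFDeriv_comp_add_left]
  refine (ContinuousMultilinearMap.norm_compContinuousLinearMap_le _ _).trans ?_
  have hn : ‖L‖ ≤ |τ| := by
    rw [hL, norm_neg, norm_smul, Real.norm_eq_abs]
    exact mul_le_of_le_one_right (abs_nonneg _) ContinuousLinearMap.norm_id_le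
  have e2 : x + L q = x - τ • q := by simp [hL, sub_eq_add_neg]
  rw [e2, mul_comm, Finset.prod_const, Finset.card_univ, Fintype.card_fin]
  gcongr

end BurenkovMorrey

end

noncomputable section

namespace BurenkovMorrey

/-! ### Weak derivatives with pointwise bounds -/

variable {m : ℕ}

/-- A test function on `Ω`. -/
structure IsTest (Ω : Set (E m)) (η : E m → ℝ) : Prop where
  smooth : ContDiff ℝ (⊤ : ℕ∞) η
  compact : HasCompactSupport η
  supp : tsupport η ⊆ Ω

/-- `g` is a weak derivative of `f` in direction `v` on `Ω`. -/
def HasWeakDir (Ω : Set (E m)) (v : E m) (f g : E m → ℝ) : Prop :=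
  ∀ η, IsTest Ω η → ∫ x, f x * fderiv ℝ η x v = -∫ x, g x * η x

theorem IsTest.mono {Ω Ω' : Set (E m)} {η : E m → ℝ} (h : IsTest Ω η) (hs : Ω ⊆ Ω') :
    IsTest Ω' η := ⟨h.smooth, h.compact, h.supp.trans hs⟩

theorem tsupport_fderiv_apply_subset (η : E m → ℝ) (v : E m) :
    tsupport (fun x => fderiv ℝ η x v) ⊆ tsupport η := by
  refine closure_minimal ?_ (isClosed_tsupport η)
  intro x hx
  exact support_fderiv_subset ℝ (fun h => hx (by simp [h]))

theorem IsTest.fderiv {Ω : Set (E m)} {η : E m → ℝ} (h : IsTest Ω η) (v : E m) :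
    IsTest Ω (fun x => fderiv ℝ η x v) where
  smooth := (h.smooth.fderiv_right (m := (⊤ : ℕ∞)) (by simp)).clm_apply contDiff_const
  compact := h.compact.of_isClosed_subset (isClosed_tsupport _) (tsupport_fderiv_apply_subset η v)
  supp := (tsupport_fderiv_apply_subset η v).trans h.supp

theorem IsTest.classicalD {Ω : Set (E m)} {η : E m → ℝ} (h : IsTest Ω η) (α : MultiIndex m) :
    IsTest Ω (classicalD α η) where
  smooth := contDiff_classicalD h.smooth α
  compact := hasCompactSupport_classicalD h.smooth h.compact α
  supp := (tsupport_classicalD_subset h.smooth α).trans h.supp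

theorem IsTest.eq_zero {Ω : Set (E m)} {η : E m → ℝ} (h : IsTest Ω η) {x : E m} (hx : x ∉ Ω) :
    η x = 0 := image_eq_zero_of_notMem_tsupport (fun h' => hx (h.supp h'))

theorem IsTest.integrable_mul {Ω : Set (E m)} {η : E m → ℝ} (h : IsTest Ω η) {f : E m → ℝ}
    (hf : LocallyIntegrableOn f Ω) : Integrable (fun x => f x * η x) := by
  have h1 : IntegrableOn f (tsupport η) := hf.integrableOn_compact_subset h.supp h.compact
  have h2 : IntegrableOn (fun x => f x * η x) (tsupport η) :=
    h1.mul_continuousOn h.smooth.continuous.continuousOn h.compact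
  refine (integrableOn_iff_integrable_of_support_subset ?_).1 h2
  intro x hx
  by_contra hx'
  exact hx (by simp [image_eq_zero_of_notMem_tsupport hx'])

theorem IsTest.setIntegral_mul {Ω : Set (E m)} {η : E m → ℝ} (h : IsTest Ω η) (f : E m → ℝ) :
    ∫ x in Ω, f x * η x = ∫ x, f x * η x :=
  setIntegral_eq_integral_of_forall_compl_eq_zero fun x hx => by rw [h.eq_zero hx, mul_zero]

theorem IsTest.integral_congr {Ω : Set (E m)} {η : E m → ℝ} (h : IsTest Ω η) {f g : E m → ℝ}
    (hfg : ∀ᵐ x, x ∈ Ω → f x = g x) : ∫ x, f x * η x = ∫ x, g x * η x := by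
  refine integral_congr_ae ?_
  filter_upwards [hfg] with x hx
  by_cases hxΩ : x ∈ Ω
  · simp only [hx hxΩ]
  · simp only [h.eq_zero hxΩ, mul_zero]

theorem HasWeakDir.mono {Ω Ω' : Set (E m)} {v : E m} {f g : E m → ℝ} (h : HasWeakDir Ω v f g)
    (hs : Ω' ⊆ Ω) : HasWeakDir Ω' v f g := fun η hη => h η (hη.mono hs)

theorem HasWeakDir.congr {Ω : Set (E m)} {v : E m} {f g f' g' : E m → ℝ} (h : HasWeakDir Ω v f g)
    (hf : ∀ᵐ x, x ∈ Ω → f' x = f x) (hg : ∀ᵐ x, x ∈ Ω → g' x = g x) : HasWeakDir Ω v f' g' := by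
  intro η hη
  rw [(hη.fderiv v).integral_congr hf, hη.integral_congr hg]
  exact h η hη

/-- `f` has weak derivatives up to order `k` on `Ω`, and those of order `j` are bounded by `N j`.
Derivatives are iterated derivatives in the direction of vectors of norm at most one. -/
def WeakBound (Ω : Set (E m)) : ℕ → (ℕ → E m → ℝ≥0∞) → (E m → ℝ) → Prop
  | 0, N, f => LocallyIntegrableOn f Ω ∧ ∀ᵐ x, x ∈ Ω → ‖f x‖ₑ ≤ N 0 x
  | k + 1, N, f => (LocallyIntegrableOn f Ω ∧ ∀ᵐ x, x ∈ Ω → ‖f x‖ₑ ≤ N 0 x) ∧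
      ∀ v : E m, ‖v‖ ≤ 1 → ∃ g, HasWeakDir Ω v f g ∧ WeakBound Ω k (fun j => N (j + 1)) g

theorem WeakBound.base {Ω : Set (E m)} {k : ℕ} {N : ℕ → E m → ℝ≥0∞} {f : E m → ℝ}
    (h : WeakBound Ω k N f) : LocallyIntegrableOn f Ω ∧ ∀ᵐ x, x ∈ Ω → ‖f x‖ₑ ≤ N 0 x := by
  cases k with
  | zero => exact h
  | succ k => exact h.1

theorem WeakBound.pred {Ω : Set (E m)} {k : ℕ} {N : ℕ → E m → ℝ≥0∞} {f : E m → ℝ}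
    (h : WeakBound Ω (k + 1) N f) : WeakBound Ω k N f := by
  induction k generalizing N f with
  | zero => exact h.1
  | succ k ih =>
    refine ⟨h.1, fun v hv => ?_⟩
    obtain ⟨g, hg, hg'⟩ := h.2 v hv
    exact ⟨g, hg, ih hg'⟩

theorem WeakBound.mono {Ω Ω' : Set (E m)} {k : ℕ} {N N' : ℕ → E m → ℝ≥0∞} {f : E m → ℝ}
    (h : WeakBound Ω k N f) (hs : Ω' ⊆ Ω) (hN : ∀ j, ∀ᵐ x, x ∈ Ω' → N j x ≤ N' j x) :
    WeakBound Ω' k N' f := by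
  induction k generalizing N N' f with
  | zero =>
    refine ⟨h.1.mono_set hs, ?_⟩
    filter_upwards [h.2, hN 0] with x h1 h2 hx using (h1 (hs hx)).trans (h2 hx)
  | succ k ih =>
    refine ⟨⟨h.1.1.mono_set hs, ?_⟩, fun v hv => ?_⟩
    · filter_upwards [h.1.2, hN 0] with x h1 h2 hx using (h1 (hs hx)).trans (h2 hx)
    obtain ⟨g, hg, hg'⟩ := h.2 v hv
    exact ⟨g, hg.mono hs, ih hg' fun j => hN (j + 1)⟩

theorem locallyIntegrableOn_congr {Ω : Set (E m)} (hΩ : MeasurableSet Ω) {f f' : E m → ℝ}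
    (h : LocallyIntegrableOn f Ω) (hf : ∀ᵐ x, x ∈ Ω → f' x = f x) : LocallyIntegrableOn f' Ω := by
  intro x hx
  obtain ⟨U, hU, hfU⟩ := h x hx
  refine ⟨U ∩ Ω, Filter.inter_mem hU self_mem_nhdsWithin, ?_⟩
  refine (hfU.mono_set inter_subset_left).congr ?_
  have : ∀ᵐ x ∂(volume.restrict Ω), f' x = f x := (ae_restrict_iff' hΩ).2 hf
  exact (ae_restrict_of_ae_restrict_of_subset inter_subset_right this).mono fun x h => h.symm

theorem WeakBound.congr {Ω : Set (E m)} (hΩ : MeasurableSet Ω) {k : ℕ} {N : ℕ → E m → ℝ≥0∞}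
    {f f' : E m → ℝ} (h : WeakBound Ω k N f) (hf : ∀ᵐ x, x ∈ Ω → f' x = f x) :
    WeakBound Ω k N f' := by
  have hb : LocallyIntegrableOn f' Ω ∧ ∀ᵐ x, x ∈ Ω → ‖f' x‖ₑ ≤ N 0 x := by
    refine ⟨locallyIntegrableOn_congr hΩ h.base.1 hf, ?_⟩
    filter_upwards [h.base.2, hf] with x h1 h2 hx
    rw [h2 hx]; exact h1 hx
  cases k with
  | zero => exact hb
  | succ k =>
    refine ⟨hb, fun v hv => ?_⟩
    obtain ⟨g, hg, hg'⟩ := h.2 v hv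
    exact ⟨g, hg.congr hf (Filter.Eventually.of_forall fun _ _ => rfl), hg'⟩

theorem HasWeakDir.add {Ω : Set (E m)} {v : E m} {f g f' g' : E m → ℝ}
    (hf : LocallyIntegrableOn f Ω) (hg : LocallyIntegrableOn g Ω)
    (hf' : LocallyIntegrableOn f' Ω) (hg' : LocallyIntegrableOn g' Ω)
    (h : HasWeakDir Ω v f g) (h' : HasWeakDir Ω v f' g') :
    HasWeakDir Ω v (f + f') (g + g') := by
  intro η hη
  simp only [Pi.add_apply, add_mul]
  rw [integral_add ((hη.fderiv v).integrable_mul hf) ((hη.fderiv v).integrable_mul hf'),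
    integral_add (hη.integrable_mul hg) (hη.integrable_mul hg'), h η hη, h' η hη]
  ring

theorem WeakBound.add {Ω : Set (E m)} {k : ℕ} {N N' : ℕ → E m → ℝ≥0∞} {f f' : E m → ℝ}
    (h : WeakBound Ω k N f) (h' : WeakBound Ω k N' f') :
    WeakBound Ω k (fun j x => N j x + N' j x) (f + f') := by
  induction k generalizing N N' f f' with
  | zero =>
    refine ⟨h.1.add h'.1, ?_⟩
    filter_upwards [h.2, h'.2] with x h1 h2 hx
    exact (enorm_add_le _ _).trans (add_le_add (h1 hx) (h2 hx))
  | succ k ih =>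
    refine ⟨⟨h.1.1.add h'.1.1, ?_⟩, fun v hv => ?_⟩
    · filter_upwards [h.1.2, h'.1.2] with x h1 h2 hx
      exact (enorm_add_le _ _).trans (add_le_add (h1 hx) (h2 hx))
    obtain ⟨g, hg, hgW⟩ := h.2 v hv
    obtain ⟨g', hg', hgW'⟩ := h'.2 v hv
    exact ⟨g + g', hg.add h.1.1 hgW.base.1 h'.1.1 hgW'.base.1 hg', ih hgW hgW'⟩

theorem HasWeakDir.const_mul {Ω : Set (E m)} {v : E m} {f g : E m → ℝ} (c : ℝ)
    (h : HasWeakDir Ω v f g) : HasWeakDir Ω v (fun x => c * f x) (fun x => c * g x) := by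
  intro η hη
  simp only [mul_assoc]
  rw [integral_const_mul, integral_const_mul, h η hη]
  ring

theorem locallyIntegrableOn_const_mul {Ω : Set (E m)} {f : E m → ℝ} (c : ℝ)
    (h : LocallyIntegrableOn f Ω) : LocallyIntegrableOn (fun x => c * f x) Ω := by
  intro x hx
  obtain ⟨U, hU, hf⟩ := h x hx
  exact ⟨U, hU, hf.const_mul c⟩

theorem WeakBound.const_mul {Ω : Set (E m)} {k : ℕ} {N : ℕ → E m → ℝ≥0∞} {f : E m → ℝ} (c : ℝ)
    (hc : |c| ≤ 1) (h : WeakBound Ω k N f) : WeakBound Ω k N (fun x => c * f x) := by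
  have key : ∀ {f : E m → ℝ} {M : E m → ℝ≥0∞}, (∀ᵐ x, x ∈ Ω → ‖f x‖ₑ ≤ M x) →
      ∀ᵐ x, x ∈ Ω → ‖c * f x‖ₑ ≤ M x := by
    intro f M h
    filter_upwards [h] with x h1 hx
    rw [enorm_mul]
    refine le_trans ?_ (h1 hx)
    refine mul_le_of_le_one_left' ?_
    rw [Real.enorm_eq_ofReal_abs]
    exact ENNReal.ofReal_le_one.2 hc
  induction k generalizing N f with
  | zero => exact ⟨locallyIntegrableOn_const_mul c h.1, key h.2⟩
  | succ k ih =>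
    refine ⟨⟨locallyIntegrableOn_const_mul c h.1.1, key h.1.2⟩, fun v hv => ?_⟩
    obtain ⟨g, hg, hgW⟩ := h.2 v hv
    exact ⟨_, hg.const_mul c, ih hgW⟩

theorem weakBound_zero (Ω : Set (E m)) (k : ℕ) (N : ℕ → E m → ℝ≥0∞) :
    WeakBound Ω k N 0 := by
  have hb : ∀ N : ℕ → E m → ℝ≥0∞, LocallyIntegrableOn (0 : E m → ℝ) Ω ∧
      ∀ᵐ x, x ∈ Ω → ‖(0 : E m → ℝ) x‖ₑ ≤ N 0 x :=
    fun N => ⟨locallyIntegrable_zero.locallyIntegrableOn Ω,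
      Filter.Eventually.of_forall fun x _ => by simp⟩
  induction k generalizing N with
  | zero => exact hb N
  | succ k ih => exact ⟨hb N, fun v _ => ⟨0, fun η _ => by simp, ih _⟩⟩

theorem WeakBound.sum {ι : Type*} (s : Finset ι) {Ω : Set (E m)} {k : ℕ}
    {N : ι → ℕ → E m → ℝ≥0∞} {f : ι → E m → ℝ} (h : ∀ i ∈ s, WeakBound Ω k (N i) (f i)) :
    WeakBound Ω k (fun j x => ∑ i ∈ s, N i j x) (∑ i ∈ s, f i) := by
  classical
  induction s using Finset.induction_on with
  | empty => simpa using weakBound_zero Ω k _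
  | insert a s ha ih =>
    simp only [Finset.sum_insert ha]
    exact (h a (Finset.mem_insert_self _ _)).add
      (ih fun i hi => h i (Finset.mem_insert_of_mem hi))

/-- Linearity in the direction, used to pass from coordinate directions to arbitrary vectors. -/
theorem HasWeakDir.sum_apply {ι : Type*} (s : Finset ι) {Ω : Set (E m)} {f : E m → ℝ}
    {w : ι → E m} {c : ι → ℝ} {g : ι → E m → ℝ} (hf : LocallyIntegrableOn f Ω)
    (hg : ∀ i ∈ s, LocallyIntegrableOn (g i) Ω) (h : ∀ i ∈ s, HasWeakDir Ω (w i) f (g i)) :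
    HasWeakDir Ω (∑ i ∈ s, c i • w i) f (∑ i ∈ s, fun x => c i * g i x) := by
  intro η hη
  have e1 : ∀ x, f x * fderiv ℝ η x (∑ i ∈ s, c i • w i)
      = ∑ i ∈ s, c i * (f x * fderiv ℝ η x (w i)) := by
    intro x
    simp only [map_sum, map_smul, smul_eq_mul, Finset.mul_sum]
    exact Finset.sum_congr rfl fun i _ => by ring
  have e2 : ∀ x, (∑ i ∈ s, fun x => c i * g i x) x * η x = ∑ i ∈ s, c i * (g i x * η x) := by
    intro x
    simp only [Finset.sum_apply, Finset.sum_mul]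
    exact Finset.sum_congr rfl fun i _ => by ring
  simp only [e1, e2]
  rw [integral_finsetSum s fun i _ => ((hη.fderiv (w i)).integrable_mul hf).const_mul _,
    integral_finsetSum s fun i hi => (hη.integrable_mul (hg i hi)).const_mul _,
    ← Finset.sum_neg_distrib]
  refine Finset.sum_congr rfl fun i hi => ?_
  rw [integral_const_mul, integral_const_mul, h i hi η hη]
  ring

/-! #### Weak derivatives of Sobolev functions -/

/-- Testing `D^β f` with `∂_i η` and `D^{β+e_i} f` with `η` evaluates the same integral of `f`
against `D^{β+e_i} η`; the powers of `-1` differ by one sign. -/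
theorem HasWeakDeriv.hasWeakDir {Ω : Set (E m)} {f g h : E m → ℝ} {β : MultiIndex m}
    {i : Fin (m + 1)} (hg : HasWeakDeriv Ω β f g)
    (hh : HasWeakDeriv Ω (β + Pi.single i 1) f h) :
    HasWeakDir Ω (EuclideanSpace.single i 1) g h := by
  intro η hη
  have hη' := hη.fderiv (EuclideanSpace.single i 1)
  have h1 := hg.2.2 _ hη'.smooth hη'.compact hη'.supp
  have h2 := hh.2.2 η hη.smooth hη.compact hη.supp
  rw [classicalD_add_single' hη.smooth, order_add_single] at h2
  change ∫ x in Ω, f x * BurenkovMorrey.classicalD β (partialD i η) x = _ at h1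
  rw [h1, hη'.setIntegral_mul, hη.setIntegral_mul, pow_succ] at h2
  have hne : ((-1 : ℝ) ^ β.order) ≠ 0 := pow_ne_zero _ (by norm_num)
  have h3 := mul_left_cancel₀ hne (h2.trans (by ring :
    _ = (-1 : ℝ) ^ β.order * (-∫ x, h x * η x)))
  exact h3

/-- The sum of the absolute values of the derivatives of order `j`. -/
def orderSum (F : MultiIndex m → E m → ℝ) (j : ℕ) (x : E m) : ℝ≥0∞ :=
  ∑ β ∈ (multiIndexLE m j).filter (fun β => β.order = j), ‖F β x‖ₑ

/-- A derivative along `v` with `‖v‖ ≤ 1` is a sum of `m + 1` partial derivatives with coefficients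
at most one in absolute value, so each order costs a factor `m + 1`. -/
theorem weakBound_of_hasWeakDeriv {Ω : Set (E m)} {f : E m → ℝ} {F : MultiIndex m → E m → ℝ}
    {l : ℕ} (hF : ∀ β : MultiIndex m, β.order ≤ l → HasWeakDeriv Ω β f (F β)) (k : ℕ)
    (β : MultiIndex m) (hβ : β.order + k ≤ l) :
    WeakBound Ω k (fun j x => (m + 1 : ℝ≥0∞) ^ j * orderSum F (β.order + j) x) (F β) := by
  have hb : LocallyIntegrableOn (F β) Ω ∧ ∀ᵐ x, x ∈ Ω →
      ‖F β x‖ₑ ≤ (m + 1 : ℝ≥0∞) ^ 0 * orderSum F (β.order + 0) x := by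
    refine ⟨(hF β (by omega)).2.1, Filter.Eventually.of_forall fun x _ => ?_⟩
    rw [pow_zero, one_mul, add_zero]
    exact Finset.single_le_sum (f := fun β => ‖F β x‖ₑ) (fun _ _ => zero_le)
      (Finset.mem_filter.2 ⟨(mem_multiIndexLE β).2 le_rfl, rfl⟩)
  induction k generalizing β with
  | zero => exact hb
  | succ k ih =>
    refine ⟨hb, fun v hv => ?_⟩
    have hl : ∀ i : Fin (m + 1), HasWeakDeriv Ω (β + Pi.single i 1) f (F (β + Pi.single i 1)) :=
      fun i => hF _ (by rw [order_add_single]; omega)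
    refine ⟨∑ i, fun x => v i * F (β + Pi.single i 1) x, ?_, ?_⟩
    · have := HasWeakDir.sum_apply (Finset.univ) (c := fun i => v i) hb.1
        (fun i _ => (hl i).2.1) (fun i _ => (hF β (by omega)).hasWeakDir (hl i))
      rwa [sum_single_eq] at this
    · have hs := WeakBound.sum (Finset.univ : Finset (Fin (m + 1))) (Ω := Ω) (k := k)
        (N := fun _ j x => (m + 1 : ℝ≥0∞) ^ j * orderSum F (β.order + 1 + j) x)
        (f := fun i x => v i * F (β + Pi.single i 1) x) (fun i _ => by
          refine WeakBound.const_mul (v i) ?_ ?_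
          · exact (PiLp.norm_apply_le v i).trans hv
          · have := ih (β + Pi.single i 1) (by rw [order_add_single]; omega)
              ⟨(hl i).2.1, Filter.Eventually.of_forall fun x _ => by
                rw [pow_zero, one_mul, add_zero]
                exact Finset.single_le_sum (f := fun β => ‖F β x‖ₑ) (fun _ _ => zero_le)
                  (Finset.mem_filter.2 ⟨(mem_multiIndexLE _).2 le_rfl, rfl⟩)⟩
            simpa only [order_add_single] using this)
      refine hs.mono subset_rfl fun j => Filter.Eventually.of_forall fun x _ => le_of_eq ?_
      simp only [Finset.sum_const, Finset.card_univ, Fintype.card_fin, nsmul_eq_mul]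
      rw [pow_succ, add_right_comm, add_assoc β.order]
      push_cast; ring

theorem WeakBound.exists_hasWeakDeriv {Ω : Set (E m)} {k : ℕ} {N : ℕ → E m → ℝ≥0∞} {f : E m → ℝ}
    (h : WeakBound Ω k N f) (α : MultiIndex m) (hα : α.order ≤ k) :
    ∃ g, HasWeakDeriv Ω α f g ∧ ∀ᵐ x, x ∈ Ω → ‖g x‖ₑ ≤ N α.order x := by
  induction α using multiIndex_induction generalizing k N f with
  | h0 =>
    refine ⟨f, ⟨h.base.1, h.base.1, fun η _ _ _ => ?_⟩, ?_⟩
    · rw [classicalD_zero, order_zero]; simp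
    · rw [order_zero]; exact h.base.2
  | hs α i ih =>
    rw [order_add_single] at hα ⊢
    obtain ⟨k, rfl⟩ : ∃ k', k = k' + 1 := ⟨k - 1, by omega⟩
    obtain ⟨g, hg, hgW⟩ := h.2 (EuclideanSpace.single i 1) (norm_single_one i).le
    obtain ⟨g', hg', hgb⟩ := ih hgW (by omega)
    refine ⟨g', ⟨h.base.1, hg'.2.1, fun η h1 h2 h3 => ?_⟩, hgb⟩
    have hη : IsTest Ω η := ⟨h1, h2, h3⟩
    have e1 := hg _ (hη.classicalD α)
    have e2 := hg'.2.2 η h1 h2 h3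
    rw [(hη.classicalD α).setIntegral_mul] at e2
    rw [(hη.classicalD _).setIntegral_mul, classicalD_add_single h1, order_add_single, pow_succ]
    refine Eq.trans e1 ?_
    rw [e2]; ring

/-- Weak derivatives are unique almost everywhere. -/
theorem HasWeakDeriv.ae_unique {Ω : Set (E m)} (hΩ : IsOpen Ω) {α : MultiIndex m}
    {f g g' : E m → ℝ} (h : HasWeakDeriv Ω α f g) (h' : HasWeakDeriv Ω α f g') :
    ∀ᵐ x, x ∈ Ω → g x = g' x := by
  have := hΩ.ae_eq_zero_of_integral_contDiff_smul_eq_zero (f := g - g') (μ := volume)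
    (h.2.1.sub h'.2.1) fun η h1 h2 h3 => by
      have hη : IsTest Ω η := ⟨h1, h2, h3⟩
      have e1 := h.2.2 η h1 h2 h3
      rw [h'.2.2 η h1 h2 h3, hη.setIntegral_mul, hη.setIntegral_mul] at e1
      have hne : ((-1 : ℝ) ^ α.order) ≠ 0 := pow_ne_zero _ (by norm_num)
      have e2 := mul_left_cancel₀ hne e1
      have e3 : ∀ x, η x • (g - g') x = g x * η x - g' x * η x := by
        intro x; simp only [Pi.sub_apply, smul_eq_mul]; ring
      simp only [e3]
      rw [integral_sub (hη.integrable_mul h.2.1) (hη.integrable_mul h'.2.1), e2, sub_self]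
  filter_upwards [this] with _ hx hxΩ
  exact sub_eq_zero.1 (hx hxΩ)

theorem HasWeakDeriv.weakD {Ω : Set (E m)} {α : MultiIndex m} {f g : E m → ℝ}
    (h : HasWeakDeriv Ω α f g) : HasWeakDeriv Ω α f (weakD Ω α f) := by
  have hex : ∃ g, HasWeakDeriv Ω α f g := ⟨g, h⟩
  unfold BurenkovMorrey.weakD
  rw [dif_pos hex]
  exact hex.choose_spec

/-! #### Products with smooth functions and extension by zero -/

theorem isTest_mul {Ω Ω' : Set (E m)} {χ η : E m → ℝ} (hχ : ContDiff ℝ (⊤ : ℕ∞) χ)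
    (hs : tsupport χ ∩ Ω' ⊆ Ω) (hη : IsTest Ω' η) : IsTest Ω (fun x => χ x * η x) where
  smooth := hχ.mul hη.smooth
  compact := hη.compact.mul_left
  supp := fun x hx => hs ⟨tsupport_mul_subset_left hx, hη.supp (tsupport_mul_subset_right hx)⟩

theorem locallyIntegrableOn_indicator_mul {Ω Ω' : Set (E m)} (hΩ : IsOpen Ω) {χ f : E m → ℝ}
    (hχ : Continuous χ) (hs : tsupport χ ∩ Ω' ⊆ Ω) (hf : LocallyIntegrableOn f Ω) :
    LocallyIntegrableOn (Ω.indicator fun x => f x * χ x) Ω' := by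
  intro x hx
  by_cases hxs : x ∈ tsupport χ
  · have hxΩ := hs ⟨hxs, hx⟩
    have h1 : LocallyIntegrableOn (fun x => f x * χ x) Ω :=
      hf.mul_continuousOn hχ.continuousOn hΩ.isLocallyClosed
    have h2 := h1 x hxΩ
    rw [hΩ.nhdsWithin_eq hxΩ] at h2
    obtain ⟨U, hU, hfU⟩ := h2
    exact ⟨U, nhdsWithin_le_nhds hU, hfU.indicator hΩ.measurableSet⟩
  · refine ⟨(tsupport χ)ᶜ, nhdsWithin_le_nhds
      ((isClosed_tsupport χ).isOpen_compl.mem_nhds hxs), ?_⟩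
    have h0 : IntegrableOn (fun _ : E m => (0 : ℝ)) (tsupport χ)ᶜ := integrableOn_zero
    refine h0.congr_fun (fun y hy => ?_) (isClosed_tsupport χ).measurableSet.compl
    simp [indicator, image_eq_zero_of_notMem_tsupport hy]

/-- The product rule follows by testing with `χ η`. Since the support of `χ` meets `Ω'` only inside
`Ω`, the function `χ η` is a test function on `Ω`; this is why extension by zero creates no singular
part on `∂Ω ∩ Ω'`. -/
theorem HasWeakDir.indicator_mul {Ω Ω' : Set (E m)} {v : E m} {f g χ : E m → ℝ}
    (hf : LocallyIntegrableOn f Ω) (hg : LocallyIntegrableOn g Ω) (h : HasWeakDir Ω v f g)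
    (hχ : ContDiff ℝ (⊤ : ℕ∞) χ) (hs : tsupport χ ∩ Ω' ⊆ Ω) :
    HasWeakDir Ω' v (Ω.indicator fun x => f x * χ x)
      ((Ω.indicator fun x => g x * χ x) + Ω.indicator fun x => f x * fderiv ℝ χ x v) := by
  intro η hη
  have hχ' : ContDiff ℝ (⊤ : ℕ∞) (fun x => fderiv ℝ χ x v) :=
    (hχ.fderiv_right (m := (⊤ : ℕ∞)) (by simp)).clm_apply contDiff_const
  have hs' : tsupport (fun x => fderiv ℝ χ x v) ∩ Ω' ⊆ Ω :=
    (inter_subset_inter_left _ (tsupport_fderiv_apply_subset χ v)).trans hs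
  have h1 := isTest_mul hχ hs hη
  have h2 := isTest_mul hχ' hs' hη
  have h3 := h _ h1
  -- At points of the support of `χ` outside `Ω` the test function itself vanishes, so values of `f`
  -- off `Ω` never matter.
  have z : ∀ {x}, x ∉ Ω → x ∈ tsupport χ → η x = 0 ∧ fderiv ℝ η x v = 0 := by
    intro x hx hxs
    have hx' : x ∉ Ω' := fun hx' => hx (hs ⟨hxs, hx'⟩)
    exact ⟨hη.eq_zero hx', (hη.fderiv v).eq_zero hx'⟩
  have e1 : ∀ x, Ω.indicator (fun x => f x * χ x) x * fderiv ℝ η x v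
      = f x * fderiv ℝ (fun x => χ x * η x) x v - f x * (fderiv ℝ χ x v * η x) := by
    intro x
    rw [fderiv_fun_mul (hχ.differentiable (by simp) x) (hη.smooth.differentiable (by simp) x)]
    simp only [add_apply, smul_apply, smul_eq_mul]
    by_cases hx : x ∈ Ω
    · rw [indicator_of_mem hx]; ring
    · rw [indicator_of_notMem hx]
      by_cases hxs : x ∈ tsupport χ
      · rw [(z hx hxs).1, (z hx hxs).2]; ring
      · rw [image_eq_zero_of_notMem_tsupport hxs]; ring
  have e2 : ∀ x, ((Ω.indicator fun x => g x * χ x) +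
      Ω.indicator fun x => f x * fderiv ℝ χ x v) x * η x
      = g x * (χ x * η x) + f x * (fderiv ℝ χ x v * η x) := by
    intro x
    by_cases hx : x ∈ Ω
    · simp only [Pi.add_apply, indicator_of_mem hx]; ring
    · simp only [Pi.add_apply, indicator_of_notMem hx]
      by_cases hxs : x ∈ tsupport χ
      · rw [(z hx hxs).1]; ring
      · rw [image_eq_zero_of_notMem_tsupport hxs, image_eq_zero_of_notMem_tsupport
          (fun h => hxs (tsupport_fderiv_apply_subset χ v h))]; ring
  simp only [e1, e2]
  rw [integral_sub ((h1.fderiv v).integrable_mul hf) (h2.integrable_mul hf), h3,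
    integral_add (h1.integrable_mul hg) (h2.integrable_mul hf)]
  ring

/-- Weak bounds of the extension by zero of the product with a smooth function `χ`. -/
theorem WeakBound.indicator_mul {Ω Ω' : Set (E m)} (hΩ : IsOpen Ω) {k : ℕ}
    {N : ℕ → E m → ℝ≥0∞} {f χ : E m → ℝ} {P : ℝ≥0} (h : WeakBound Ω k N f)
    (hχ : ContDiff ℝ (⊤ : ℕ∞) χ) (hs : tsupport χ ∩ Ω' ⊆ Ω)
    (hP : ∀ i ≤ k, ∀ x, ‖iteratedFDeriv ℝ i χ x‖ ≤ P) :
    WeakBound Ω' k (fun j => Ω.indicator fun x => 2 ^ j * P * ∑ i ∈ Finset.range (j + 1), N i x)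
      (Ω.indicator fun x => f x * χ x) := by
  have hb : LocallyIntegrableOn (Ω.indicator fun x => f x * χ x) Ω' ∧ ∀ᵐ x, x ∈ Ω' →
      ‖Ω.indicator (fun x => f x * χ x) x‖ₑ ≤
        Ω.indicator (fun x => 2 ^ 0 * P * ∑ i ∈ Finset.range (0 + 1), N i x) x := by
    refine ⟨locallyIntegrableOn_indicator_mul hΩ hχ.continuous hs h.base.1, ?_⟩
    filter_upwards [h.base.2] with x h1 _
    by_cases hx : x ∈ Ω
    · rw [indicator_of_mem hx, indicator_of_mem hx, enorm_mul]
      have h2 : ‖χ x‖ₑ ≤ P := by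
        have := hP 0 (Nat.zero_le _) x
        rw [norm_iteratedFDeriv_zero] at this
        rw [enorm_le_coe]; exact this
      calc ‖f x‖ₑ * ‖χ x‖ₑ ≤ N 0 x * P := mul_le_mul' (h1 hx) h2
        _ = _ := by simp [mul_comm]
    · rw [indicator_of_notMem hx]; simp
  induction k generalizing N f χ with
  | zero => exact hb
  | succ k ih =>
    refine ⟨hb, fun v hv => ?_⟩
    obtain ⟨g, hg, hgW⟩ := h.2 v hv
    have hχ' : ContDiff ℝ (⊤ : ℕ∞) (fun x => fderiv ℝ χ x v) :=
      (hχ.fderiv_right (m := (⊤ : ℕ∞)) (by simp)).clm_apply contDiff_const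
    have hs' : tsupport (fun x => fderiv ℝ χ x v) ∩ Ω' ⊆ Ω :=
      (inter_subset_inter_left _ (tsupport_fderiv_apply_subset χ v)).trans hs
    have hP' : ∀ i ≤ k, ∀ x, ‖iteratedFDeriv ℝ i (fun x => fderiv ℝ χ x v) x‖ ≤ P := by
      intro i hi x
      refine (norm_iteratedFDeriv_fderiv_apply_le hχ i x v).trans ?_
      exact (mul_le_of_le_one_left (norm_nonneg _) hv).trans (hP (i + 1) (by omega) x)
    refine ⟨_, HasWeakDir.indicator_mul h.base.1 hgW.base.1 hg hχ hs, ?_⟩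
    have base : ∀ {f χ : E m → ℝ} {N : ℕ → E m → ℝ≥0∞}, LocallyIntegrableOn f Ω →
        (∀ᵐ x, x ∈ Ω → ‖f x‖ₑ ≤ N 0 x) → ContDiff ℝ (⊤ : ℕ∞) χ → (tsupport χ ∩ Ω' ⊆ Ω) →
        (∀ x, ‖iteratedFDeriv ℝ 0 χ x‖ ≤ P) →
        LocallyIntegrableOn (Ω.indicator fun x => f x * χ x) Ω' ∧ ∀ᵐ x, x ∈ Ω' →
        ‖Ω.indicator (fun x => f x * χ x) x‖ₑ ≤
        Ω.indicator (fun x => 2 ^ 0 * P * ∑ i ∈ Finset.range (0 + 1), N i x) x := by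
      intro f χ N hf hN hχ hs hP
      refine ⟨locallyIntegrableOn_indicator_mul hΩ hχ.continuous hs hf, ?_⟩
      filter_upwards [hN] with x h1 _
      by_cases hx : x ∈ Ω
      · rw [indicator_of_mem hx, indicator_of_mem hx, enorm_mul]
        have h2 : ‖χ x‖ₑ ≤ P := by
          have := hP x
          rw [norm_iteratedFDeriv_zero] at this
          rw [enorm_le_coe]; exact this
        calc ‖f x‖ₑ * ‖χ x‖ₑ ≤ N 0 x * P := mul_le_mul' (h1 hx) h2
          _ = _ := by simp [mul_comm]
      · rw [indicator_of_notMem hx]; simp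
    have w1 := ih hgW hχ hs (fun i hi => hP i (by omega))
      (base hgW.base.1 hgW.base.2 hχ hs (hP 0 (Nat.zero_le _)))
    have w2 := ih h.pred hχ' hs' hP' (base h.base.1 h.base.2 hχ' hs' (hP' 0 (Nat.zero_le _)))
    -- The product rule gives two terms, each bounded with the factor `2^j`; their sum accounts for
    -- `2^{j+1}` at the next order.
    refine (w1.add w2).mono subset_rfl fun j => Filter.Eventually.of_forall fun x _ => ?_
    by_cases hx : x ∈ Ω
    · simp only [indicator_of_mem hx]
      have s1 : ∑ i ∈ Finset.range (j + 1), N (i + 1) x ≤ ∑ i ∈ Finset.range (j + 1 + 1), N i x := by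
        rw [Finset.sum_range_succ' _ (j + 1)]; exact le_self_add
      have s2 : ∑ i ∈ Finset.range (j + 1), N i x ≤ ∑ i ∈ Finset.range (j + 1 + 1), N i x := by
        rw [Finset.sum_range_succ _ (j + 1)]; exact le_self_add
      calc _ ≤ 2 ^ j * P * ∑ i ∈ Finset.range (j + 1 + 1), N i x
            + 2 ^ j * P * ∑ i ∈ Finset.range (j + 1 + 1), N i x := by gcongr
        _ = _ := by ring
    · simp [indicator_of_notMem hx]

/-! #### Composition with isometries -/

/-- By Mazur–Ulam a surjective isometry is affine. Hence smoothness, norms of derivatives and volume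
are transported by the charts without constants. -/
theorem exists_linear_of_isometryEquiv (lam : E m ≃ᵢ E m) :
    ∃ (R : E m ≃ₗᵢ[ℝ] E m) (b : E m), (∀ x, lam x = R x + b) ∧
      ∀ y, lam.symm y = R.symm (y - b) := by
  refine ⟨lam.toRealLinearIsometryEquiv, lam 0, fun x => ?_, fun y => ?_⟩
  · simp [IsometryEquiv.toRealLinearIsometryEquiv_apply]
  · apply lam.injective
    have : ∀ x, lam x = lam.toRealLinearIsometryEquiv x + lam 0 := fun x => by
      simp [IsometryEquiv.toRealLinearIsometryEquiv_apply]
    rw [lam.apply_symm_apply, this]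
    simp

theorem contDiff_isometryEquiv (lam : E m ≃ᵢ E m) : ContDiff ℝ (⊤ : ℕ∞) lam := by
  obtain ⟨R, b, h, -⟩ := exists_linear_of_isometryEquiv lam
  have : (lam : E m → E m) = fun x => R x + b := funext h
  rw [this]
  exact R.contDiff.add contDiff_const

theorem measurePreserving_isometryEquiv (lam : E m ≃ᵢ E m) :
    MeasurePreserving lam volume volume := by
  obtain ⟨R, b, h, -⟩ := exists_linear_of_isometryEquiv lam
  have : (lam : E m → E m) = (fun x => x + b) ∘ R := funext h
  rw [this]
  exact (measurePreserving_add_right volume b).comp R.measurePreserving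

theorem norm_iteratedFDeriv_comp_isometryEquiv (lam : E m ≃ᵢ E m) {f : E m → ℝ} (k : ℕ)
    (x : E m) : ‖iteratedFDeriv ℝ k (fun y => f (lam y)) x‖ = ‖iteratedFDeriv ℝ k f (lam x)‖ := by
  obtain ⟨R, b, h, -⟩ := exists_linear_of_isometryEquiv lam
  have e : (fun y => f (lam y)) = (fun y => f (y + b)) ∘ R := by funext y; simp [h]
  rw [e, R.norm_iteratedFDeriv_comp_right, iteratedFDeriv_comp_add_right, h]

theorem HasWeakDir.comp_isometry {Ω : Set (E m)} {v : E m} {f g : E m → ℝ} (lam : E m ≃ᵢ E m)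
    {R : E m ≃ₗᵢ[ℝ] E m} {b : E m} (hR : ∀ x, lam x = R x + b) (h : HasWeakDir Ω v f g) :
    HasWeakDir (lam '' Ω) (R v) (fun y => f (lam.symm y)) (fun y => g (lam.symm y)) := by
  intro η hη
  have hmp := measurePreserving_isometryEquiv lam
  have hme : MeasurableEmbedding lam := lam.toHomeomorph.measurableEmbedding
  have ht : IsTest Ω (fun x => η (lam x)) := by
    refine ⟨hη.smooth.comp (contDiff_isometryEquiv lam),
      hη.compact.comp_homeomorph lam.toHomeomorph, ?_⟩
    intro x hx
    have : lam x ∈ tsupport η := by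
      have := tsupport_comp_eq_preimage η lam.toHomeomorph
      change x ∈ tsupport (η ∘ lam.toHomeomorph) at hx
      rw [this] at hx
      exact hx
    obtain ⟨y, hy, hyx⟩ := hη.supp this
    rwa [← lam.injective hyx]
  have hd : ∀ x, fderiv ℝ (fun x => η (lam x)) x v = fderiv ℝ η (lam x) (R v) := by
    intro x
    have h1 : HasFDerivAt lam (R : E m →L[ℝ] E m) x := by
      have : (lam : E m → E m) = fun x => R x + b := funext hR
      rw [this]
      exact (R : E m →L[ℝ] E m).hasFDerivAt.add_const b
    have h2 := (hη.smooth.differentiable (by simp) (lam x)).hasFDerivAt.comp x h1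
    have h3 : fderiv ℝ (fun x => η (lam x)) x = _ := h2.fderiv
    rw [h3]; rfl
  have := h _ ht
  rw [← hmp.integral_comp hme (fun y => f (lam.symm y) * fderiv ℝ η y (R v)),
    ← hmp.integral_comp hme (fun y => g (lam.symm y) * η y)]
  simpa only [lam.symm_apply_apply, hd] using this

/-- An isometry rotates directions. Because `WeakBound` admits all vectors of norm at most one, and
not only coordinate vectors, the majorants are carried over unchanged. -/
theorem WeakBound.comp_isometry {Ω : Set (E m)} {k : ℕ} {N : ℕ → E m → ℝ≥0∞} {f : E m → ℝ}
    (lam : E m ≃ᵢ E m) (h : WeakBound Ω k N f) :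
    WeakBound (lam '' Ω) k (fun j y => N j (lam.symm y)) (fun y => f (lam.symm y)) := by
  obtain ⟨R, b, hR, -⟩ := exists_linear_of_isometryEquiv lam
  have hb : ∀ {N : E m → ℝ≥0∞} {f : E m → ℝ}, (LocallyIntegrableOn f Ω ∧
      ∀ᵐ x, x ∈ Ω → ‖f x‖ₑ ≤ N x) → (LocallyIntegrableOn (fun y => f (lam.symm y)) (lam '' Ω) ∧
      ∀ᵐ y, y ∈ lam '' Ω → ‖f (lam.symm y)‖ₑ ≤ N (lam.symm y)) := by
    intro N f h
    have hmp := measurePreserving_isometryEquiv lam.symm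
    constructor
    · rintro _ ⟨x, hx, rfl⟩
      obtain ⟨U, hU, hfU⟩ := h.1 x hx
      refine ⟨lam '' U, ?_, ?_⟩
      · have := lam.toHomeomorph.isInducing.map_nhdsWithin_eq Ω x
        have h2 : lam '' U ∈ Filter.map lam (nhdsWithin x Ω) := Filter.image_mem_map hU
        change lam '' U ∈ nhdsWithin (lam.toHomeomorph x) (lam.toHomeomorph '' Ω)
        rw [← this]; exact h2
      · have e : lam '' U = lam.symm ⁻¹' U := lam.image_eq_preimage_symm U
        rw [e]
        exact (hmp.integrableOn_comp_preimage lam.symm.toHomeomorph.measurableEmbedding).2 hfU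
    · have := hmp.quasiMeasurePreserving.ae h.2
      filter_upwards [this] with y hy hyΩ
      apply hy
      obtain ⟨x, hx, rfl⟩ := hyΩ
      simpa using hx
  induction k generalizing N f with
  | zero => exact hb h
  | succ k ih =>
    refine ⟨hb h.1, fun v hv => ?_⟩
    obtain ⟨g, hg, hgW⟩ := h.2 (R.symm v) (by simpa using hv)
    refine ⟨fun y => g (lam.symm y), ?_, ih hgW⟩
    have := hg.comp_isometry lam hR
    rwa [R.apply_symm_apply] at this

end BurenkovMorrey

end

noncomputable section

namespace BurenkovMorrey

/-! ### Mollification with a kernel supported in the lower part of a cone -/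

variable {m : ℕ}

/-! ### Splitting off the last coordinate. -/

@[simp] theorem bar_sub (x y : E m) : bar (x - y) = bar x - bar y := by ext i; rfl

@[simp] theorem bar_add (x y : E m) : bar (x + y) = bar x + bar y := by ext i; rfl

@[simp] theorem bar_smul (c : ℝ) (x : E m) : bar (c • x) = c • bar x := by ext i; rfl

@[simp] theorem lastCoord_sub (x y : E m) : lastCoord (x - y) = lastCoord x - lastCoord y := rfl

@[simp] theorem lastCoord_add (x y : E m) : lastCoord (x + y) = lastCoord x + lastCoord y := rfl

@[simp] theorem lastCoord_smul (c : ℝ) (x : E m) : lastCoord (c • x) = c * lastCoord x := rfl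

theorem norm_sq_eq (x : E m) : ‖x‖ ^ 2 = ‖bar x‖ ^ 2 + lastCoord x ^ 2 := by
  rw [EuclideanSpace.norm_sq_eq, EuclideanSpace.norm_sq_eq, Fin.sum_univ_castSucc]
  simp [bar, lastCoord]

theorem norm_bar_le (x : E m) : ‖bar x‖ ≤ ‖x‖ := by
  have := norm_sq_eq x
  exact abs_le_of_sq_le_sq' (by nlinarith [sq_nonneg (lastCoord x)]) (norm_nonneg _) |>.2

theorem abs_lastCoord_le (x : E m) : |lastCoord x| ≤ ‖x‖ := PiLp.norm_apply_le x (Fin.last m)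

theorem norm_le_bar_add (x : E m) : ‖x‖ ≤ ‖bar x‖ + |lastCoord x| := by
  have := norm_sq_eq x
  refine abs_le_of_sq_le_sq' ?_ (by positivity) |>.2
  nlinarith [mul_nonneg (norm_nonneg (bar x)) (abs_nonneg (lastCoord x)), sq_abs (lastCoord x)]

theorem continuous_bar : Continuous (bar : E m → EuclideanSpace ℝ (Fin m)) := by
  unfold bar
  refine (PiLp.continuous_toLp 2 _).comp (continuous_pi fun i => ?_)
  fun_prop

theorem continuous_lastCoord : Continuous (lastCoord : E m → ℝ) := by
  unfold lastCoord
  fun_prop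

/-- A smooth kernel supported in the set of points with `‖w̄‖ ≤ 1` and
`8 (M + 1) ≤ w_n ≤ 16 (M + 1)`, that reproduces polynomials of degree at most `l` at the origin. -/
structure IsConeKernel (M : ℝ≥0) (l : ℕ) (ρ : E m → ℝ) : Prop where
  smooth : ContDiff ℝ (⊤ : ℕ∞) ρ
  compact : HasCompactSupport ρ
  supp : ∀ w ∈ tsupport ρ, ‖bar w‖ ≤ 1 ∧ 8 * ((M : ℝ) + 1) ≤ lastCoord w ∧
    lastCoord w ≤ 16 * ((M : ℝ) + 1)
  moments : ∀ q : MvPolynomial (Fin (m + 1)) ℝ, q.totalDegree ≤ l →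
    ∫ w, ρ w * MvPolynomial.eval (fun i => w i) q = MvPolynomial.eval 0 q

/-- The mollification of `u` at scale `τ`. -/
def mol (τ : ℝ) (ρ u : E m → ℝ) (x : E m) : ℝ := ∫ w, u (x - τ • w) * ρ w

/-- The stretching of the last coordinate by the factor `A`. -/
def stretch (A : ℝ) (hA : A ≠ 0) : E m ≃L[ℝ] E m :=
  LinearEquiv.toContinuousLinearEquiv
    { toFun := fun z => WithLp.toLp 2 fun i => (if i = Fin.last m then A else 1) * z i
      invFun := fun z => WithLp.toLp 2 fun i => (if i = Fin.last m then A else 1)⁻¹ * z i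
      map_add' := fun x y => by ext i; simp [mul_add]
      map_smul' := fun c x => by ext i; simp; split_ifs <;> ring
      left_inv := fun x => by ext i; simp only; split_ifs <;> simp [hA]
      right_inv := fun x => by ext i; simp only; split_ifs <;> simp [hA] }

theorem stretch_apply (A : ℝ) (hA : A ≠ 0) (z : E m) (i : Fin (m + 1)) :
    stretch A hA z i = (if i = Fin.last m then A else 1) * z i := rfl

theorem bar_stretch (A : ℝ) (hA : A ≠ 0) (z : E m) : bar (stretch A hA z) = bar z := by
  ext i
  simp [bar, stretch_apply]

theorem lastCoord_stretch (A : ℝ) (hA : A ≠ 0) (z : E m) :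
    lastCoord (stretch A hA z) = A * lastCoord z := by
  simp [lastCoord, stretch_apply]

theorem reflected_eq (A : ℝ) (hA : A ≠ 0) (k : ℤ) (x z : E m) :
    reflected A k x z = x - (2 : ℝ) ^ (-k) • stretch A hA z := by
  ext i
  simp only [reflected, PiLp.sub_apply, PiLp.smul_apply, stretch_apply, smul_eq_mul]
  split_ifs <;> ring

theorem IsKernel.eq_zero {l : ℕ} {ω : E m → ℝ} (hω : IsKernel l ω) {z : E m}
    (hz : z ∉ Metric.closedBall 0 1) : ω z = 0 :=
  image_eq_zero_of_notMem_tsupport fun h => hz (hω.supp h).1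

/-- The normalization is over the open ball and the support lies in the closed ball; the sphere
between them is a null set. -/
theorem IsKernel.setIntegral_eq {l : ℕ} {ω : E m → ℝ} (hω : IsKernel l ω) (h : E m → ℝ) :
    ∫ z in Metric.ball (0 : E m) 1, ω z * h z = ∫ z, ω z * h z := by
  have h1 : (Metric.ball (0 : E m) 1 : Set (E m)) =ᵐ[volume] Metric.closedBall 0 1 := by
    rw [← Metric.ball_union_sphere]
    exact (union_ae_eq_left_of_ae_eq_empty
      (ae_eq_empty.2 (Measure.addHaar_sphere_of_ne_zero volume 0 one_ne_zero))).symm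
  rw [setIntegral_congr_set h1]
  exact setIntegral_eq_integral_of_forall_compl_eq_zero fun z hz => by
    rw [hω.eq_zero hz, zero_mul]

/-- Stretching the last variable turns a kernel into a cone kernel. -/
theorem IsKernel.exists_coneKernel {l : ℕ} {ω : E m → ℝ} (hω : IsKernel l ω) (M : ℝ≥0) :
    ∃ ρ : E m → ℝ, IsConeKernel M l ρ ∧ ∀ (u : E m → ℝ) (k : ℤ),
      mollified (16 * ((M : ℝ) + 1)) ω u k = mol ((2 : ℝ) ^ (-k)) ρ u := by
  set A : ℝ := 16 * ((M : ℝ) + 1) with hAdef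
  have hApos : 0 < A := by positivity
  have hA : A ≠ 0 := hApos.ne'
  set S : E m ≃L[ℝ] E m := stretch A hA with hS
  have hdet : LinearMap.det (S : E m →ₗ[ℝ] E m) ≠ 0 :=
    (LinearEquiv.isUnit_det' S.toLinearEquiv).ne_zero
  set c : ℝ := |(LinearMap.det (S : E m →ₗ[ℝ] E m))⁻¹| with hc
  set ρ : E m → ℝ := fun w => c * ω (S.symm w) with hρ
  have hcov : ∀ G : E m → ℝ, ∫ z, G (S z) * ω z = ∫ w, G w * ρ w := by
    intro G
    have h1 : Measure.map S volume = ENNReal.ofReal c • (volume : Measure (E m)) :=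
      Measure.map_linearMap_addHaar_eq_smul_addHaar volume hdet
    have h2 := integral_map_equiv (μ := volume) S.toHomeomorph.toMeasurableEquiv
      (fun w => G w * ω (S.symm w))
    have h3 : (S.toHomeomorph.toMeasurableEquiv : E m → E m) = S := rfl
    rw [h3, h1, integral_smul_measure] at h2
    simp only [S.symm_apply_apply] at h2
    rw [← h2, ENNReal.toReal_ofReal (abs_nonneg _), smul_eq_mul, ← integral_const_mul]
    congr 1; funext w; simp only [hρ]; ring
  have hts : ∀ w ∈ tsupport ρ, S.symm w ∈ tsupport ω := by
    intro w hw
    have h1 : tsupport ρ ⊆ tsupport (ω ∘ S.symm.toHomeomorph) := by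
      refine closure_mono fun w hw h => hw ?_
      have h' : ω (S.symm w) = 0 := h
      simp [hρ, h']
    have h2 := h1 hw
    rw [tsupport_comp_eq_preimage] at h2
    exact h2
  refine ⟨ρ, ⟨?_, ?_, ?_, ?_⟩, ?_⟩
  · exact contDiff_const.mul (hω.smooth.comp S.symm.contDiff)
  · exact (hω.compact.comp_homeomorph S.symm.toHomeomorph).mul_left
  · intro w hw
    have h1 := hω.supp (hts w hw)
    have e : w = S (S.symm w) := (S.apply_symm_apply w).symm
    have hz : ‖S.symm w‖ ≤ 1 := by simpa using h1.1
    have h2 := (abs_le.1 (abs_lastCoord_le (S.symm w))).2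
    rw [e, hS, bar_stretch, lastCoord_stretch, ← hS]
    -- The last coordinate of the kernel's support lies in `[1/2, 1]`; stretching by `A = 16 (M +
    -- 1)` moves it to `[8 (M + 1), 16 (M + 1)]`.
    refine ⟨(norm_bar_le _).trans hz, ?_, ?_⟩
    · have := h1.2
      nlinarith
    · nlinarith
  · intro q hq
    have h1 := hcov fun w => MvPolynomial.eval (fun i => w i) q
    simp only [mul_comm (ρ _)]
    rw [← h1]
    have e : ∀ z : E m, MvPolynomial.eval (fun i => S z i) q * ω z
        = ∑ d ∈ q.support, (q.coeff d * ∏ i, (if i = Fin.last m then A else 1) ^ d i) *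
          (ω z * ∏ i, z i ^ d i) := by
      intro z
      rw [MvPolynomial.eval_eq', Finset.sum_mul]
      refine Finset.sum_congr rfl fun d _ => ?_
      have : ∀ i, (S z i) ^ d i = (if i = Fin.last m then A else 1) ^ d i * z i ^ d i := by
        intro i; rw [hS, stretch_apply, mul_pow]
      simp only [this, Finset.prod_mul_distrib]
      ring
    simp only [e]
    have hint : ∀ d : Fin (m + 1) →₀ ℕ, Integrable fun z : E m => ω z * ∏ i, z i ^ d i := by
      intro d
      have hcont : Continuous fun z : E m => ω z * ∏ i, z i ^ d i :=
        hω.smooth.continuous.mul (by fun_prop)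
      exact hcont.integrable_of_hasCompactSupport hω.compact.mul_right
    rw [integral_finsetSum _ fun d _ => (hint d).const_mul _, MvPolynomial.eval_eq']
    refine Finset.sum_congr rfl fun d hd => ?_
    rw [integral_const_mul, ← hω.setIntegral_eq]
    -- Polynomials are reproduced at the origin monomial by monomial: the constant one by `∫ ω = 1`,
    -- while any other monomial has vanishing moment and also vanishes at the origin.
    by_cases hd0 : d = 0
    · subst hd0
      simp [hω.integral_eq_one]
    · have hpos : 0 < MultiIndex.order (fun i => d i : MultiIndex m) := by
        rw [Nat.pos_iff_ne_zero]
        intro h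
        exact hd0 (DFunLike.coe_injective (eq_zero_of_order_eq_zero h))
      have hle : MultiIndex.order (fun i => d i : MultiIndex m) ≤ l := by
        refine le_trans ?_ ((MvPolynomial.le_totalDegree hd).trans hq)
        rw [Finsupp.sum_fintype _ _ (fun _ => rfl)]
        rfl
      rw [hω.moments _ hpos hle, mul_zero]
      obtain ⟨i, hi⟩ : ∃ i, d i ≠ 0 := by
        by_contra! h0
        exact hd0 (Finsupp.ext h0)
      rw [Finset.prod_eq_zero (Finset.mem_univ i) (by simp [hi]), mul_zero]
  · intro u k
    funext x
    unfold mollified mol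
    rw [← hcov fun w => u (x - (2 : ℝ) ^ (-k) • w)]
    simp only [reflected_eq A hA, hS]

variable {M : ℝ≥0} {l : ℕ} {ρ : E m → ℝ}

/-! ### Mollifications as convolutions. -/

/-- The kernel rescaled to scale `τ`. -/
def scaledKernel (τ : ℝ) (ρ : E m → ℝ) (w : E m) : ℝ := (τ ^ (m + 1))⁻¹ * ρ (τ⁻¹ • w)

theorem mol_eq_integral {τ : ℝ} (hτ : 0 < τ) (u : E m → ℝ) (x : E m) :
    mol τ ρ u x = ∫ y, u y * scaledKernel τ ρ (x - y) := by
  have h1 := Measure.integral_comp_smul_of_nonneg (volume : Measure (E m))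
    (fun y => u (x - y) * ρ (τ⁻¹ • y)) τ (hR := hτ.le)
  simp only [smul_smul, inv_mul_cancel₀ hτ.ne', one_smul] at h1
  have h2 := integral_sub_left_eq_self (fun y => u y * scaledKernel τ ρ (x - y)) volume x
  simp only [sub_sub_cancel] at h2
  unfold mol
  rw [h1, ← h2, smul_eq_mul, ← integral_const_mul]
  congr 1; funext y
  simp only [scaledKernel, finrank_euclideanSpace, Fintype.card_fin]
  ring

theorem contDiff_scaledKernel (hρ : ContDiff ℝ (⊤ : ℕ∞) ρ) (τ : ℝ) :
    ContDiff ℝ (⊤ : ℕ∞) (scaledKernel τ ρ) :=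
  contDiff_const.mul (hρ.comp (contDiff_const_smul _))

theorem tsupport_scaledKernel {τ : ℝ} (hτ : 0 < τ) {w : E m} (hw : w ∈ tsupport (scaledKernel τ ρ)) :
    ∃ z ∈ tsupport ρ, w = τ • z := by
  refine ⟨τ⁻¹ • w, ?_, by rw [smul_smul, mul_inv_cancel₀ hτ.ne', one_smul]⟩
  have h1 : tsupport (scaledKernel τ ρ) ⊆
      tsupport (ρ ∘ Homeomorph.smulOfNeZero τ⁻¹ (inv_ne_zero hτ.ne')) := by
    refine closure_mono fun w hw h => hw ?_
    have h' : ρ (τ⁻¹ • w) = 0 := h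
    simp [scaledKernel, h']
  have h2 := h1 hw
  rw [tsupport_comp_eq_preimage] at h2
  exact h2

theorem hasCompactSupport_scaledKernel (hρ : HasCompactSupport ρ) {τ : ℝ} (hτ : 0 < τ) :
    HasCompactSupport (scaledKernel τ ρ) :=
  (hρ.comp_homeomorph (Homeomorph.smulOfNeZero τ⁻¹ (inv_ne_zero hτ.ne'))).mul_left

theorem mol_eq_convolution {τ : ℝ} (hτ : 0 < τ) (u : E m → ℝ) :
    mol τ ρ u = convolution u (scaledKernel τ ρ) (ContinuousLinearMap.mul ℝ ℝ) volume := by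
  funext x
  rw [mol_eq_integral hτ]
  rfl

theorem contDiff_mol (hρ : IsConeKernel M l ρ) {τ : ℝ} (hτ : 0 < τ) {u : E m → ℝ}
    (hu : LocallyIntegrable u) : ContDiff ℝ (⊤ : ℕ∞) (mol τ ρ u) := by
  rw [mol_eq_convolution hτ]
  exact (hasCompactSupport_scaledKernel hρ.compact hτ).contDiff_convolution_right _ hu
    (contDiff_scaledKernel hρ.smooth τ)

/-- Mollification commutes with weak derivatives. -/
theorem fderiv_mol (hρ : IsConeKernel M l ρ) {τ : ℝ} (hτ : 0 < τ) {u g : E m → ℝ}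
    (hu : LocallyIntegrable u) {Ω : Set (E m)} {v x : E m} (h : HasWeakDir Ω v u g)
    (hx : ∀ w ∈ tsupport ρ, x - τ • w ∈ Ω) : fderiv ℝ (mol τ ρ u) x v = mol τ ρ g x := by
  set κ := scaledKernel τ ρ with hκ
  have hκs : ContDiff ℝ (⊤ : ℕ∞) κ := contDiff_scaledKernel hρ.smooth τ
  have hκc : HasCompactSupport κ := hasCompactSupport_scaledKernel hρ.compact hτ
  have h1 := (hκc.hasFDerivAt_convolution_right (ContinuousLinearMap.mul ℝ ℝ) hu
    (hκs.of_le (by exact_mod_cast le_top)) x).fderiv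
  rw [mol_eq_convolution hτ, h1, convolution_precompR_apply _ hu (hκc.fderiv ℝ)
    (hκs.continuous_fderiv (by simp)), mol_eq_integral hτ]
  have ht : IsTest Ω (fun y => κ (x - y)) := by
    refine ⟨hκs.comp (contDiff_const.sub contDiff_id),
      hκc.comp_homeomorph (Homeomorph.subLeft x), fun y hy => ?_⟩
    have h2 : x - y ∈ tsupport κ := by
      change y ∈ tsupport (κ ∘ Homeomorph.subLeft x) at hy
      rw [tsupport_comp_eq_preimage] at hy
      exact hy
    obtain ⟨z, hz, hzw⟩ := tsupport_scaledKernel hτ h2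
    have := hx z hz
    rwa [← hzw, sub_sub_cancel] at this
  have h3 := h _ ht
  have h4 : ∀ y, fderiv ℝ (fun y => κ (x - y)) y v = -(fderiv ℝ κ (x - y) v) := by
    intro y
    have e := ((hκs.differentiable (by simp) (x - y)).hasFDerivAt).comp y
      ((hasFDerivAt_id y).const_sub x)
    have e' : fderiv ℝ (fun y => κ (x - y)) y = _ := e.fderiv
    rw [e']; simp
  simp only [h4, mul_neg, integral_neg, neg_inj] at h3
  exact h3

/-- The majorant holds only almost everywhere, so the substitution `w ↦ x - τ w` has to preserve
null sets; this is where `τ ≠ 0` enters. -/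
theorem enorm_mol_le {τ : ℝ} {u : E m → ℝ} {N : E m → ℝ≥0∞} (hτ : τ ≠ 0)
    {Ω : Set (E m)} {x : E m} (hu : ∀ᵐ y, y ∈ Ω → ‖u y‖ₑ ≤ N y)
    (hx : ∀ w ∈ tsupport ρ, x - τ • w ∈ Ω) :
    ‖mol τ ρ u x‖ₑ ≤ ∫⁻ w, N (x - τ • w) * ‖ρ w‖ₑ := by
  refine (enorm_integral_le_lintegral_enorm _).trans (lintegral_mono_ae ?_)
  have h1 : Measure.QuasiMeasurePreserving (fun w : E m => x - τ • w) volume volume := by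
    have h2 : Measure.QuasiMeasurePreserving (fun w : E m => x - w) volume volume :=
      (Measure.measurePreserving_sub_left volume x).quasiMeasurePreserving
    refine h2.comp ⟨measurable_const_smul τ, ?_⟩
    rw [Measure.map_addHaar_smul _ hτ]
    exact Measure.smul_absolutelyContinuous
  filter_upwards [h1.ae hu] with w hw
  rw [enorm_mul]
  by_cases hw' : w ∈ tsupport ρ
  · exact mul_le_mul' (hw (hx w hw')) le_rfl
  · simp [image_eq_zero_of_notMem_tsupport hw']

theorem IsConeKernel.integral_eq_one (hρ : IsConeKernel M l ρ) : ∫ w, ρ w = 1 := by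
  simpa using hρ.moments 1 (by simp)

theorem IsConeKernel.integrable (hρ : IsConeKernel M l ρ) : Integrable ρ :=
  hρ.smooth.continuous.integrable_of_hasCompactSupport hρ.compact

/-- Continuity of translations in `L¹`. -/
theorem tendsto_lintegral_translate {u : E m → ℝ} (hu : Integrable u) :
    Filter.Tendsto (fun h : E m => ∫⁻ x, ‖u (x - h) - u x‖ₑ) (nhds 0) (nhds 0) := by
  have : Fact ((1 : ℝ≥0∞) ≠ ∞) := ⟨ENNReal.one_ne_top⟩
  have hu1 : MemLp u 1 := memLp_one_iff_integrable.2 hu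
  have h1 : Continuous fun h : E m => (DomAddAct.mk (-h) : (E m)ᵈᵃᵃ) +ᵥ hu1.toLp u := by
    have hm : Continuous fun h : E m => (DomAddAct.mk (-h) : (E m)ᵈᵃᵃ) :=
      DomAddAct.continuous_mk.comp continuous_neg
    exact hm.vadd continuous_const
  have h2 : Filter.Tendsto (fun h : E m =>
      edist ((DomAddAct.mk (-h) : (E m)ᵈᵃᵃ) +ᵥ hu1.toLp u) (hu1.toLp u)) (nhds 0) (nhds 0) := by
    have h3 := (h1.edist (continuous_const (y := hu1.toLp u))).tendsto 0
    have h4 : (DomAddAct.mk (-(0 : E m)) : (E m)ᵈᵃᵃ) +ᵥ hu1.toLp u = hu1.toLp u := by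
      rw [neg_zero]; exact zero_vadd _ _
    rwa [h4, edist_self] at h3
  refine h2.congr fun h => ?_
  rw [DomAddAct.mk_vadd_toLp, Lp.edist_toLp_toLp, eLpNorm_one_eq_lintegral_enorm]
  refine lintegral_congr fun x => ?_
  simp [sub_eq_neg_add]

/-- Mollifications of integrable functions converge in `L¹`. -/
theorem tendsto_mol (hρ : IsConeKernel M l ρ) {u : E m → ℝ} (hu : Integrable u) :
    Filter.Tendsto (fun τ : ℝ => ∫⁻ x, ‖mol τ ρ u x - u x‖ₑ) (nhdsWithin 0 (Ioi 0)) (nhds 0) := by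
  set I : ℝ≥0∞ := ∫⁻ w, ‖ρ w‖ₑ with hI
  have hIt : I ≠ ∞ := hρ.integrable.2.ne
  obtain ⟨R, hR⟩ := hρ.compact.isBounded.exists_norm_le
  have hsm : AEStronglyMeasurable u volume := hu.1
  rw [ENNReal.tendsto_nhds_zero]
  intro ε hε
  obtain ⟨ε', hε', hle⟩ : ∃ ε' : ℝ≥0∞, 0 < ε' ∧ I * ε' ≤ ε := by
    refine ⟨ε / (I + 1), ENNReal.div_pos hε.ne' (by simp [hIt]), ?_⟩
    calc I * (ε / (I + 1)) ≤ (I + 1) * (ε / (I + 1)) := by gcongr; exact le_self_add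
      _ ≤ ε := ENNReal.mul_div_le
  have h1 := ENNReal.tendsto_nhds_zero.1 (tendsto_lintegral_translate hu) ε' hε'
  obtain ⟨δ, hδ, hball⟩ := Metric.eventually_nhds_iff.1 h1
  -- For such `τ` every shift `τ w` with `w` in the support is shorter than `δ`, the range in which
  -- translations of `u` are `ε'`-close in `L¹`.
  have hev : ∀ᶠ τ : ℝ in nhdsWithin 0 (Ioi 0), τ * (|R| + 1) < δ ∧ 0 < τ := by
    refine Filter.Eventually.and ?_ self_mem_nhdsWithin
    have : Filter.Tendsto (fun τ : ℝ => τ * (|R| + 1)) (nhds 0) (nhds (0 * (|R| + 1))) :=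
      Filter.tendsto_id.mul_const _
    rw [zero_mul] at this
    exact nhdsWithin_le_nhds (this.eventually_lt_const hδ)
  filter_upwards [hev] with τ hτ
  obtain ⟨hτ1, hτ0⟩ := hτ
  have hmeas : AEMeasurable (fun z : E m × E m => ‖u (z.1 - τ • z.2) - u z.1‖ₑ * ‖ρ z.2‖ₑ)
      (volume.prod volume) := by
    have q1 : Measure.QuasiMeasurePreserving (fun z : E m × E m => z.1 - τ • z.2)
        (volume.prod volume) volume := by
      refine QuasiMeasurePreserving.prod_of_left (by fun_prop) ?_
      exact Filter.Eventually.of_forall fun w =>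
        (measurePreserving_sub_right volume (τ • w)).quasiMeasurePreserving
    have a1 := hsm.comp_quasiMeasurePreserving q1
    have a2 : AEStronglyMeasurable (fun z : E m × E m => u z.1) (volume.prod volume) := hsm.comp_fst
    have a3 : Measurable fun z : E m × E m => ‖ρ z.2‖ₑ :=
      (hρ.smooth.continuous.measurable.enorm).comp measurable_snd
    exact (a1.sub a2).enorm.mul a3.aemeasurable
  calc ∫⁻ x, ‖mol τ ρ u x - u x‖ₑ
      ≤ ∫⁻ x, ∫⁻ w, ‖u (x - τ • w) - u x‖ₑ * ‖ρ w‖ₑ := by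
        refine lintegral_mono fun x => ?_
        have hi1 : Integrable fun w => u (x - τ • w) * ρ w := by
          obtain ⟨C, hC⟩ := hρ.compact.exists_bound_of_continuous hρ.smooth.continuous
          refine Integrable.mul_bdd (c := C) ?_ hρ.smooth.continuous.aestronglyMeasurable
            (Filter.Eventually.of_forall hC)
          have := (hu.comp_sub_left x).comp_smul hτ0.ne'
          exact this
        have e : mol τ ρ u x - u x = ∫ w, (u (x - τ • w) - u x) * ρ w := by
          have e1 : u x = ∫ w, u x * ρ w := by
            rw [integral_const_mul, hρ.integral_eq_one, mul_one]
          rw [e1, mol, ← integral_sub hi1 (hρ.integrable.const_mul _)]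
          congr 1; funext w; rw [← e1]; ring
        rw [e]
        refine (enorm_integral_le_lintegral_enorm _).trans (le_of_eq ?_)
        simp only [enorm_mul]
    _ = ∫⁻ w, ∫⁻ x, ‖u (x - τ • w) - u x‖ₑ * ‖ρ w‖ₑ := lintegral_lintegral_swap hmeas
    _ ≤ ∫⁻ w, ‖ρ w‖ₑ * ε' := by
        refine lintegral_mono fun w => ?_
        rw [lintegral_mul_const' _ _ enorm_ne_top, mul_comm]
        by_cases hw : w ∈ tsupport ρ
        · gcongr
          apply hball
          rw [dist_zero_right, norm_smul, Real.norm_of_nonneg hτ0.le]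
          refine lt_of_le_of_lt ?_ hτ1
          gcongr
          have := hR w hw
          exact this.trans ((le_abs_self R).trans (by linarith))
        · simp [image_eq_zero_of_notMem_tsupport hw]
    _ = I * ε' := by rw [lintegral_mul_const _ hρ.smooth.continuous.measurable.enorm]
    _ ≤ ε := hle

end BurenkovMorrey

end

noncomputable section

namespace BurenkovMorrey

/-! ### Cancellation by vanishing moments -/

variable {m : ℕ}

/-- A convex set that contains the dilates by factors in `[1/2, 2]` of the support of every cone
kernel. -/
def coneBox (M : ℝ≥0) : Set (E m) :=
  {q | ‖bar q‖ ≤ 2 ∧ 4 * ((M : ℝ) + 1) ≤ lastCoord q ∧ lastCoord q ≤ 32 * ((M : ℝ) + 1)}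

/-- A neighbourhood of `coneBox M`. -/
def bigConeBox (M : ℝ≥0) : Set (E m) :=
  {q | ‖bar q‖ ≤ 3 ∧ 4 * (M : ℝ) + 3 ≤ lastCoord q ∧ lastCoord q ≤ 32 * (M : ℝ) + 33}

theorem coneBox_subset_bigConeBox (M : ℝ≥0) : (coneBox M : Set (E m)) ⊆ bigConeBox M :=
  fun q hq => ⟨by linarith [hq.1], by linarith [hq.2.1], by linarith [hq.2.2]⟩

/-- Room for a preliminary smoothing of `u`, which displaces points of `coneBox` by vectors of norm
at most one in rescaled coordinates. -/
theorem add_mem_bigConeBox {M : ℝ≥0} {q h : E m} (hq : q ∈ coneBox M) (hh : ‖h‖ ≤ 1) :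
    q + h ∈ bigConeBox M := by
  have h1 := (norm_bar_le h).trans hh
  have h2 := abs_le.1 ((abs_lastCoord_le h).trans hh)
  refine ⟨?_, ?_, ?_⟩
  · rw [bar_add]; exact (norm_add_le _ _).trans (by linarith [hq.1])
  · rw [lastCoord_add]; linarith [hq.2.1]
  · rw [lastCoord_add]; linarith [hq.2.2]

theorem isClosed_coneBox (M : ℝ≥0) : IsClosed (coneBox M : Set (E m)) :=
  (isClosed_le continuous_bar.norm continuous_const).inter
    ((isClosed_le continuous_const continuous_lastCoord).inter
      (isClosed_le continuous_lastCoord continuous_const))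

theorem isClosed_bigConeBox (M : ℝ≥0) : IsClosed (bigConeBox M : Set (E m)) :=
  (isClosed_le continuous_bar.norm continuous_const).inter
    ((isClosed_le continuous_const continuous_lastCoord).inter
      (isClosed_le continuous_lastCoord continuous_const))

theorem norm_le_of_mem_bigConeBox {M : ℝ≥0} {q : E m} (hq : q ∈ bigConeBox M) :
    ‖q‖ ≤ 36 * ((M : ℝ) + 1) := by
  have h0 : (0 : ℝ) ≤ M := M.2
  refine (norm_le_bar_add q).trans ?_
  rw [abs_of_nonneg (by linarith [hq.2.1])]
  linarith [hq.1, hq.2.2]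

theorem norm_le_of_mem_coneBox {M : ℝ≥0} {q : E m} (hq : q ∈ coneBox M) :
    ‖q‖ ≤ 36 * ((M : ℝ) + 1) := norm_le_of_mem_bigConeBox (coneBox_subset_bigConeBox M hq)

theorem volume_bigConeBox_lt_top (M : ℝ≥0) : volume (bigConeBox M : Set (E m)) < ∞ := by
  refine (measure_mono (t := Metric.closedBall 0 (36 * ((M : ℝ) + 1))) fun q hq => ?_).trans_lt
    measure_closedBall_lt_top
  rw [mem_closedBall_zero_iff]; exact norm_le_of_mem_bigConeBox hq

theorem volume_coneBox_lt_top (M : ℝ≥0) : volume (coneBox M : Set (E m)) < ∞ :=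
  (measure_mono (coneBox_subset_bigConeBox M)).trans_lt (volume_bigConeBox_lt_top M)

/-- The set contains a unit ball around the point of height `16 (M + 1)` on the last axis.
Positivity permits division after averaging over Taylor base points. -/
theorem volume_coneBox_pos (M : ℝ≥0) : 0 < volume (coneBox M : Set (E m)) := by
  have h0 : (0 : ℝ) ≤ M := M.2
  set c : E m := EuclideanSpace.single (Fin.last m) (16 * ((M : ℝ) + 1)) with hc
  have hb : bar c = 0 := by
    ext i
    simp [bar, hc]
  have hl : lastCoord c = 16 * ((M : ℝ) + 1) := by simp [lastCoord, hc]
  refine (Metric.measure_ball_pos volume c one_pos).trans_le (measure_mono fun q hq => ?_)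
  have hq' : ‖q - c‖ < 1 := by rwa [← dist_eq_norm]
  have h1 := (norm_bar_le (q - c)).trans hq'.le
  have h2 := abs_le.1 ((abs_lastCoord_le (q - c)).trans hq'.le)
  rw [bar_sub, hb, sub_zero] at h1
  rw [lastCoord_sub, hl] at h2
  exact ⟨by linarith, by linarith [h2.1], by linarith [h2.2]⟩

theorem convex_coneBox (M : ℝ≥0) : Convex ℝ (coneBox M : Set (E m)) := by
  intro x hx y hy a b ha hb hab
  refine ⟨?_, ?_, ?_⟩
  · rw [bar_add, bar_smul, bar_smul]
    refine (norm_add_le _ _).trans ?_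
    rw [norm_smul, norm_smul, Real.norm_of_nonneg ha, Real.norm_of_nonneg hb]
    nlinarith [hx.1, hy.1]
  · rw [lastCoord_add, lastCoord_smul, lastCoord_smul]
    nlinarith [hx.2.1, hy.2.1]
  · rw [lastCoord_add, lastCoord_smul, lastCoord_smul]
    nlinarith [hx.2.2, hy.2.2]

theorem IsConeKernel.smul_mem_coneBox {M : ℝ≥0} {l : ℕ} {ρ : E m → ℝ} (hρ : IsConeKernel M l ρ)
    {w : E m} (hw : w ∈ tsupport ρ) {t : ℝ} (ht : 1 / 2 ≤ t) (ht' : t ≤ 2) :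
    t • w ∈ coneBox M := by
  have h0 : (0 : ℝ) ≤ M := M.2
  obtain ⟨h1, h2, h3⟩ := hρ.supp w hw
  refine ⟨?_, ?_, ?_⟩
  · rw [bar_smul, norm_smul, Real.norm_of_nonneg (by linarith)]
    nlinarith [norm_nonneg (bar w)]
  · rw [lastCoord_smul]; nlinarith
  · rw [lastCoord_smul]; nlinarith

/-! ### Averages over segments and Taylor's formula. -/

theorem lintegral_comp_affine_le {G : E m → ℝ≥0∞} (hG : Measurable G) {c : ℝ} (hc : 1 / 2 ≤ c)
    (b : E m) : ∫⁻ y, G (c • y + b) ≤ 2 ^ (m + 1) * ∫⁻ y, G y := by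
  have hc0 : c ≠ 0 := by linarith
  have h1 : ∫⁻ y, G (c • y + b) = ∫⁻ z, G (z + b) ∂(Measure.map (c • ·) volume) := by
    rw [lintegral_map (by fun_prop) (by fun_prop)]
  rw [h1, Measure.map_addHaar_smul volume hc0, lintegral_smul_measure,
    lintegral_add_right_eq_self, smul_eq_mul]
  gcongr
  rw [finrank_euclideanSpace, Fintype.card_fin]
  rw [show (2 : ℝ≥0∞) ^ (m + 1) = ENNReal.ofReal (2 ^ (m + 1)) by
    rw [ENNReal.ofReal_pow (by norm_num)]; norm_num]
  apply ENNReal.ofReal_le_ofReal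
  rw [abs_of_nonneg (by positivity), ← inv_pow]
  refine pow_le_pow_left₀ (by positivity) ?_ _
  rw [inv_le_comm₀ (by linarith) (by norm_num)]
  linarith

/-- The point `y + s (w - y)` is affine in `w` with factor `s` and affine in `y` with factor `1 -
s`. One of the two is at least `1/2`, and substituting in that variable keeps the Jacobian below
`2^{m+1}`; no singular kernel arises. -/
theorem lintegral_segment_le {Q : Set (E m)} (hQ : Convex ℝ Q) (hQm : MeasurableSet Q)
    {H : E m → ℝ≥0∞} (hH : Measurable H) :
    ∫⁻ y in Q, ∫⁻ w in Q, ∫⁻ s in Icc (0 : ℝ) 1, H (y + s • (w - y)) ≤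
      2 ^ (m + 1) * volume Q * ∫⁻ q in Q, H q := by
  set G := Q.indicator H with hG
  have hGm : Measurable G := hH.indicator hQm
  have hGi : ∫⁻ y, G y = ∫⁻ q in Q, H q := lintegral_indicator hQm H
  have hHG : ∀ y ∈ Q, ∀ w ∈ Q, ∀ s ∈ Icc (0 : ℝ) 1, H (y + s • (w - y)) = G (y + s • (w - y)) := by
    intro y hy w hw s hs
    have : y + s • (w - y) ∈ Q := hQ.add_smul_sub_mem hy hw hs
    rw [hG, indicator_of_mem this]
  have key : ∀ s ∈ Icc (0 : ℝ) 1, ∫⁻ y in Q, ∫⁻ w in Q, G (y + s • (w - y)) ≤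
      2 ^ (m + 1) * volume Q * ∫⁻ q in Q, H q := by
    intro s hs
    rcases le_total (1 / 2) s with h | h
    · calc ∫⁻ y in Q, ∫⁻ w in Q, G (y + s • (w - y))
          ≤ ∫⁻ y in Q, 2 ^ (m + 1) * ∫⁻ q in Q, H q := by
            refine lintegral_mono fun y => ?_
            refine (setLIntegral_le_lintegral _ _).trans ?_
            rw [← hGi]
            refine le_trans (le_of_eq ?_) (lintegral_comp_affine_le hGm h (y - s • y))
            refine lintegral_congr fun w => ?_
            congr 1; rw [smul_sub]; abel
        _ = _ := by rw [setLIntegral_const]; ring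
    · rw [lintegral_lintegral_swap (by fun_prop)]
      calc ∫⁻ w in Q, ∫⁻ y in Q, G (y + s • (w - y))
          ≤ ∫⁻ y in Q, 2 ^ (m + 1) * ∫⁻ q in Q, H q := by
            refine lintegral_mono fun w => ?_
            refine (setLIntegral_le_lintegral _ _).trans ?_
            rw [← hGi]
            refine le_trans (le_of_eq ?_)
              (lintegral_comp_affine_le hGm (c := 1 - s) (by linarith) (s • w))
            refine lintegral_congr fun y => ?_
            congr 1; rw [smul_sub, sub_smul, one_smul]; abel
        _ = _ := by rw [setLIntegral_const]; ring
  calc ∫⁻ y in Q, ∫⁻ w in Q, ∫⁻ s in Icc (0 : ℝ) 1, H (y + s • (w - y))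
      = ∫⁻ y in Q, ∫⁻ w in Q, ∫⁻ s in Icc (0 : ℝ) 1, G (y + s • (w - y)) :=
        setLIntegral_congr_fun hQm fun y hy => setLIntegral_congr_fun hQm fun w hw =>
          setLIntegral_congr_fun measurableSet_Icc fun s hs => hHG y hy w hw s hs
    _ = ∫⁻ y in Q, ∫⁻ s in Icc (0 : ℝ) 1, ∫⁻ w in Q, G (y + s • (w - y)) :=
        lintegral_congr fun y => lintegral_lintegral_swap (by fun_prop)
    _ = ∫⁻ s in Icc (0 : ℝ) 1, ∫⁻ y in Q, ∫⁻ w in Q, G (y + s • (w - y)) := by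
        refine lintegral_lintegral_swap ?_
        refine Measurable.aemeasurable ?_
        have : Measurable fun z : (E m × ℝ) × E m => G (z.1.1 + z.1.2 • (z.2 - z.1.1)) := by
          fun_prop
        exact this.lintegral_prod_right'
    _ ≤ ∫⁻ s in Icc (0 : ℝ) 1, 2 ^ (m + 1) * volume Q * ∫⁻ q in Q, H q :=
        setLIntegral_mono measurable_const key
    _ = _ := by rw [setLIntegral_const]; simp

/-- Integral form of the remainder, with the factors `1/a!` and `(1-s)^a` estimated by one. -/
theorem enorm_taylor_le {Φ : E m → ℝ} (hΦ : ContDiff ℝ (⊤ : ℕ∞) Φ) (a : ℕ) (y w : E m) :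
    ‖Φ w - ∑ j ∈ Finset.range (a + 1),
        ((j.factorial : ℝ))⁻¹ • iteratedFDeriv ℝ j Φ y (fun _ => w - y)‖ₑ ≤
      ‖w - y‖ₑ ^ (a + 1) *
        ∫⁻ s in Icc (0 : ℝ) 1, ‖iteratedFDeriv ℝ (a + 1) Φ (y + s • (w - y))‖ₑ := by
  have h1 := map_add_eq_sum_add_integral_iteratedFDeriv (f := Φ) (x := y) (y := w - y) (n := a)
    fun t _ => hΦ.contDiffAt.of_le (by exact_mod_cast le_top)
  rw [add_sub_cancel] at h1
  rw [h1, add_sub_cancel_left, enorm_smul]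
  have hf : ‖((a.factorial : ℝ))⁻¹‖ₑ ≤ 1 := by
    rw [Real.enorm_eq_ofReal_abs]
    apply ENNReal.ofReal_le_one.2
    rw [abs_of_nonneg (by positivity)]
    exact inv_le_one_of_one_le₀ (by exact_mod_cast Nat.factorial_pos a)
  refine (mul_le_of_le_one_left' hf).trans ?_
  rw [intervalIntegral.integral_of_le zero_le_one, ← integral_Icc_eq_integral_Ioc]
  refine (enorm_integral_le_lintegral_enorm _).trans ?_
  have hm : Measurable fun s : ℝ => ‖iteratedFDeriv ℝ (a + 1) Φ (y + s • (w - y))‖ₑ := by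
    have hc : Continuous (iteratedFDeriv ℝ (a + 1) Φ) :=
      hΦ.continuous_iteratedFDeriv (by exact_mod_cast le_top)
    exact (hc.comp (by fun_prop)).enorm.measurable
  rw [← lintegral_const_mul _ hm]
  refine setLIntegral_mono (hm.const_mul _) fun s hs => ?_
  rw [enorm_smul]
  have hs1 : ‖(1 - s) ^ a‖ₑ ≤ 1 := by
    rw [Real.enorm_eq_ofReal_abs]
    apply ENNReal.ofReal_le_one.2
    rw [abs_of_nonneg (pow_nonneg (by linarith [hs.2]) _)]
    exact pow_le_one₀ (by linarith [hs.2]) (by linarith [hs.1])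
  refine (mul_le_of_le_one_left' hs1).trans ?_
  rw [mul_comm, ← ofReal_norm, ← ofReal_norm, ← ofReal_norm, ← ENNReal.ofReal_pow (norm_nonneg _),
    ← ENNReal.ofReal_mul (norm_nonneg _)]
  apply ENNReal.ofReal_le_ofReal
  refine (ContinuousMultilinearMap.le_opNorm _ _).trans ?_
  simp

/-- A polynomial with `q(w) = L (t w - y, …, t w - y)`. -/
theorem exists_mvPolynomial_multilinear {j : ℕ}
    (L : ContinuousMultilinearMap ℝ (fun _ : Fin j => E m) ℝ) (t : ℝ) (y : E m) :
    ∃ q : MvPolynomial (Fin (m + 1)) ℝ, q.totalDegree ≤ j ∧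
      ∀ w : E m, MvPolynomial.eval (fun i => w i) q = L (fun _ => t • w - y) := by
  refine ⟨∑ r : Fin j → Fin (m + 1), MvPolynomial.C (L fun i => EuclideanSpace.single (r i) 1) *
    ∏ i, (MvPolynomial.C t * MvPolynomial.X (r i) - MvPolynomial.C (y (r i))), ?_, fun w => ?_⟩
  · refine MvPolynomial.totalDegree_finsetSum_le fun r _ => ?_
    refine (MvPolynomial.totalDegree_mul _ _).trans ?_
    rw [MvPolynomial.totalDegree_C, zero_add]
    refine (MvPolynomial.totalDegree_finsetProd _ _).trans ?_
    calc ∑ i : Fin j, _ ≤ ∑ _i : Fin j, 1 := by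
          refine Finset.sum_le_sum fun i _ => ?_
          refine (MvPolynomial.totalDegree_sub _ _).trans (max_le ?_ ?_)
          · refine (MvPolynomial.totalDegree_mul _ _).trans ?_
            rw [MvPolynomial.totalDegree_C, zero_add, MvPolynomial.totalDegree_X]
          · rw [MvPolynomial.totalDegree_C]; exact zero_le_one
      _ = j := by simp
  · have e : (fun _ : Fin j => t • w - y) =
        fun _ => ∑ b, (t • w - y) b • (EuclideanSpace.single b 1 : E m) := by
      funext _; rw [sum_single_eq]
    rw [e, ContinuousMultilinearMap.map_sum, map_sum]
    refine Finset.sum_congr rfl fun r _ => ?_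
    rw [ContinuousMultilinearMap.map_smul_univ, map_mul, map_prod, MvPolynomial.eval_C,
      smul_eq_mul, mul_comm]
    congr 1
    refine Finset.prod_congr rfl fun i _ => ?_
    simp

variable {M : ℝ≥0} {l : ℕ} {ρ : E m → ℝ}

/-- The integrand is a polynomial in `w` of degree at most `j`, and its value at the origin does not
involve `t`. This independence of the scale is the cancellation behind all differences of
mollifications. -/
theorem IsConeKernel.integral_multilinear (hρ : IsConeKernel M l ρ) {j : ℕ} (hj : j ≤ l)
    (L : ContinuousMultilinearMap ℝ (fun _ : Fin j => E m) ℝ) (t : ℝ) (y : E m) :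
    ∫ w, ρ w * L (fun _ => t • w - y) = L (fun _ => -y) := by
  obtain ⟨q, hq, he⟩ := exists_mvPolynomial_multilinear L t y
  have h1 := hρ.moments q (hq.trans hj)
  simp only [he] at h1
  rw [h1]
  have := he 0
  simp only [smul_zero, zero_sub] at this
  rw [← this]; rfl

theorem IsConeKernel.exists_bound (hρ : IsConeKernel M l ρ) :
    ∃ C : ℝ≥0, ∀ w, ‖ρ w‖ₑ ≤ C := by
  obtain ⟨C, hC⟩ := hρ.compact.exists_bound_of_continuous hρ.smooth.continuous
  refine ⟨C.toNNReal, fun w => ?_⟩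
  rw [enorm_le_coe, ← NNReal.coe_le_coe, coe_nnnorm]
  exact (hC w).trans (Real.le_coe_toNNReal C)

/-- Averages with respect to the kernel are bounded by averages over `coneBox M`. -/
theorem IsConeKernel.lintegral_mul_le (hρ : IsConeKernel M l ρ) {C : ℝ≥0} (hC : ∀ w, ‖ρ w‖ₑ ≤ C)
    {t : ℝ} (ht : 1 / 2 ≤ t) (ht' : t ≤ 2) {K : E m → ℝ≥0∞} (hK : Measurable K) :
    ∫⁻ w, K (t • w) * ‖ρ w‖ₑ ≤ C * 2 ^ (m + 1) * ∫⁻ q in coneBox M, K q := by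
  have hm := (isClosed_coneBox (m := m) M).measurableSet
  set G := (coneBox M : Set (E m)).indicator K with hG
  calc ∫⁻ w, K (t • w) * ‖ρ w‖ₑ ≤ ∫⁻ w, C * G (t • w + 0) := by
        refine lintegral_mono fun w => ?_
        by_cases hw : w ∈ tsupport ρ
        · rw [add_zero, hG, indicator_of_mem (hρ.smul_mem_coneBox hw ht ht'), mul_comm]
          exact mul_le_mul' (hC w) le_rfl
        · simp [image_eq_zero_of_notMem_tsupport hw]
    _ = C * ∫⁻ w, G (t • w + 0) := by
        rw [lintegral_const_mul' _ _ ENNReal.coe_ne_top]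
    _ ≤ C * (2 ^ (m + 1) * ∫⁻ w, G w) := by
        gcongr
        exact lintegral_comp_affine_le (hK.indicator hm) ht 0
    _ = _ := by rw [hG, lintegral_indicator hm, mul_assoc]

/-- Comparison of two averages of a smooth function by its derivatives of order `a`. -/
theorem IsConeKernel.enorm_integral_sub_le (hρ : IsConeKernel M l ρ) {a : ℕ} (ha : a ≤ l) :
    ∃ C : ℝ≥0, ∀ Φ : E m → ℝ, ContDiff ℝ (⊤ : ℕ∞) Φ → ∀ t : ℝ, 1 / 2 ≤ t → t ≤ 2 →
      ‖(∫ w, Φ (t • w) * ρ w) - ∫ w, Φ w * ρ w‖ₑ ≤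
        C * ∫⁻ q in coneBox M, ‖iteratedFDeriv ℝ a Φ q‖ₑ := by
  obtain ⟨C, hC⟩ := hρ.exists_bound
  have hQm := (isClosed_coneBox (m := m) M).measurableSet
  cases a with
  -- Without derivatives there is nothing to cancel, and the two averages are bounded separately.
  | zero =>
    refine ⟨2 * (C * 2 ^ (m + 1)), fun Φ hΦ t ht ht' => ?_⟩
    have hK : Measurable fun q => ‖Φ q‖ₑ := hΦ.continuous.enorm.measurable
    have key : ∀ t : ℝ, 1 / 2 ≤ t → t ≤ 2 → ‖∫ w, Φ (t • w) * ρ w‖ₑ ≤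
        C * 2 ^ (m + 1) * ∫⁻ q in coneBox M, ‖Φ q‖ₑ := by
      intro t ht ht'
      refine le_trans ?_ (hρ.lintegral_mul_le hC ht ht' hK)
      refine (enorm_integral_le_lintegral_enorm _).trans (le_of_eq ?_)
      simp only [enorm_mul]
    have e : ∀ q, ‖iteratedFDeriv ℝ 0 Φ q‖ₑ = ‖Φ q‖ₑ := fun q => by
      rw [← ofReal_norm, norm_iteratedFDeriv_zero, ofReal_norm]
    simp only [e]
    have k1 := key 1 (by norm_num) (by norm_num)
    simp only [one_smul] at k1
    refine enorm_sub_le.trans ((add_le_add (key t ht ht') k1).trans (le_of_eq ?_))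
    push_cast; ring
  | succ a =>
    set V := volume (coneBox M : Set (E m)) with hV
    have hV0 : V ≠ 0 := (volume_coneBox_pos M).ne'
    have hVt : V ≠ ∞ := (volume_coneBox_lt_top M).ne
    -- A bound for the diameter of `coneBox M`, whose points have norm at most `36 (M + 1)`.
    set R : ℝ≥0 := 72 * (M + 1) with hR
    refine ⟨2 * (C * 2 ^ (m + 1) * R ^ (a + 1) * 2 ^ (m + 1)), fun Φ hΦ t ht ht' => ?_⟩
    set H : E m → ℝ≥0∞ := fun q => ‖iteratedFDeriv ℝ (a + 1) Φ q‖ₑ with hH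
    have hHm : Measurable H := (hΦ.continuous_iteratedFDeriv
      (by exact_mod_cast le_top)).enorm.measurable
    set T : E m → E m → ℝ := fun y w => ∑ j ∈ Finset.range (a + 1),
      ((j.factorial : ℝ))⁻¹ • iteratedFDeriv ℝ j Φ y (fun _ => w - y) with hT
    set A : E m → ℝ≥0∞ := fun y => ∫⁻ w in coneBox M, ∫⁻ s in Icc (0 : ℝ) 1, H (y + s • (w - y))
      with hA
    have hTc : ∀ y, Continuous (T y) := by
      intro y
      refine continuous_finsetSum _ fun j _ => ?_
      have : Continuous fun w : E m => iteratedFDeriv ℝ j Φ y (fun _ => w - y) :=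
        (iteratedFDeriv ℝ j Φ y).cont.comp (continuous_pi fun _ => by fun_prop)
      exact continuous_const.mul this
    -- The Taylor polynomial of degree `a`, which is less than the given order `a + 1 ≤ l`, has the
    -- same kernel average at every scale. Both averages of `Φ` are therefore compared with the
    -- number `T y 0`.
    have hTi : ∀ (y : E m) (t : ℝ), ∫ w, T y (t • w) * ρ w = T y 0 := by
      intro y t
      simp only [hT, Finset.sum_mul, zero_sub]
      rw [integral_finsetSum]
      · refine Finset.sum_congr rfl fun j hj => ?_
        rw [← hρ.integral_multilinear (j := j)
          (by have := Finset.mem_range.1 hj; omega) (iteratedFDeriv ℝ j Φ y) t y,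
          smul_eq_mul, ← integral_const_mul]
        congr 1; funext w; rw [smul_eq_mul]; ring
      · intro j _
        have : Continuous fun w : E m => ((j.factorial : ℝ))⁻¹ •
            iteratedFDeriv ℝ j Φ y (fun _ => t • w - y) := by
          have : Continuous fun w : E m => iteratedFDeriv ℝ j Φ y (fun _ => t • w - y) :=
            (iteratedFDeriv ℝ j Φ y).cont.comp (continuous_pi fun _ => by fun_prop)
          exact continuous_const.mul this
        exact (this.mul hρ.smooth.continuous).integrable_of_hasCompactSupport
          hρ.compact.mul_left
    have key : ∀ t : ℝ, 1 / 2 ≤ t → t ≤ 2 → ∀ y ∈ coneBox M,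
        ‖(∫ w, Φ (t • w) * ρ w) - T y 0‖ₑ ≤ C * 2 ^ (m + 1) * R ^ (a + 1) * A y := by
      intro t ht ht' y hy
      rw [← hTi y t, ← integral_sub]
      · set K : E m → ℝ≥0∞ := fun w => ‖w - y‖ₑ ^ (a + 1) *
          ∫⁻ s in Icc (0 : ℝ) 1, H (y + s • (w - y)) with hK
        have hm1 : Measurable fun z : E m × ℝ => H (y + z.2 • (z.1 - y)) := by fun_prop
        have hKm : Measurable K := by
          refine Measurable.mul (by fun_prop) ?_
          exact hm1.lintegral_prod_right'
        calc ‖∫ w, Φ (t • w) * ρ w - T y (t • w) * ρ w‖ₑ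
            ≤ ∫⁻ w, K (t • w) * ‖ρ w‖ₑ := by
              refine (enorm_integral_le_lintegral_enorm _).trans (lintegral_mono fun w => ?_)
              rw [← sub_mul, enorm_mul]
              refine mul_le_mul' ?_ le_rfl
              exact enorm_taylor_le hΦ a y (t • w)
          _ ≤ C * 2 ^ (m + 1) * ∫⁻ q in coneBox M, K q := hρ.lintegral_mul_le hC ht ht' hKm
          _ ≤ C * 2 ^ (m + 1) * (R ^ (a + 1) * A y) := by
              gcongr
              rw [hA, ← lintegral_const_mul _ hm1.lintegral_prod_right']
              refine setLIntegral_mono (hm1.lintegral_prod_right'.const_mul _) fun w hw => ?_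
              refine mul_le_mul' (pow_le_pow_left' ?_ _) le_rfl
              rw [enorm_le_coe, ← NNReal.coe_le_coe, coe_nnnorm]
              refine (norm_sub_le _ _).trans ?_
              have := norm_le_of_mem_coneBox hw
              have := norm_le_of_mem_coneBox hy
              rw [hR]; push_cast; linarith
          _ = _ := by ring
      · exact ((hΦ.continuous.comp (continuous_const_smul t)).mul
          hρ.smooth.continuous).integrable_of_hasCompactSupport hρ.compact.mul_left
      · exact (((hTc y).comp (continuous_const_smul t)).mul
          hρ.smooth.continuous).integrable_of_hasCompactSupport hρ.compact.mul_left
    set X := ‖(∫ w, Φ (t • w) * ρ w) - ∫ w, Φ w * ρ w‖ₑ with hX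
    have hXy : ∀ y ∈ coneBox M, X ≤ 2 * (C * 2 ^ (m + 1) * R ^ (a + 1)) * A y := by
      intro y hy
      have k1 := key 1 (by norm_num) (by norm_num) y hy
      simp only [one_smul] at k1
      have e : (∫ w, Φ (t • w) * ρ w) - ∫ w, Φ w * ρ w = ((∫ w, Φ (t • w) * ρ w) - T y 0)
          - ((∫ w, Φ w * ρ w) - T y 0) := by ring
      rw [hX, e]
      refine enorm_sub_le.trans ((add_le_add (key t ht ht' y hy) k1).trans (le_of_eq ?_))
      ring
    have hAm : Measurable A := by
      have : Measurable fun z : (E m × E m) × ℝ => H (z.1.1 + z.2 • (z.1.2 - z.1.1)) := by fun_prop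
      exact (this.lintegral_prod_right').lintegral_prod_right'
    -- The base point `y` is arbitrary in `coneBox M`. Integrating over it turns the segment
    -- integrals into an integral over the box by `lintegral_segment_le`, and the volume `V` cancels
    -- afterwards.
    have hint : X * V ≤ 2 * (C * 2 ^ (m + 1) * R ^ (a + 1)) *
        (2 ^ (m + 1) * V * ∫⁻ q in coneBox M, H q) := by
      calc X * V = ∫⁻ _ in (coneBox M : Set (E m)), X := by rw [setLIntegral_const]
        _ ≤ ∫⁻ y in coneBox M, 2 * (C * 2 ^ (m + 1) * R ^ (a + 1)) * A y :=
          setLIntegral_mono (hAm.const_mul _) hXy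
        _ = 2 * (C * 2 ^ (m + 1) * R ^ (a + 1)) * ∫⁻ y in coneBox M, A y :=
          lintegral_const_mul _ hAm
        _ ≤ _ := by
          gcongr
          exact lintegral_segment_le (convex_coneBox M) hQm hHm
    have h3 : X * V ≤ (2 * (C * 2 ^ (m + 1) * R ^ (a + 1) * 2 ^ (m + 1)) *
        ∫⁻ q in coneBox M, H q) * V := hint.trans (le_of_eq (by ring))
    have h4 := (ENNReal.mul_le_mul_iff_left hV0 hVt).1 h3
    refine h4.trans (le_of_eq ?_)
    push_cast; ring

end BurenkovMorrey

end

noncomputable section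

namespace BurenkovMorrey

/-! ### Estimates for mollifications near a Lipschitz graph -/

variable {m : ℕ}

/-- The height above the graph of `F`. -/
def height (F : EuclideanSpace ℝ (Fin m) → ℝ) (x : E m) : ℝ := lastCoord x - F (bar x)

theorem mem_subgraph_iff {F : EuclideanSpace ℝ (Fin m) → ℝ} {x : E m} :
    x ∈ subgraph F ↔ height F x < 0 := by simp [subgraph, height]

theorem mem_above_iff {F : EuclideanSpace ℝ (Fin m) → ℝ} {x : E m} :
    x ∈ above F ↔ 0 < height F x := by simp [above, height]

variable {M : ℝ≥0} {F : EuclideanSpace ℝ (Fin m) → ℝ}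

theorem continuous_height (hF : LipschitzWith M F) : Continuous (height F) :=
  continuous_lastCoord.sub (hF.continuous.comp continuous_bar)

theorem isOpen_subgraph (hF : LipschitzWith M F) : IsOpen (subgraph F) := by
  have : subgraph F = height F ⁻¹' Iio 0 := by ext x; exact mem_subgraph_iff
  rw [this]; exact isOpen_Iio.preimage (continuous_height hF)

theorem abs_height_sub_le (hF : LipschitzWith M F) (x w : E m) :
    |height F (x - w) - (height F x - lastCoord w)| ≤ M * ‖bar w‖ := by
  have h1 := hF.dist_le_mul (bar x) (bar (x - w))
  rw [bar_sub, dist_eq_norm, dist_eq_norm, sub_sub_cancel, Real.norm_eq_abs] at h1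
  have e : height F (x - w) - (height F x - lastCoord w) = F (bar x) - F (bar x - bar w) := by
    simp only [height, lastCoord_sub, bar_sub]; ring
  rwa [e]

theorem abs_height_sub_height_le (hF : LipschitzWith M F) (x y : E m) :
    |height F x - height F y| ≤ ((M : ℝ) + 1) * ‖x - y‖ := by
  have h1 := abs_le.1 (abs_height_sub_le hF x (x - y))
  have h2 := abs_le.1 (abs_lastCoord_le (x - y))
  have h3 : (M : ℝ) * ‖bar (x - y)‖ ≤ M * ‖x - y‖ :=
    mul_le_mul_of_nonneg_left (norm_bar_le _) M.2
  rw [sub_sub_cancel] at h1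
  rw [abs_le]; constructor <;> linarith [h1.1, h1.2, h2.1, h2.2]

theorem height_sub_smul_le (hF : LipschitzWith M F) {x q : E m} {τ c : ℝ} (hτ : 0 ≤ τ)
    (hq : ‖bar q‖ ≤ c) :
    height F (x - τ • q) ≤ height F x - τ * lastCoord q + M * (τ * c) ∧
      height F x - τ * lastCoord q - M * (τ * c) ≤ height F (x - τ • q) := by
  have h1 := abs_le.1 (abs_height_sub_le hF x (τ • q))
  rw [lastCoord_smul, bar_smul, norm_smul, Real.norm_of_nonneg hτ] at h1
  have h2 : (M : ℝ) * (τ * ‖bar q‖) ≤ M * (τ * c) := by gcongr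
  constructor <;> linarith [h1.1, h1.2]

variable {l : ℕ} {ρ : E m → ℝ}

/-- Moving down by at least `8 (M + 1) τ` and sideways by at most `τ` lowers the height by at least
`8 (M + 1) τ - M τ = (7 M + 8) τ`. -/
theorem IsConeKernel.sub_mem_subgraph (hρ : IsConeKernel M l ρ) (hF : LipschitzWith M F)
    {x w : E m} {τ : ℝ} (hτ : 0 ≤ τ) (hx : height F x < (7 * M + 8) * τ) (hw : w ∈ tsupport ρ) :
    x - τ • w ∈ subgraph F := by
  obtain ⟨h1, h2, -⟩ := hρ.supp w hw
  rw [mem_subgraph_iff]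
  refine (height_sub_smul_le hF hτ h1).1.trans_lt ?_
  nlinarith [mul_le_mul_of_nonneg_left h2 hτ]

/-- The balance is `τ - (4 M + 3) τ + 3 M τ = -(M + 2) τ`. With the reverse inequality below it says
that, from heights in `[0, τ]`, the points reached lie at depth comparable to `τ`. -/
theorem height_sub_le_of_mem_bigConeBox (hF : LipschitzWith M F) {x q : E m} {τ : ℝ}
    (hτ : 0 ≤ τ) (hx : height F x ≤ τ) (hq : q ∈ bigConeBox M) :
    height F (x - τ • q) ≤ -(((M : ℝ) + 2) * τ) := by
  refine (height_sub_smul_le hF hτ hq.1).1.trans ?_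
  nlinarith [mul_le_mul_of_nonneg_left hq.2.1 hτ]

theorem le_height_sub_of_mem_bigConeBox (hF : LipschitzWith M F) {x q : E m} {τ : ℝ}
    (hτ : 0 ≤ τ) (hq : q ∈ bigConeBox M) :
    height F x - 35 * ((M : ℝ) + 1) * τ ≤ height F (x - τ • q) := by
  refine le_trans ?_ (height_sub_smul_le hF hτ hq.1).2
  nlinarith [mul_le_mul_of_nonneg_left hq.2.2 hτ]

/-- `u` vanishes off `Ω` and has weak derivatives on `Ω` with integrable bounds. -/
structure FiniteBound (Ω : Set (E m)) (k : ℕ) (N : ℕ → E m → ℝ≥0∞) (u : E m → ℝ) : Prop where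
  weak : WeakBound Ω k N u
  meas : ∀ j, Measurable (N j)
  finite : ∀ j ≤ k, ∫⁻ x, N j x ≠ ∞
  zero : ∀ x ∉ Ω, u x = 0

theorem FiniteBound.integrable {Ω : Set (E m)} (hΩ : MeasurableSet Ω) {k : ℕ}
    {N : ℕ → E m → ℝ≥0∞} {u : E m → ℝ} (h : FiniteBound Ω k N u) : Integrable u := by
  have e : Ω.indicator u = u := indicator_eq_self.2 fun x hx => by
    by_contra h'; exact hx (h.zero x h')
  have hm : AEStronglyMeasurable u volume := by
    rw [← e]
    exact (aestronglyMeasurable_indicator_iff hΩ).2 h.weak.base.1.aestronglyMeasurable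
  refine ⟨hm, ?_⟩
  refine lt_of_le_of_lt (lintegral_mono_ae ?_) (lt_top_iff_ne_top.2 (h.finite 0 (Nat.zero_le _)))
  filter_upwards [h.weak.base.2] with x hx
  by_cases hxΩ : x ∈ Ω
  · exact hx hxΩ
  · simp [h.zero x hxΩ]

/-- A derivative is cut off to `Ω`, where alone it is determined. The class is thereby closed under
differentiation, so estimates can be proved by induction on the order. -/
theorem FiniteBound.exists_deriv {Ω : Set (E m)} (hΩ : MeasurableSet Ω) {k : ℕ}
    {N : ℕ → E m → ℝ≥0∞} {u : E m → ℝ} (h : FiniteBound Ω (k + 1) N u) {v : E m} (hv : ‖v‖ ≤ 1) :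
    ∃ g, HasWeakDir Ω v u g ∧ FiniteBound Ω k (fun j => N (j + 1)) g := by
  obtain ⟨g, hg, hgW⟩ := h.weak.2 v hv
  have he : ∀ᵐ x, x ∈ Ω → Ω.indicator g x = g x :=
    Filter.Eventually.of_forall fun x hx => indicator_of_mem hx g
  exact ⟨Ω.indicator g, hg.congr (Filter.Eventually.of_forall fun _ _ => rfl) he,
    hgW.congr hΩ he, fun j => h.meas _, fun j hj => h.finite _ (by omega),
    fun x hx => indicator_of_notMem hx g⟩

theorem enorm_iteratedFDeriv_succ_le {f : E m → ℝ} (hf : ContDiff ℝ (⊤ : ℕ∞) f) (k : ℕ)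
    (x : E m) :
    ‖iteratedFDeriv ℝ (k + 1) f x‖ₑ ≤ ∑ i, ‖iteratedFDeriv ℝ k (partialD i f) x‖ₑ := by
  rw [← ofReal_norm]
  refine (ENNReal.ofReal_le_ofReal (norm_iteratedFDeriv_succ_le hf k x)).trans ?_
  rw [ENNReal.ofReal_sum_of_nonneg fun _ _ => norm_nonneg _]
  simp only [ofReal_norm, le_refl]

theorem sum_const_fin_le (c X : ℝ≥0∞) (k : ℕ) :
    ∑ _i : Fin (m + 1), (m + 1 : ℝ≥0∞) ^ k * c * X = (m + 1 : ℝ≥0∞) ^ (k + 1) * c * X := by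
  rw [Finset.sum_const, Finset.card_univ, Fintype.card_fin, nsmul_eq_mul, pow_succ]
  push_cast; ring

/-- The height condition is open, so the identity holds in a neighbourhood and can be differentiated
further. -/
theorem eventually_partialD_mol (hρ : IsConeKernel M l ρ) (hF : LipschitzWith M F)
    {u g : E m → ℝ} (hu : Integrable u) {i : Fin (m + 1)}
    (hg : HasWeakDir (subgraph F) (EuclideanSpace.single i 1) u g) {τ : ℝ} (hτ : 0 < τ) {x : E m}
    (hx : height F x < (7 * M + 8) * τ) :
    partialD i (mol τ ρ u) =ᶠ[nhds x] mol τ ρ g := by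
  have h1 : ∀ᶠ y in nhds x, height F y < (7 * M + 8) * τ :=
    (continuous_height hF).continuousAt.eventually_lt_const hx
  filter_upwards [h1] with y hy
  exact fderiv_mol hρ hτ hu.locallyIntegrable hg fun w hw =>
    hρ.sub_mem_subgraph hF hτ.le hy hw

/-- All derivatives fall on `u` as weak derivatives and none on the kernel, so no negative power of
`τ` appears. -/
theorem enorm_iteratedFDeriv_mol_le (hρ : IsConeKernel M l ρ) (hF : LipschitzWith M F) {k i : ℕ}
    {N : ℕ → E m → ℝ≥0∞} {u : E m → ℝ} (hu : FiniteBound (subgraph F) k N u) (hi : i ≤ k)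
    {τ : ℝ} (hτ : 0 < τ) {x : E m} (hx : height F x < (7 * M + 8) * τ) :
    ‖iteratedFDeriv ℝ i (mol τ ρ u) x‖ₑ ≤
      (m + 1 : ℝ≥0∞) ^ i * 1 * ∫⁻ w, N i (x - τ • w) * ‖ρ w‖ₑ := by
  have hΩ := (isOpen_subgraph hF).measurableSet
  induction i generalizing k N u with
  | zero =>
    rw [pow_zero, one_mul, one_mul, ← ofReal_norm, norm_iteratedFDeriv_zero, ofReal_norm]
    exact enorm_mol_le hτ.ne' hu.weak.base.2 fun w hw => hρ.sub_mem_subgraph hF hτ.le hx hw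
  | succ i ih =>
    obtain ⟨k, rfl⟩ : ∃ k', k = k' + 1 := ⟨k - 1, by omega⟩
    refine (enorm_iteratedFDeriv_succ_le
      (contDiff_mol hρ hτ (hu.integrable hΩ).locallyIntegrable) i x).trans ?_
    rw [← sum_const_fin_le]
    refine Finset.sum_le_sum fun c _ => ?_
    obtain ⟨g, hg, hgF⟩ := hu.exists_deriv hΩ (v := EuclideanSpace.single c 1)
      (norm_single_one c).le
    rw [((eventually_partialD_mol hρ hF (hu.integrable hΩ) hg hτ hx).iteratedFDeriv ℝ i).eq_of_nhds]
    exact ih hgF (by omega)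

/-- The (unnormalized) average at scale `τ` below the point `x`. -/
def coneAvg (M : ℝ≥0) (τ : ℝ) (N : E m → ℝ≥0∞) (x : E m) : ℝ≥0∞ :=
  ∫⁻ q in bigConeBox M, N (x - τ • q)

theorem enorm_iteratedFDeriv_mol_le_coneAvg (hρ : IsConeKernel M l ρ) (i : ℕ) :
    ∃ C : ℝ≥0, ∀ (F : EuclideanSpace ℝ (Fin m) → ℝ), LipschitzWith M F → ∀ (k : ℕ)
      (N : ℕ → E m → ℝ≥0∞) (u : E m → ℝ), FiniteBound (subgraph F) k N u → i ≤ k →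
      ∀ τ : ℝ, 0 < τ → ∀ x : E m, height F x ≤ τ →
      ‖iteratedFDeriv ℝ i (mol τ ρ u) x‖ₑ ≤ C * coneAvg M τ (N i) x := by
  obtain ⟨C, hC⟩ := hρ.exists_bound
  refine ⟨(m + 1) ^ i * (C * 2 ^ (m + 1)), fun F hF k N u hu hi τ hτ x hx => ?_⟩
  have hx' : height F x < (7 * M + 8) * τ := by nlinarith [M.2]
  refine (enorm_iteratedFDeriv_mol_le hρ hF hu hi hτ hx').trans ?_
  push_cast
  rw [mul_one, mul_assoc]
  gcongr
  have h1 := hρ.lintegral_mul_le hC (t := 1) (by norm_num) (by norm_num)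
    (K := fun w => N i (x - τ • w)) ((hu.meas i).comp (by fun_prop))
  simp only [one_smul] at h1
  refine h1.trans ?_
  gcongr
  exact lintegral_mono_set (coneBox_subset_bigConeBox M)

theorem integrable_mol_integrand (hρ : IsConeKernel M l ρ) {u : E m → ℝ} (hu : Integrable u)
    {τ : ℝ} (hτ : τ ≠ 0) (x : E m) : Integrable fun w => u (x - τ • w) * ρ w := by
  obtain ⟨C, hC⟩ := hρ.compact.exists_bound_of_continuous hρ.smooth.continuous
  exact Integrable.mul_bdd (c := C) ((hu.comp_sub_left x).comp_smul hτ)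
    hρ.smooth.continuous.aestronglyMeasurable (Filter.Eventually.of_forall hC)

theorem integrable_mol (hρ : IsConeKernel M l ρ) {u : E m → ℝ} (hu : Integrable u) {τ : ℝ}
    (hτ : 0 < τ) : Integrable (mol τ ρ u) := by
  rw [mol_eq_convolution hτ]
  refine hu.integrable_convolution _ ?_
  exact (contDiff_scaledKernel hρ.smooth τ).continuous.integrable_of_hasCompactSupport
    (hasCompactSupport_scaledKernel hρ.compact hτ)

/-- At a fixed scale `τ` the kernel is bounded, so `L¹` convergence of the inner mollifications
gives pointwise convergence of the outer ones. This reduces comparisons of mollifications of `u` to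
smooth functions. -/
theorem tendsto_mol_mol (hρ : IsConeKernel M l ρ) {u : E m → ℝ} (hu : Integrable u) {τ : ℝ}
    (hτ : 0 < τ) (x : E m) :
    Filter.Tendsto (fun σ => mol τ ρ (mol σ ρ u) x) (nhdsWithin 0 (Ioi 0))
      (nhds (mol τ ρ u x)) := by
  obtain ⟨C, hC⟩ := hρ.exists_bound
  rw [tendsto_iff_edist_tendsto_0]
  set K : ℝ≥0∞ := ENNReal.ofReal |(τ ^ (m + 1))⁻¹| * C with hK
  have hKt : K ≠ ∞ := ENNReal.mul_ne_top ENNReal.ofReal_ne_top ENNReal.coe_ne_top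
  have h1 := ENNReal.Tendsto.const_mul (tendsto_mol hρ hu) (Or.inr hKt) (a := K)
  rw [mul_zero] at h1
  refine tendsto_of_tendsto_of_tendsto_of_le_of_le' tendsto_const_nhds h1
    (Filter.Eventually.of_forall fun _ => zero_le) ?_
  filter_upwards [self_mem_nhdsWithin] with σ hσ
  have hint := integrable_mol hρ hu hσ
  rw [edist_eq_enorm_sub]
  have e : mol τ ρ (mol σ ρ u) x - mol τ ρ u x
      = ∫ w, (mol σ ρ u (x - τ • w) - u (x - τ • w)) * ρ w := by
    conv_lhs => rw [mol]
    rw [show mol τ ρ u x = ∫ w, u (x - τ • w) * ρ w from rfl,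
      ← integral_sub (integrable_mol_integrand hρ hint hτ.ne' x)
        (integrable_mol_integrand hρ hu hτ.ne' x)]
    congr 1; funext w; ring
  set G : E m → ℝ≥0∞ := fun y => ‖mol σ ρ u y - u y‖ₑ with hG
  rw [e]
  have hGm : AEMeasurable G volume := (hint.1.sub hu.1).enorm
  calc ‖∫ w, (mol σ ρ u (x - τ • w) - u (x - τ • w)) * ρ w‖ₑ
      ≤ ∫⁻ w, G (x - τ • w) * C := by
        refine (enorm_integral_le_lintegral_enorm _).trans (lintegral_mono fun w => ?_)
        rw [enorm_mul]
        exact mul_le_mul' le_rfl (hC w)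
    _ = (∫⁻ w, G (x - τ • w)) * C := lintegral_mul_const' _ _ ENNReal.coe_ne_top
    _ = (ENNReal.ofReal |(τ ^ (m + 1))⁻¹| * ∫⁻ y, G y) * C := by
        congr 1
        have h2 : ∫⁻ w, G (x - τ • w) = ∫⁻ z, G (x - z) ∂(Measure.map (τ • ·) volume) := by
          rw [lintegral_map']
          · rw [Measure.map_addHaar_smul _ hτ.ne']
            exact ((hGm.comp_quasiMeasurePreserving
              (Measure.measurePreserving_sub_left volume x).quasiMeasurePreserving)).smul_measure _
          · exact (measurable_const_smul τ).aemeasurable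
        rw [h2, Measure.map_addHaar_smul _ hτ.ne', lintegral_smul_measure,
          lintegral_sub_left_eq_self, finrank_euclideanSpace, Fintype.card_fin, smul_eq_mul]
    _ = K * ∫⁻ y, G y := by rw [hK]; ring

/-- Comparison of mollifications at comparable scales. -/
theorem enorm_mol_sub_mol_le (hρ : IsConeKernel M l ρ) {a : ℕ} (ha : a ≤ l) :
    ∃ C : ℝ≥0, ∀ (F : EuclideanSpace ℝ (Fin m) → ℝ), LipschitzWith M F → ∀ (k : ℕ)
      (N : ℕ → E m → ℝ≥0∞) (u : E m → ℝ), FiniteBound (subgraph F) k N u → a ≤ k →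
      ∀ τ t : ℝ, 0 < τ → 1 / 2 ≤ t → t ≤ 2 → ∀ x : E m, height F x ≤ τ →
      ‖mol (t * τ) ρ u x - mol τ ρ u x‖ₑ ≤
        C * (ENNReal.ofReal τ ^ a * coneAvg M τ (N a) x) := by
  obtain ⟨C, hC⟩ := hρ.enorm_integral_sub_le ha
  obtain ⟨R, hR⟩ := hρ.compact.isBounded.exists_norm_le
  have hIt : ∫⁻ w, ‖ρ w‖ₑ ≠ ∞ := hρ.integrable.2.ne
  refine ⟨C * ((m + 1) ^ a * (∫⁻ w, ‖ρ w‖ₑ).toNNReal),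
    fun F hF k N u hu hak τ t hτ ht ht' x hx => ?_⟩
  have hΩ := (isOpen_subgraph hF).measurableSet
  have hui := hu.integrable hΩ
  have htτ : 0 < t * τ := by positivity
  -- The moment estimate needs a smooth function, so `u` is replaced by its mollification at scale
  -- `σ`, and `σ → 0` at the end.
  have hlim : Filter.Tendsto
      (fun σ => ‖mol (t * τ) ρ (mol σ ρ u) x - mol τ ρ (mol σ ρ u) x‖ₑ) (nhdsWithin 0 (Ioi 0))
      (nhds ‖mol (t * τ) ρ u x - mol τ ρ u x‖ₑ) :=
    ((tendsto_mol_mol hρ hui htτ x).sub (tendsto_mol_mol hρ hui hτ x)).enorm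
  refine le_of_tendsto hlim ?_
  have hev : ∀ᶠ σ : ℝ in nhdsWithin 0 (Ioi 0), σ * (|R| + 1) < τ ∧ 0 < σ := by
    refine Filter.Eventually.and ?_ self_mem_nhdsWithin
    have : Filter.Tendsto (fun σ : ℝ => σ * (|R| + 1)) (nhds 0) (nhds (0 * (|R| + 1))) :=
      Filter.tendsto_id.mul_const _
    rw [zero_mul] at this
    exact nhdsWithin_le_nhds (this.eventually_lt_const hτ)
  filter_upwards [hev] with σ hσ
  obtain ⟨hσ1, hσ0⟩ := hσ
  set φ := mol σ ρ u with hφ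
  have hφs : ContDiff ℝ (⊤ : ℕ∞) φ := contDiff_mol hρ hσ0 hui.locallyIntegrable
  set Φ : E m → ℝ := fun q => φ (x - τ • q) with hΦ
  have hΦs : ContDiff ℝ (⊤ : ℕ∞) Φ :=
    hφs.comp (contDiff_const.sub (contDiff_const_smul τ))
  have h1 := hC Φ hΦs t ht ht'
  have e1 : ∫ w, Φ (t • w) * ρ w = mol (t * τ) ρ φ x := by
    simp only [hΦ, mol, smul_smul, mul_comm τ t]
  have e2 : ∫ w, Φ w * ρ w = mol τ ρ φ x := rfl
  rw [e1, e2] at h1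
  refine h1.trans ?_
  push_cast
  rw [mul_assoc]
  gcongr
  rw [ENNReal.coe_toNNReal hIt]
  have hNm : Measurable fun z : E m × E m => N a (x - τ • z.1 - σ • z.2) * ‖ρ z.2‖ₑ := by
    have h2 : Measurable fun z : E m × E m => ‖ρ z.2‖ₑ :=
      hρ.smooth.continuous.measurable.enorm.comp measurable_snd
    have h3 : Measurable fun z : E m × E m => N a (x - τ • z.1 - σ • z.2) :=
      (hu.meas a).comp (by fun_prop)
    exact h3.mul h2
  calc ∫⁻ q in coneBox M, ‖iteratedFDeriv ℝ a Φ q‖ₑ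
      ≤ ∫⁻ q in coneBox M, ENNReal.ofReal τ ^ a * ((m + 1 : ℝ≥0∞) ^ a * 1 *
          ∫⁻ w, N a (x - τ • q - σ • w) * ‖ρ w‖ₑ) := by
        refine setLIntegral_mono' (isClosed_coneBox M).measurableSet fun q hq => ?_
        have h2 := ENNReal.ofReal_le_ofReal (norm_iteratedFDeriv_comp_affine_le hφs a x q τ)
        rw [ofReal_norm, ENNReal.ofReal_mul (by positivity), ofReal_norm,
          ENNReal.ofReal_pow (abs_nonneg _), abs_of_pos hτ] at h2
        refine h2.trans ?_
        gcongr
        refine enorm_iteratedFDeriv_mol_le hρ hF hu hak hσ0 ?_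
        have h3 := height_sub_le_of_mem_bigConeBox hF hτ.le hx (coneBox_subset_bigConeBox M hq)
        have h0 : (0 : ℝ) ≤ M := M.2
        have : 0 < (7 * (M : ℝ) + 8) * σ := by positivity
        have : 0 < ((M : ℝ) + 2) * τ := by positivity
        linarith
    _ = ENNReal.ofReal τ ^ a * (m + 1 : ℝ≥0∞) ^ a *
          ∫⁻ q in coneBox M, ∫⁻ w, N a (x - τ • q - σ • w) * ‖ρ w‖ₑ := by
        simp only [mul_one, ← mul_assoc]
        rw [lintegral_const_mul _ hNm.lintegral_prod_right']
    _ = ENNReal.ofReal τ ^ a * (m + 1 : ℝ≥0∞) ^ a *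
          ∫⁻ w, ∫⁻ q in coneBox M, N a (x - τ • q - σ • w) * ‖ρ w‖ₑ := by
        rw [lintegral_lintegral_swap hNm.aemeasurable]
    _ ≤ ENNReal.ofReal τ ^ a * (m + 1 : ℝ≥0∞) ^ a *
          ∫⁻ w, coneAvg M τ (N a) x * ‖ρ w‖ₑ := by
        gcongr with w
        by_cases hw : w ∈ tsupport ρ
        · rw [lintegral_mul_const' _ _ enorm_ne_top]
          gcongr
          -- The inner shift by `σ w` amounts to moving `q` by `h` at scale `τ`. As `σ |w| ≤ τ`,
          -- this leads from `coneBox` only into `bigConeBox`, uniformly in `σ`.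
          set h : E m := (σ / τ) • w with hh
          have hhn : ‖h‖ ≤ 1 := by
            rw [hh, norm_smul, Real.norm_of_nonneg (by positivity), div_mul_eq_mul_div,
              div_le_one hτ]
            refine le_trans ?_ hσ1.le
            gcongr
            exact (hR w hw).trans ((le_abs_self R).trans (by linarith))
          have e3 : ∀ q, x - τ • q - σ • w = x - τ • (q + h) := by
            intro q
            rw [hh, smul_add, smul_smul, mul_div_cancel₀ _ hτ.ne', sub_sub]
          simp only [e3]
          unfold coneAvg
          rw [← lintegral_indicator (isClosed_coneBox M).measurableSet,
            ← lintegral_indicator (isClosed_bigConeBox M).measurableSet,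
            ← lintegral_add_right_eq_self ((bigConeBox M).indicator _) h]
          refine lintegral_mono fun q => ?_
          by_cases hq : q ∈ coneBox M
          · rw [indicator_of_mem hq, indicator_of_mem (add_mem_bigConeBox hq hhn)]
          · rw [indicator_of_notMem hq]; exact zero_le
        · simp [image_eq_zero_of_notMem_tsupport hw]
    _ = _ := by
        rw [lintegral_const_mul _ hρ.smooth.continuous.measurable.enorm]
        ring

/-- The first `b` derivatives pass to `u`; the remaining `a` come from the vanishing moments and
bring the factor `τ^a`. This factor pays for the `a` derivatives that fall on the layer partition.
-/
theorem enorm_iteratedFDeriv_mol_sub_le (hρ : IsConeKernel M l ρ) {a : ℕ} (ha : a ≤ l) :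
    ∃ C : ℝ≥0, ∀ (F : EuclideanSpace ℝ (Fin m) → ℝ), LipschitzWith M F → ∀ (b k : ℕ)
      (N : ℕ → E m → ℝ≥0∞) (u : E m → ℝ), FiniteBound (subgraph F) k N u → b + a ≤ k →
      ∀ τ t : ℝ, 0 < τ → 1 / 2 ≤ t → t ≤ 2 → ∀ x : E m, height F x ≤ τ →
      ‖iteratedFDeriv ℝ b (mol (t * τ) ρ u - mol τ ρ u) x‖ₑ ≤
        (m + 1 : ℝ≥0∞) ^ b * C * (ENNReal.ofReal τ ^ a * coneAvg M τ (N (b + a)) x) := by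
  obtain ⟨C, hC⟩ := enorm_mol_sub_mol_le (m := m) hρ ha
  refine ⟨C, fun F hF b => ?_⟩
  have hΩ := (isOpen_subgraph hF).measurableSet
  induction b with
  | zero =>
    intro k N u hu hk τ t hτ ht ht' x hx
    rw [pow_zero, one_mul, ← ofReal_norm, norm_iteratedFDeriv_zero, ofReal_norm, zero_add]
    exact hC F hF k N u hu (by omega) τ t hτ ht ht' x hx
  | succ b ih =>
    intro k N u hu hk τ t hτ ht ht' x hx
    obtain ⟨k, rfl⟩ : ∃ k', k = k' + 1 := ⟨k - 1, by omega⟩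
    have hui := hu.integrable hΩ
    have htτ : 0 < t * τ := by positivity
    have s1 := contDiff_mol hρ htτ hui.locallyIntegrable
    have s2 := contDiff_mol hρ hτ hui.locallyIntegrable
    refine (enorm_iteratedFDeriv_succ_le (f := mol (t * τ) ρ u - mol τ ρ u)
      (s1.sub s2) b x).trans ?_
    rw [← sum_const_fin_le]
    refine Finset.sum_le_sum fun c _ => ?_
    obtain ⟨g, hg, hgF⟩ := hu.exists_deriv hΩ (v := EuclideanSpace.single c 1)
      (norm_single_one c).le
    have h0 : (0 : ℝ) ≤ M := M.2
    have e1 := eventually_partialD_mol hρ hF hui hg htτ (x := x) (by nlinarith)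
    have e2 := eventually_partialD_mol hρ hF hui hg hτ (x := x) (by nlinarith)
    rw [partialD_sub s1 s2, ((e1.sub e2).iteratedFDeriv ℝ b).eq_of_nhds]
    have := ih k _ g hgF (by omega) τ t hτ ht ht' x hx
    rwa [show b + a + 1 = b + 1 + a by ring] at this

end BurenkovMorrey

end

noncomputable section

namespace BurenkovMorrey

/-! ### Smooth approximations of the extension from a subgraph -/

variable {m : ℕ}

theorem enorm_iteratedFDeriv_mul_le {f g : E m → ℝ} (hf : ContDiff ℝ (⊤ : ℕ∞) f)
    (hg : ContDiff ℝ (⊤ : ℕ∞) g) (i : ℕ) (x : E m) :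
    ‖iteratedFDeriv ℝ i (fun y => f y * g y) x‖ₑ ≤ ∑ b ∈ Finset.range (i + 1),
      (i.choose b : ℝ≥0∞) * ‖iteratedFDeriv ℝ b f x‖ₑ * ‖iteratedFDeriv ℝ (i - b) g x‖ₑ := by
  have h1 := norm_iteratedFDeriv_mul_le hf hg x (n := i) (by exact_mod_cast le_top)
  rw [← ofReal_norm]
  refine (ENNReal.ofReal_le_ofReal h1).trans (le_of_eq ?_)
  rw [ENNReal.ofReal_sum_of_nonneg fun _ _ => by positivity]
  refine Finset.sum_congr rfl fun b _ => ?_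
  rw [ENNReal.ofReal_mul (by positivity), ENNReal.ofReal_mul (by positivity), ofReal_norm,
    ofReal_norm, ENNReal.ofReal_natCast]

theorem iteratedFDeriv_mul_eq_zero {f g : E m → ℝ} (i : ℕ) {x : E m} (hx : x ∉ tsupport f) :
    iteratedFDeriv ℝ i (fun y => f y * g y) x = 0 := by
  have h1 : (fun y => f y * g y) =ᶠ[nhds x] fun _ => 0 := by
    filter_upwards [(isClosed_tsupport f).isOpen_compl.mem_nhds hx] with y hy
    rw [image_eq_zero_of_notMem_tsupport hy, zero_mul]
  rw [(h1.iteratedFDeriv ℝ i).eq_of_nhds]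
  simp

variable {M : ℝ≥0} {F : EuclideanSpace ℝ (Fin m) → ℝ} {C : MultiIndex m → ℝ} {ψ : ℤ → E m → ℝ}

theorem two_zpow_lt {a b : ℤ} : (2 : ℝ) ^ a < 2 ^ b ↔ a < b :=
  zpow_lt_zpow_iff_right₀ one_lt_two

theorem exists_mem_layer {x : E m} (hx : 0 < height F x) : ∃ k : ℤ, x ∈ layer F k := by
  obtain ⟨n, hn1, hn2⟩ := exists_mem_Ioc_zpow hx one_lt_two
  refine ⟨-(n + 1), ?_, ?_⟩
  · rw [show -(-(n + 1)) - 1 = n by ring]; exact hn1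
  · rw [neg_neg]; exact hn2

theorem IsLayerPartition.height_bounds (hψ : IsLayerPartition F C ψ) {k : ℤ} {x : E m}
    (hx : x ∈ tsupport (ψ k)) : (2 : ℝ) ^ (-k - 2) < height F x ∧ height F x ≤ 2 ^ (-k + 1) := by
  have hle : ∀ {a b : ℤ}, a ≤ b → (2 : ℝ) ^ a ≤ 2 ^ b := fun h =>
    zpow_le_zpow_right₀ one_le_two h
  rcases hψ.subset_layers k hx with (h | h) | h
  · exact ⟨lt_of_le_of_lt (hle (by omega)) h.1, h.2.trans (hle (by omega))⟩
  · exact ⟨lt_of_le_of_lt (hle (by omega)) h.1, h.2.trans (hle (by omega))⟩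
  · exact ⟨lt_of_le_of_lt (hle (by omega)) h.1, h.2.trans (hle (by omega))⟩

theorem IsLayerPartition.eq_zero (hψ : IsLayerPartition F C ψ) {k : ℤ} {x : E m}
    (hx : ¬ ((2 : ℝ) ^ (-k - 2) < height F x ∧ height F x ≤ 2 ^ (-k + 1))) : ψ k x = 0 :=
  image_eq_zero_of_notMem_tsupport fun h => hx (hψ.height_bounds h)

theorem IsLayerPartition.exists_deriv_bound (C : MultiIndex m → ℝ) (b : ℕ) :
    ∃ c : ℝ≥0, ∀ (F : EuclideanSpace ℝ (Fin m) → ℝ) (ψ : ℤ → E m → ℝ), IsLayerPartition F C ψ →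
      ∀ k x, ‖iteratedFDeriv ℝ b (ψ k) x‖ₑ ≤ c * ENNReal.ofReal ((2 : ℝ) ^ k) ^ b := by
  set S : ℝ := ∑ α ∈ multiIndexLE m b, |C α| with hS
  have hS0 : 0 ≤ S := Finset.sum_nonneg fun _ _ => abs_nonneg _
  refine ⟨((m + 1 : ℝ) ^ b * S).toNNReal, fun F ψ hψ k x => ?_⟩
  have h1 := norm_iteratedFDeriv_le_of_classicalD (hψ.smooth k) b x (c := S * ((2 : ℝ) ^ k) ^ b)
    fun α hα => by
      refine (hψ.deriv_le α k x).trans ?_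
      rw [hα, zpow_mul, zpow_natCast]
      gcongr
      refine (le_abs_self _).trans ?_
      exact Finset.single_le_sum (f := fun α => |C α|) (fun _ _ => abs_nonneg _)
        ((mem_multiIndexLE α).2 hα.le)
  rw [← ofReal_norm]
  refine (ENNReal.ofReal_le_ofReal h1).trans (le_of_eq ?_)
  rw [← mul_assoc, ENNReal.ofReal_mul (by positivity), ENNReal.ofReal_pow (by positivity)]
  rfl

variable {l : ℕ} {ρ : E m → ℝ}

/-! ### Dyadic mollifications and the truncated extension. -/

/-- The mollification of `u` at scale `2^{-k}`. -/
def dyadicMol (ρ u : E m → ℝ) (k : ℤ) : E m → ℝ := mol ((2 : ℝ) ^ (-k)) ρ u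

theorem contDiff_dyadicMol (hρ : IsConeKernel M l ρ) {u : E m → ℝ} (hu : Integrable u) (k : ℤ) :
    ContDiff ℝ (⊤ : ℕ∞) (dyadicMol ρ u k) :=
  contDiff_mol hρ (by positivity) hu.locallyIntegrable

/-- The extension of `u` from the subgraph, with the layers of index at least `K` filled in by
the mollification at scale `2^{-K}`. -/
def approxExt (ρ u : E m → ℝ) (ψ : ℤ → E m → ℝ) (K : ℤ) (x : E m) : ℝ :=
  dyadicMol ρ u K x + ∑' k : ℤ, if k < K then
    ψ k x * (dyadicMol ρ u k x - dyadicMol ρ u K x) else 0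

/-- An upper bound on the height excludes all sufficiently negative indices and truncation excludes
`k ≥ K`. The sum is therefore locally finite on the whole space, including at the graph. -/
theorem approxExt_eventuallyEq_sum (hF : LipschitzWith M F) (hψ : IsLayerPartition F C ψ)
    (u : E m → ℝ) (K k₀ : ℤ) {x : E m} (hx : height F x < 2 ^ (-k₀)) :
    approxExt ρ u ψ K =ᶠ[nhds x] fun y => dyadicMol ρ u K y + ∑ k ∈ Finset.Ico (k₀ - 1) K,
      ψ k y * (dyadicMol ρ u k y - dyadicMol ρ u K y) := by
  have h1 : ∀ᶠ y in nhds x, height F y < 2 ^ (-k₀) :=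
    (continuous_height hF).continuousAt.eventually_lt_const hx
  filter_upwards [h1] with y hy
  unfold approxExt
  rw [tsum_eq_sum (s := Finset.Ico (k₀ - 1) K)]
  · congr 1
    refine Finset.sum_congr rfl fun k hk => ?_
    rw [if_pos (Finset.mem_Ico.1 hk).2]
  · intro k hk
    split_ifs with hkK
    · have hlt : k < k₀ - 1 := by
        by_contra h
        exact hk (Finset.mem_Ico.2 ⟨not_lt.1 h, hkK⟩)
      rw [hψ.eq_zero, zero_mul]
      intro h
      have := two_zpow_lt.1 (h.1.trans hy)
      omega
    · rfl

theorem contDiff_approxExt (hρ : IsConeKernel M l ρ) (hF : LipschitzWith M F)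
    (hψ : IsLayerPartition F C ψ) {u : E m → ℝ} (hu : Integrable u) (K : ℤ) :
    ContDiff ℝ (⊤ : ℕ∞) (approxExt ρ u ψ K) := by
  rw [contDiff_iff_contDiffAt]
  intro x
  obtain ⟨n, hn⟩ := pow_unbounded_of_one_lt (height F x) one_lt_two
  have hx : height F x < 2 ^ (-(-(n : ℤ))) := by rw [neg_neg, zpow_natCast]; exact hn
  refine ContDiffAt.congr_of_eventuallyEq ?_ (approxExt_eventuallyEq_sum hF hψ u K _ hx)
  have hg := contDiff_dyadicMol hρ hu
  exact ((hg K).add (ContDiff.sum fun k _ => (hψ.smooth k).mul ((hg k).sub (hg K)))).contDiffAt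

/-- Below this height only functions `ψ k` with `k ≥ K` can be nonzero, and those are replaced by
the reference mollification. This makes the truncated extension smooth across the graph. -/
theorem approxExt_eventuallyEq_mol (hF : LipschitzWith M F) (hψ : IsLayerPartition F C ψ)
    (u : E m → ℝ) (K : ℤ) {x : E m} (hx : height F x < 2 ^ (-(K + 1))) :
    approxExt ρ u ψ K =ᶠ[nhds x] dyadicMol ρ u K := by
  refine (approxExt_eventuallyEq_sum hF hψ u K _ hx).trans ?_
  simp only [add_sub_cancel_right, Finset.Ico_self, Finset.sum_empty, add_zero]
  rfl

/-- The height range is a neighbourhood of that of the layer `k₀`; it is this open version, rather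
than the one on the layer itself, that permits differentiation. -/
theorem IsLayerPartition.sum_eq_one (hψ : IsLayerPartition F C ψ) {k₀ : ℤ} {x : E m}
    (h1 : (2 : ℝ) ^ (-k₀ - 2) < height F x) (h2 : height F x < 2 ^ (-k₀ + 1)) :
    (∀ k ∉ Finset.Icc (k₀ - 2) (k₀ + 2), ψ k x = 0) ∧
      ∑ k ∈ Finset.Icc (k₀ - 2) (k₀ + 2), ψ k x = 1 := by
  have hz : ∀ k ∉ Finset.Icc (k₀ - 2) (k₀ + 2), ψ k x = 0 := by
    intro k hk
    refine hψ.eq_zero fun h => hk (Finset.mem_Icc.2 ?_)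
    have a1 := two_zpow_lt.1 (h.1.trans h2)
    have a2 := two_zpow_lt.1 (h1.trans_le h.2)
    omega
  refine ⟨hz, ?_⟩
  rw [← tsum_eq_sum (L := SummationFilter.unconditional ℤ) hz]
  exact hψ.sum_above x (mem_above_iff.2 (lt_trans (by positivity) h1))

/-- Since the `ψ k` add up to one near `x`, the reference mollification can be chosen at will.
Truncation amounts to replacing the index `k` by `min k K`. -/
theorem approxExt_eventuallyEq_of_mem_layer (hF : LipschitzWith M F)
    (hψ : IsLayerPartition F C ψ) (u : E m → ℝ) (K k₁ : ℤ) {k₀ : ℤ} {x : E m}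
    (hx : x ∈ layer F k₀) :
    approxExt ρ u ψ K =ᶠ[nhds x] fun y => dyadicMol ρ u k₁ y +
      ∑ k ∈ Finset.Icc (k₀ - 2) (k₀ + 2),
        ψ k y * (dyadicMol ρ u (min k K) - dyadicMol ρ u k₁) y := by
  have hc := continuous_height hF
  have h1 : ∀ᶠ y in nhds x, height F y < 2 ^ (-k₀ + 1) :=
    hc.continuousAt.eventually_lt_const (lt_of_le_of_lt hx.2 (two_zpow_lt.2 (by omega)))
  have h2 : ∀ᶠ y in nhds x, (2 : ℝ) ^ (-k₀ - 2) < height F y :=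
    hc.continuousAt.eventually_const_lt (lt_trans (two_zpow_lt.2 (by omega)) hx.1)
  filter_upwards [h1, h2] with y hy1 hy2
  obtain ⟨hz, hs⟩ := hψ.sum_eq_one hy2 hy1
  unfold approxExt
  rw [tsum_eq_sum (s := Finset.Icc (k₀ - 2) (k₀ + 2)) fun k hk => by rw [hz k hk]; simp]
  have key : ∀ c : ℝ, c + ∑ k ∈ Finset.Icc (k₀ - 2) (k₀ + 2),
      ψ k y * (dyadicMol ρ u (min k K) y - c) =
      ∑ k ∈ Finset.Icc (k₀ - 2) (k₀ + 2), ψ k y * dyadicMol ρ u (min k K) y := by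
    intro c
    simp only [mul_sub, Finset.sum_sub_distrib, ← Finset.sum_mul, hs]
    ring
  simp only [Pi.sub_apply]
  rw [key, ← key (dyadicMol ρ u K y)]
  congr 1
  refine Finset.sum_congr rfl fun k _ => ?_
  split_ifs with hk
  · rw [min_eq_left hk.le]
  · rw [min_eq_right (not_lt.1 hk), sub_self, mul_zero]

theorem approxExt_eventuallyEq_approxExt (hF : LipschitzWith M F) (hψ : IsLayerPartition F C ψ)
    (u : E m → ℝ) {K K' k₀ : ℤ} {x : E m} (hx : x ∈ layer F k₀) (hK : k₀ + 2 ≤ K)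
    (hK' : k₀ + 2 ≤ K') : approxExt ρ u ψ K =ᶠ[nhds x] approxExt ρ u ψ K' := by
  refine (approxExt_eventuallyEq_of_mem_layer hF hψ u K k₀ hx).trans
    (Filter.EventuallyEq.trans ?_ (approxExt_eventuallyEq_of_mem_layer hF hψ u K' k₀ hx).symm)
  refine Filter.Eventually.of_forall fun y => ?_
  simp only [add_right_inj]
  refine Finset.sum_congr rfl fun k hk => ?_
  have := (Finset.mem_Icc.1 hk).2
  rw [min_eq_left (by omega), min_eq_left (by omega)]

theorem approxExt_eq_tsum (hF : LipschitzWith M F) (hψ : IsLayerPartition F C ψ)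
    (u : E m → ℝ) {K k₀ : ℤ} {x : E m} (hx : x ∈ layer F k₀) (hK : k₀ + 2 ≤ K) :
    approxExt ρ u ψ K x = ∑' k : ℤ, ψ k x * dyadicMol ρ u k x := by
  rw [(approxExt_eventuallyEq_of_mem_layer hF hψ u K k₀ hx).eq_of_nhds]
  obtain ⟨hz, hs⟩ := hψ.sum_eq_one (x := x) (k₀ := k₀)
    (lt_trans (two_zpow_lt.2 (by omega)) hx.1) (lt_of_le_of_lt hx.2 (two_zpow_lt.2 (by omega)))
  rw [tsum_eq_sum (s := Finset.Icc (k₀ - 2) (k₀ + 2)) fun k hk => by rw [hz k hk, zero_mul]]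
  simp only [Pi.sub_apply, mul_sub, Finset.sum_sub_distrib, ← Finset.sum_mul, hs]
  rw [one_mul, add_sub_cancel]
  refine Finset.sum_congr rfl fun k hk => ?_
  rw [min_eq_left (by have := (Finset.mem_Icc.1 hk).2; omega)]

/-- The points where the scale `2^{-k}` governs the approximation of index `K`, for `k ≤ K`. -/
def scaleRegion (F : EuclideanSpace ℝ (Fin m) → ℝ) (K k : ℤ) : Set (E m) :=
  {x | height F x ≤ 2 ^ (-k) ∧ (k < K → (2 : ℝ) ^ (-k - 1) < height F x)}

theorem exists_mem_scaleRegion (F : EuclideanSpace ℝ (Fin m) → ℝ) (K : ℤ) (x : E m) :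
    ∃ k ≤ K, x ∈ scaleRegion F K k := by
  by_cases h : height F x ≤ 2 ^ (-K)
  · exact ⟨K, le_rfl, h, fun h => absurd h (lt_irrefl _)⟩
  · rw [not_le] at h
    obtain ⟨k, hk⟩ := exists_mem_layer (F := F) (x := x) (lt_trans (by positivity) h)
    have := two_zpow_lt.1 (h.trans_le hk.2)
    exact ⟨k, by omega, hk.2, fun _ => hk.1⟩

/-- The reference index is the scale `k₁` of the point. In the Leibniz rule `b` derivatives of `ψ k`
cost `2^{kb}`, while `D^{i-b}` of a difference of mollifications gains `2^{-k₁ b}` from `b`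
vanishing moments; only derivatives of order exactly `i` of the data remain. The constant is
independent of `K`. -/
theorem enorm_iteratedFDeriv_approxExt_le (hρ : IsConeKernel M l ρ) (C : MultiIndex m → ℝ) {i : ℕ}
    (hil : i ≤ l) :
    ∃ c : ℝ≥0, ∀ (F : EuclideanSpace ℝ (Fin m) → ℝ), LipschitzWith M F →
      ∀ ψ : ℤ → E m → ℝ, IsLayerPartition F C ψ → ∀ (n : ℕ) (N : ℕ → E m → ℝ≥0∞) (u : E m → ℝ),
      FiniteBound (subgraph F) n N u → i ≤ n → ∀ K k : ℤ, k ≤ K → ∀ x ∈ scaleRegion F K k,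
      ‖iteratedFDeriv ℝ i (approxExt ρ u ψ K) x‖ₑ ≤ c * coneAvg M ((2 : ℝ) ^ (-k)) (N i) x := by
  obtain ⟨c₁, hc₁⟩ := enorm_iteratedFDeriv_mol_le_coneAvg hρ i
  choose c₂ hc₂ using fun a : Fin (l + 1) =>
    enorm_iteratedFDeriv_mol_sub_le (m := m) hρ (Nat.lt_succ_iff.1 a.2)
  choose c₃ hc₃ using fun b => IsLayerPartition.exists_deriv_bound (m := m) C b
  -- The value zero never intervenes, as `b ≤ i ≤ l` in the sum.
  set B : ℕ → ℝ≥0 := fun b => if h : b < l + 1 then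
    (i.choose b) * c₃ b * 2 ^ b * ((m + 1) ^ (i - b) * c₂ ⟨b, h⟩) else 0 with hB
  refine ⟨c₁ + 5 * ∑ b ∈ Finset.range (i + 1), B b,
    fun F hF ψ hψ n N u hu hin K k₁ hk₁ x hx => ?_⟩
  have hΩ := (isOpen_subgraph hF).measurableSet
  have hui := hu.integrable hΩ
  have hg := contDiff_dyadicMol hρ hui
  have hτ : (0 : ℝ) < 2 ^ (-k₁) := by positivity
  have hbase : ‖iteratedFDeriv ℝ i (dyadicMol ρ u k₁) x‖ₑ ≤
      c₁ * coneAvg M ((2 : ℝ) ^ (-k₁)) (N i) x := hc₁ F hF n N u hu hin _ hτ x hx.1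
  push_cast
  rw [add_mul]
  by_cases hlow : height F x < 2 ^ (-(K + 1))
  · have hk : k₁ = K := by
      by_contra hne
      have hlt : k₁ < K := by omega
      have := two_zpow_lt.1 ((hx.2 hlt).trans hlow)
      omega
    rw [((approxExt_eventuallyEq_mol hF hψ u K hlow).iteratedFDeriv ℝ i).eq_of_nhds, ← hk]
    exact hbase.trans le_self_add
  · rw [not_lt] at hlow
    have hpos : 0 < height F x := lt_of_lt_of_le (by positivity) hlow
    obtain ⟨k₀, hk₀⟩ := exists_mem_layer hpos
    -- The governing scale is that of the layer of `x`, except below height `2^{-K}`, where it is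
    -- frozen at `K`.
    have hmin : k₁ = min k₀ K := by
      have a1 := two_zpow_lt.1 (lt_of_lt_of_le hk₀.1 hx.1)
      rcases hk₁.lt_or_eq with hlt | heq
      · have a2 := two_zpow_lt.1 (lt_of_lt_of_le (hx.2 hlt) hk₀.2)
        omega
      · omega
    rw [((approxExt_eventuallyEq_of_mem_layer hF hψ u K k₁ hk₀).iteratedFDeriv ℝ i).eq_of_nhds]
    have hterm : ∀ k, ContDiff ℝ (⊤ : ℕ∞)
        (fun y => ψ k y * (dyadicMol ρ u (min k K) - dyadicMol ρ u k₁) y) := fun k =>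
      (hψ.smooth k).mul ((hg _).sub (hg _))
    have hile : ((i : ℕ∞) : WithTop ℕ∞) ≤ ((⊤ : ℕ∞) : WithTop ℕ∞) := by exact_mod_cast le_top
    rw [fun_iteratedFDeriv_add_apply ((hg k₁).of_le hile).contDiffAt
      ((ContDiff.sum fun k _ => (hterm k)).of_le hile).contDiffAt,
      iteratedFDeriv_fun_sum_apply fun k _ => ((hterm k).of_le hile).contDiffAt]
    refine (enorm_add_le _ _).trans (add_le_add hbase ?_)
    refine (enorm_sum_le _ _).trans ?_
    have hone : ∀ k ∈ Finset.Icc (k₀ - 2) (k₀ + 2), ‖iteratedFDeriv ℝ i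
        (fun y => ψ k y * (dyadicMol ρ u (min k K) - dyadicMol ρ u k₁) y) x‖ₑ ≤
        (∑ b ∈ Finset.range (i + 1), (B b : ℝ≥0∞)) * coneAvg M ((2 : ℝ) ^ (-k₁)) (N i) x := by
      intro k _
      by_cases hxs : x ∈ tsupport (ψ k)
      swap
      · rw [iteratedFDeriv_mul_eq_zero i hxs]; simp
      obtain ⟨b1, b2⟩ := hψ.height_bounds hxs
      have d1 := two_zpow_lt.1 (b1.trans_le hk₀.2)
      have d2 := two_zpow_lt.1 (hk₀.1.trans_le b2)
      -- In this case every `ψ k` alive at `x` has `k ≥ k₀ - 1 ≥ K`, so the corresponding difference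
      -- of mollifications is identically zero.
      by_cases hK : K < k₀
      · have : min k K = k₁ := by omega
        rw [this, sub_self]
        simp
      have hk10 : k₁ = k₀ := by omega
      refine (enorm_iteratedFDeriv_mul_le (g := dyadicMol ρ u (min k K) - dyadicMol ρ u k₁)
        (hψ.smooth k) ((hg _).sub (hg _)) i x).trans ?_
      rw [Finset.sum_mul]
      refine Finset.sum_le_sum fun b hb => ?_
      have hbi : b ≤ i := Nat.lt_succ_iff.1 (Finset.mem_range.1 hb)
      have hbl : b < l + 1 := by omega
      set t : ℝ := 2 ^ (k₁ - min k K) with ht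
      have hle2 : ∀ {a b : ℤ}, a ≤ b → (2 : ℝ) ^ a ≤ 2 ^ b := fun h =>
        zpow_le_zpow_right₀ one_le_two h
      have ht1 : 1 / 2 ≤ t := by
        have : (2 : ℝ) ^ (-1 : ℤ) ≤ t := hle2 (by omega)
        simpa using this
      have ht2 : t ≤ 2 := by
        have : t ≤ (2 : ℝ) ^ (1 : ℤ) := hle2 (by omega)
        simpa using this
      have htτ : t * 2 ^ (-k₁) = 2 ^ (-(min k K)) := by
        rw [ht, ← zpow_add₀ two_ne_zero]; congr 1; ring
      have h2 := hc₂ ⟨b, hbl⟩ F hF (i - b) n N u hu (by simp only; omega) _ t hτ ht1 ht2 x hx.1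
      rw [htτ] at h2
      simp only [Nat.sub_add_cancel hbi] at h2
      have h3 := hc₃ b F ψ hψ k x
      have hBb : (B b : ℝ≥0∞) = (i.choose b) * c₃ b * 2 ^ b *
          ((m + 1) ^ (i - b) * c₂ ⟨b, hbl⟩) := by
        simp only [hB, dif_pos hbl]; push_cast; rfl
      -- The cost of differentiating `ψ k` against the gain from the moments; the indices `k` and
      -- `k₁ = k₀` differ by at most one.
      have hsc : ENNReal.ofReal ((2 : ℝ) ^ k) ^ b * ENNReal.ofReal ((2 : ℝ) ^ (-k₁)) ^ b ≤ 2 ^ b := by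
        rw [← mul_pow, ← ENNReal.ofReal_mul (by positivity), ← zpow_add₀ two_ne_zero]
        gcongr
        have : (2 : ℝ) ^ (k + -k₁) ≤ 2 ^ (1 : ℤ) := hle2 (by omega)
        rw [zpow_one] at this
        simpa using ENNReal.ofReal_le_ofReal this
      calc (i.choose b : ℝ≥0∞) * ‖iteratedFDeriv ℝ b (ψ k) x‖ₑ * ‖iteratedFDeriv ℝ (i - b)
            (dyadicMol ρ u (min k K) - dyadicMol ρ u k₁) x‖ₑ
          ≤ (i.choose b : ℝ≥0∞) * (c₃ b * ENNReal.ofReal ((2 : ℝ) ^ k) ^ b) *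
            ((m + 1 : ℝ≥0∞) ^ (i - b) * c₂ ⟨b, hbl⟩ *
              (ENNReal.ofReal ((2 : ℝ) ^ (-k₁)) ^ b * coneAvg M ((2 : ℝ) ^ (-k₁)) (N i) x)) := by
            gcongr
            exact h2
        _ = (i.choose b : ℝ≥0∞) * c₃ b * (ENNReal.ofReal ((2 : ℝ) ^ k) ^ b *
              ENNReal.ofReal ((2 : ℝ) ^ (-k₁)) ^ b) * ((m + 1 : ℝ≥0∞) ^ (i - b) * c₂ ⟨b, hbl⟩) *
              coneAvg M ((2 : ℝ) ^ (-k₁)) (N i) x := by ring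
        _ ≤ _ := by
            rw [hBb]
            gcongr
    refine (Finset.sum_le_sum hone).trans (le_of_eq ?_)
    rw [Finset.sum_const, Int.card_Icc, nsmul_eq_mul,
      show (k₀ + 2 + 1 - (k₀ - 2)).toNat = 5 by omega]
    push_cast; ring

end BurenkovMorrey

end

noncomputable section

namespace BurenkovMorrey

/-! ### Integral estimates and convergence of the approximations -/

variable {m : ℕ}

theorem rpow_lintegral_le {α : Type*} [MeasurableSpace α] (μ : Measure α) {f : α → ℝ≥0∞}
    (hf : Measurable f) {p : ℝ} (hp : 1 ≤ p) :
    (∫⁻ x, f x ∂μ) ^ p ≤ μ univ ^ (p - 1) * ∫⁻ x, f x ^ p ∂μ := by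
  have h1 := eLpNorm'_le_eLpNorm'_mul_rpow_measure_univ one_pos hp (μ := μ)
    (f := f) hf.aestronglyMeasurable
  simp only [eLpNorm', enorm_eq_self, ENNReal.rpow_one, div_one] at h1
  have hp0 : 0 < p := by linarith
  refine (ENNReal.rpow_le_rpow h1 hp0.le).trans (le_of_eq ?_)
  rw [ENNReal.mul_rpow_of_nonneg _ _ hp0.le, ← ENNReal.rpow_mul, ← ENNReal.rpow_mul,
    one_div_mul_cancel hp0.ne', ENNReal.rpow_one, mul_comm]
  congr 2
  field_simp

variable {M : ℝ≥0} {F : EuclideanSpace ℝ (Fin m) → ℝ}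

theorem measurable_height (hF : LipschitzWith M F) : Measurable (height F) :=
  (continuous_height hF).measurable

theorem measurableSet_scaleRegion (hF : LipschitzWith M F) (K k : ℤ) :
    MeasurableSet (scaleRegion F K k) := by
  have h1 : MeasurableSet {x : E m | height F x ≤ 2 ^ (-k)} :=
    measurableSet_le (measurable_height hF) measurable_const
  by_cases hk : k < K
  · have h2 : MeasurableSet {x : E m | (2 : ℝ) ^ (-k - 1) < height F x} :=
      measurableSet_lt measurable_const (measurable_height hF)
    convert h1.inter h2 using 1
    ext x
    simp [scaleRegion, hk]
  · convert h1 using 1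
    ext x
    simp [scaleRegion, hk]

/-- Bounded overlap of the translated regions. -/
theorem exists_finset_scaleRegion (hF : LipschitzWith M F) (K : ℤ) {q : E m}
    (hq : q ∈ bigConeBox M) (y : E m) : ∃ T : Finset ℤ, T.card ≤ 12 ∧
      ∀ k ≤ K, y + (2 : ℝ) ^ (-k) • q ∈ scaleRegion F K k → k ∈ T := by
  -- For `k < K` the translated point has positive height, so the depth of `y` is comparable to
  -- `2^{-k}` from both sides. For `k = K` there is no upper bound on the depth, and that index is
  -- counted separately.
  have key : ∀ k, k < K → y + (2 : ℝ) ^ (-k) • q ∈ scaleRegion F K k →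
      ((M : ℝ) + 2) * 2 ^ (-k) ≤ -height F y ∧ -height F y ≤ 35 * ((M : ℝ) + 1) * 2 ^ (-k) := by
    intro k hkK hk
    have hpos : (0 : ℝ) ≤ 2 ^ (-k) := by positivity
    have h1 := height_sub_le_of_mem_bigConeBox hF hpos hk.1 hq
    have h2 := le_height_sub_of_mem_bigConeBox hF (x := y + (2 : ℝ) ^ (-k) • q) hpos hq
    rw [add_sub_cancel_right] at h1 h2
    have h3 : (0 : ℝ) < height F (y + (2 : ℝ) ^ (-k) • q) :=
      lt_trans (by positivity) (hk.2 hkK)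
    constructor <;> linarith
  have h0 : (0 : ℝ) ≤ M := M.2
  -- The two-sided bounds on the depth of `y` differ by the factor `35 (M + 1) / (M + 2)`, which is
  -- below `64 = 2^6`.
  have cmp : ∀ k k', k < K → k' < K → y + (2 : ℝ) ^ (-k) • q ∈ scaleRegion F K k →
      y + (2 : ℝ) ^ (-k') • q ∈ scaleRegion F K k' → k' - 6 < k := by
    intro k k' hk hk' h h'
    have h1 := (key k hk h).1.trans (key k' hk' h').2
    have h2 : ((M : ℝ) + 2) * 2 ^ (-k) < ((M : ℝ) + 2) * 2 ^ (-k' + 6) := by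
      refine lt_of_le_of_lt h1 ?_
      rw [zpow_add₀ two_ne_zero, show (2 : ℝ) ^ (6 : ℤ) = 64 by norm_num]
      have : (0 : ℝ) < 2 ^ (-k') := by positivity
      nlinarith [mul_nonneg h0 this.le]
    have h3 := two_zpow_lt.1 (lt_of_mul_lt_mul_left h2 (by positivity))
    omega
  by_cases hex : ∃ k₁, k₁ < K ∧ y + (2 : ℝ) ^ (-k₁) • q ∈ scaleRegion F K k₁
  · obtain ⟨k₁, hk₁, h₁⟩ := hex
    -- Eleven indices around `k₁` and the exceptional index `K` make twelve.
    refine ⟨insert K (Finset.Icc (k₁ - 5) (k₁ + 5)), ?_, fun k hk h => ?_⟩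
    · refine (Finset.card_insert_le _ _).trans ?_
      rw [Int.card_Icc]; omega
    · rcases hk.lt_or_eq with hlt | rfl
      · have a1 := cmp k k₁ hlt hk₁ h h₁
        have a2 := cmp k₁ k hk₁ hlt h₁ h
        exact Finset.mem_insert_of_mem (Finset.mem_Icc.2 ⟨by omega, by omega⟩)
      · exact Finset.mem_insert_self _ _
  · refine ⟨{K}, by simp, fun k hk h => ?_⟩
    rcases hk.lt_or_eq with hlt | rfl
    · exact absurd ⟨k, hlt, h⟩ hex
    · simp

/-- After the substitution `y = x - 2^{-k} q` the sum of integrals carries the weight that counts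
the admissible `k` for `y`, which is at most twelve. -/
theorem tsum_lintegral_scaleRegion_le (hF : LipschitzWith M F) (K : ℤ) {q : E m}
    (hq : q ∈ bigConeBox M) {G : E m → ℝ≥0∞} (hG : Measurable G) {S S' : Set (E m)}
    (hS : MeasurableSet S) (hS' : MeasurableSet S')
    (h : ∀ k ≤ K, ∀ x ∈ S ∩ scaleRegion F K k, x - (2 : ℝ) ^ (-k) • q ∈ S') :
    ∑' k : {k : ℤ // k ≤ K}, ∫⁻ x in S ∩ scaleRegion F K k, G (x - (2 : ℝ) ^ (-(k : ℤ)) • q) ≤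
      12 * ∫⁻ y in S', G y := by
  set I : {k : ℤ // k ≤ K} → E m → ℝ≥0∞ := fun k y =>
    (S ∩ scaleRegion F K k).indicator 1 (y + (2 : ℝ) ^ (-(k : ℤ)) • q) with hI
  have hm : ∀ k : {k : ℤ // k ≤ K}, MeasurableSet (S ∩ scaleRegion F K k) := fun k =>
    hS.inter (measurableSet_scaleRegion hF K k)
  have hIm : ∀ k, Measurable (I k) := fun k =>
    (measurable_one.indicator (hm k)).comp (measurable_id.add_const _)
  have e : ∀ k : {k : ℤ // k ≤ K}, ∫⁻ x in S ∩ scaleRegion F K k,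
      G (x - (2 : ℝ) ^ (-(k : ℤ)) • q) = ∫⁻ y, I k y * G y := by
    intro k
    rw [← lintegral_indicator (hm k),
      ← lintegral_add_right_eq_self _ ((2 : ℝ) ^ (-(k : ℤ)) • q)]
    refine lintegral_congr fun y => ?_
    by_cases hy : y + (2 : ℝ) ^ (-(k : ℤ)) • q ∈ S ∩ scaleRegion F K k
    · simp only [hI, indicator_of_mem hy, add_sub_cancel_right, Pi.one_apply, one_mul]
    · simp only [hI, indicator_of_notMem hy, zero_mul]
  simp only [e]
  rw [← lintegral_tsum (f := fun k y => I k y * G y) fun k => ((hIm k).mul hG).aemeasurable,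
    ← lintegral_indicator hS',
    ← lintegral_const_mul _ (hG.indicator hS')]
  refine lintegral_mono fun y => ?_
  rw [ENNReal.tsum_mul_right]
  by_cases hy : y ∈ S'
  · rw [indicator_of_mem hy]
    gcongr
    obtain ⟨T, hT, hTm⟩ := exists_finset_scaleRegion hF K hq y
    classical
    have hz : ∀ k ∉ T.subtype (fun k => k ≤ K), I k y = 0 := by
      intro k hk
      refine indicator_of_notMem (fun h' => hk ?_) _
      rw [Finset.mem_subtype]
      exact hTm k k.2 h'.2
    rw [tsum_eq_sum hz]
    calc ∑ k ∈ T.subtype (fun k => k ≤ K), I k y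
        ≤ ∑ k ∈ T.subtype (fun k => k ≤ K), (1 : ℝ≥0∞) :=
          Finset.sum_le_sum fun k _ => indicator_le_self' (by simp) _
      _ ≤ 12 := by
        rw [Finset.sum_const, nsmul_eq_mul, mul_one]
        have : (T.subtype (fun k => k ≤ K)).card ≤ 12 := by
          rw [Finset.card_subtype]
          exact (Finset.card_filter_le _ _).trans hT
        exact_mod_cast this
  · have hz : ∀ k, I k y = 0 := fun k => indicator_of_notMem (fun h' => hy (by
      have := h k k.2 _ h'
      rwa [add_sub_cancel_right] at this)) _
    simp [hz]

variable {C : MultiIndex m → ℝ} {ψ : ℤ → E m → ℝ} {l : ℕ} {ρ : E m → ℝ}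

theorem measurable_iteratedFDeriv_enorm {f : E m → ℝ} (hf : ContDiff ℝ (⊤ : ℕ∞) f) (i : ℕ) :
    Measurable fun x => ‖iteratedFDeriv ℝ i f x‖ₑ :=
  (hf.continuous_iteratedFDeriv (by exact_mod_cast le_top)).enorm.measurable

/-- The integral of a derivative of the approximations over a set is controlled by the integrals
of the given bound over the sets reached by translations. -/
theorem setLIntegral_approxExt_le (hρ : IsConeKernel M l ρ) (C : MultiIndex m → ℝ) {i : ℕ}
    (hil : i ≤ l) {p : ℝ} (hp : 1 ≤ p) :
    ∃ c : ℝ≥0, ∀ (F : EuclideanSpace ℝ (Fin m) → ℝ), LipschitzWith M F →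
      ∀ ψ : ℤ → E m → ℝ, IsLayerPartition F C ψ → ∀ (n : ℕ) (N : ℕ → E m → ℝ≥0∞) (u : E m → ℝ),
      FiniteBound (subgraph F) n N u → i ≤ n → ∀ (K : ℤ) (S : Set (E m)), MeasurableSet S →
      ∀ Λ : ℝ≥0∞, (∀ q ∈ bigConeBox M, ∃ S' : Set (E m), MeasurableSet S' ∧
        (∀ k ≤ K, ∀ x ∈ S ∩ scaleRegion F K k, x - (2 : ℝ) ^ (-k) • q ∈ S') ∧
        ∫⁻ y in S', N i y ^ p ≤ Λ) →
      ∫⁻ x in S, ‖iteratedFDeriv ℝ i (approxExt ρ u ψ K) x‖ₑ ^ p ≤ c * Λ := by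
  obtain ⟨c, hc⟩ := enorm_iteratedFDeriv_approxExt_le hρ C hil
  have hp0 : 0 ≤ p := by linarith
  set V : ℝ≥0∞ := volume (bigConeBox M : Set (E m)) with hV
  have hVt : V ≠ ∞ := (volume_bigConeBox_lt_top M).ne
  have hct : (c : ℝ≥0∞) ^ p * V ^ (p - 1) * (12 * V) ≠ ∞ := by
    refine ENNReal.mul_ne_top (ENNReal.mul_ne_top ?_ ?_) (ENNReal.mul_ne_top (by simp) hVt)
    · exact ENNReal.rpow_ne_top_of_nonneg hp0 ENNReal.coe_ne_top
    · exact ENNReal.rpow_ne_top_of_nonneg (by linarith) hVt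
  refine ⟨((c : ℝ≥0∞) ^ p * V ^ (p - 1) * (12 * V)).toNNReal,
    fun F hF ψ hψ n N u hu hin K S hS Λ hΛ => ?_⟩
  rw [ENNReal.coe_toNNReal hct]
  have hcov : S ⊆ ⋃ k : {k : ℤ // k ≤ K}, S ∩ scaleRegion F K k := by
    intro x hx
    obtain ⟨k, hk, hxk⟩ := exists_mem_scaleRegion F K x
    exact mem_iUnion.2 ⟨⟨k, hk⟩, hx, hxk⟩
  have hGm : Measurable fun y => N i y ^ p := (hu.meas i).pow_const p
  have hm : ∀ k : {k : ℤ // k ≤ K}, MeasurableSet (S ∩ scaleRegion F K k) := fun k =>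
    hS.inter (measurableSet_scaleRegion hF K k)
  have hjm : ∀ k : {k : ℤ // k ≤ K}, Measurable
      fun z : E m × E m => N i (z.1 - (2 : ℝ) ^ (-(k : ℤ)) • z.2) ^ p := fun k =>
    hGm.comp (by fun_prop)
  have hpt : ∀ k : {k : ℤ // k ≤ K}, ∀ x ∈ S ∩ scaleRegion F K k,
      ‖iteratedFDeriv ℝ i (approxExt ρ u ψ K) x‖ₑ ^ p ≤ (c : ℝ≥0∞) ^ p * V ^ (p - 1) *
        ∫⁻ q in bigConeBox M, N i (x - (2 : ℝ) ^ (-(k : ℤ)) • q) ^ p := by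
    intro k x hx
    have h1 := hc F hF ψ hψ n N u hu hin K k k.2 x hx.2
    refine (ENNReal.rpow_le_rpow h1 hp0).trans ?_
    rw [ENNReal.mul_rpow_of_nonneg _ _ hp0, mul_assoc]
    gcongr
    have h2 := rpow_lintegral_le (volume.restrict (bigConeBox M))
      (f := fun q => N i (x - (2 : ℝ) ^ (-(k : ℤ)) • q)) ((hu.meas i).comp (by fun_prop)) hp
    rwa [Measure.restrict_apply_univ] at h2
  calc ∫⁻ x in S, ‖iteratedFDeriv ℝ i (approxExt ρ u ψ K) x‖ₑ ^ p
      ≤ ∫⁻ x in ⋃ k : {k : ℤ // k ≤ K}, S ∩ scaleRegion F K k,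
          ‖iteratedFDeriv ℝ i (approxExt ρ u ψ K) x‖ₑ ^ p := lintegral_mono_set hcov
    _ ≤ ∑' k : {k : ℤ // k ≤ K}, ∫⁻ x in S ∩ scaleRegion F K k,
          ‖iteratedFDeriv ℝ i (approxExt ρ u ψ K) x‖ₑ ^ p := lintegral_iUnion_le _ _
    _ ≤ ∑' k : {k : ℤ // k ≤ K}, ∫⁻ x in S ∩ scaleRegion F K k, (c : ℝ≥0∞) ^ p * V ^ (p - 1) *
          ∫⁻ q in bigConeBox M, N i (x - (2 : ℝ) ^ (-(k : ℤ)) • q) ^ p :=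
        ENNReal.tsum_le_tsum fun k => setLIntegral_mono' (hm k) (hpt k)
    _ = (c : ℝ≥0∞) ^ p * V ^ (p - 1) * ∑' k : {k : ℤ // k ≤ K}, ∫⁻ q in bigConeBox M,
          ∫⁻ x in S ∩ scaleRegion F K k, N i (x - (2 : ℝ) ^ (-(k : ℤ)) • q) ^ p := by
        rw [← ENNReal.tsum_mul_left]
        refine tsum_congr fun k => ?_
        rw [lintegral_const_mul _ (hjm k).lintegral_prod_right',
          lintegral_lintegral_swap (hjm k).aemeasurable]
    _ = (c : ℝ≥0∞) ^ p * V ^ (p - 1) * ∫⁻ q in bigConeBox M, ∑' k : {k : ℤ // k ≤ K},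
          ∫⁻ x in S ∩ scaleRegion F K k, N i (x - (2 : ℝ) ^ (-(k : ℤ)) • q) ^ p := by
        rw [lintegral_tsum fun k => (hjm k).lintegral_prod_left'.aemeasurable]
    -- The integral over `q` is now outermost, so the receiving set `S'` may depend on `q`. The ball
    -- estimate relies on this freedom.
    _ ≤ (c : ℝ≥0∞) ^ p * V ^ (p - 1) * ∫⁻ q in (bigConeBox M : Set (E m)), 12 * Λ := by
        refine mul_le_mul' le_rfl ?_
        refine setLIntegral_mono measurable_const fun q hq => ?_
        obtain ⟨S', hS', h1, h2⟩ := hΛ q hq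
        refine (tsum_lintegral_scaleRegion_le hF K hq hGm hS hS' h1).trans ?_
        gcongr
    _ = _ := by rw [setLIntegral_const]; ring

/-- The global version of the integral estimate. -/
theorem lintegral_approxExt_le (hρ : IsConeKernel M l ρ) (C : MultiIndex m → ℝ) {i : ℕ}
    (hil : i ≤ l) {p : ℝ} (hp : 1 ≤ p) :
    ∃ c : ℝ≥0, ∀ (F : EuclideanSpace ℝ (Fin m) → ℝ), LipschitzWith M F →
      ∀ ψ : ℤ → E m → ℝ, IsLayerPartition F C ψ → ∀ (n : ℕ) (N : ℕ → E m → ℝ≥0∞) (u : E m → ℝ),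
      FiniteBound (subgraph F) n N u → i ≤ n → ∀ K : ℤ,
      ∫⁻ x, ‖iteratedFDeriv ℝ i (approxExt ρ u ψ K) x‖ₑ ^ p ≤ c * ∫⁻ y, N i y ^ p := by
  obtain ⟨c, hc⟩ := setLIntegral_approxExt_le hρ C hil hp
  refine ⟨c, fun F hF ψ hψ n N u hu hin K => ?_⟩
  have := hc F hF ψ hψ n N u hu hin K univ MeasurableSet.univ (∫⁻ y, N i y ^ p)
    fun q _ => ⟨univ, MeasurableSet.univ, fun _ _ _ _ => mem_univ _, by simp⟩
  simpa using this

/-- The version of the integral estimate on balls. -/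
theorem lintegral_ball_approxExt_le (hρ : IsConeKernel M l ρ) (C : MultiIndex m → ℝ) {i : ℕ}
    (hil : i ≤ l) {p : ℝ} (hp : 1 ≤ p) :
    ∃ c : ℝ≥0, ∀ (F : EuclideanSpace ℝ (Fin m) → ℝ), LipschitzWith M F →
      ∀ ψ : ℤ → E m → ℝ, IsLayerPartition F C ψ → ∀ (n : ℕ) (N : ℕ → E m → ℝ≥0∞) (u : E m → ℝ),
      FiniteBound (subgraph F) n N u → i ≤ n → ∀ (K : ℤ) (x₀ : E m) (r : ℝ), 0 < r →
      ∀ Λ : ℝ≥0∞, (∀ y, ∫⁻ z in Metric.ball y ((1 + 576 * ((M : ℝ) + 1) ^ 2) * r), N i z ^ p ≤ Λ) →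
      ∫⁻ x in Metric.ball x₀ r, ‖iteratedFDeriv ℝ i (approxExt ρ u ψ K) x‖ₑ ^ p ≤ c * Λ := by
  obtain ⟨c, hc⟩ := setLIntegral_approxExt_le hρ C hil hp
  refine ⟨4 * c, fun F hF ψ hψ n N u hu hin K x₀ r hr Λ hΛ => ?_⟩
  have h0 : (0 : ℝ) ≤ M := M.2
  have hR : 1 ≤ 1 + 576 * ((M : ℝ) + 1) ^ 2 := by nlinarith [sq_nonneg ((M : ℝ) + 1)]
  have hsmall : ∀ y, ∫⁻ z in Metric.ball y r, N i z ^ p ≤ Λ := fun y =>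
    (lintegral_mono_set (Metric.ball_subset_ball (by nlinarith))).trans (hΛ y)
  have hm := measurable_height hF
  set Sa : Set (E m) := Metric.ball x₀ r ∩ {x | height F x ≤ 2 ^ (-K)} with hSa
  set Sb : Set (E m) := Metric.ball x₀ r ∩ {x | 2 ^ (-K) < height F x} with hSb
  have hSam : MeasurableSet Sa := measurableSet_ball.inter (measurableSet_le hm measurable_const)
  have hSbm : MeasurableSet Sb := measurableSet_ball.inter (measurableSet_lt measurable_const hm)
  have hun : Metric.ball x₀ r ⊆ Sa ∪ Sb := fun x hx =>
    (le_or_gt (height F x) (2 ^ (-K))).imp (fun h => ⟨hx, h⟩) fun h => ⟨hx, h⟩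
  have hball : ∀ (k : ℤ) (q x : E m), x ∈ Metric.ball x₀ r →
      x - (2 : ℝ) ^ (-k) • q ∈ Metric.ball (x₀ - (2 : ℝ) ^ (-k) • q) r := by
    intro k q x hx
    rw [Metric.mem_ball, dist_sub_right]; exact hx
  -- At heights at most `2^{-K}` the only scale is `2^{-K}`, and the ball is just translated.
  have ha : ∫⁻ x in Sa, ‖iteratedFDeriv ℝ i (approxExt ρ u ψ K) x‖ₑ ^ p ≤ c * Λ := by
    refine hc F hF ψ hψ n N u hu hin K Sa hSam Λ fun q hq =>
      ⟨Metric.ball (x₀ - (2 : ℝ) ^ (-K) • q) r, measurableSet_ball, fun k hk x hx => ?_, hsmall _⟩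
    have : k = K := by
      by_contra hne
      have hlt : k < K := by omega
      have := two_zpow_lt.1 ((hx.2.2 hlt).trans_le hx.1.2)
      omega
    subst this
    exact hball k q x hx.1.1
  have hb : ∫⁻ x in Sb, ‖iteratedFDeriv ℝ i (approxExt ρ u ψ K) x‖ₑ ^ p ≤ c * (3 * Λ) := by
    have hkK : ∀ k ≤ K, ∀ x ∈ Sb ∩ scaleRegion F K k, (2 : ℝ) ^ (-k - 1) < height F x := by
      intro k hk x hx
      have := two_zpow_lt.1 (hx.1.2.trans_le hx.2.1)
      exact hx.2.2 (by omega)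
    -- In the low case `2^{-k} < 16 (M + 1) r` and `‖q‖ ≤ 36 (M + 1)`, so translations are shorter
    -- than `576 (M + 1)^2 r`; this explains the enlargement factor.
    by_cases hA : ∀ x ∈ Sb, height F x ≤ 8 * ((M : ℝ) + 1) * r
    · refine hc F hF ψ hψ n N u hu hin K Sb hSbm (3 * Λ) fun q hq =>
        ⟨Metric.ball x₀ ((1 + 576 * ((M : ℝ) + 1) ^ 2) * r), measurableSet_ball,
          fun k hk x hx => ?_, (hΛ x₀).trans (le_mul_of_one_le_left zero_le (by norm_num))⟩
      have h1 := (hkK k hk x hx).trans_le (hA x hx.1)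
      rw [zpow_sub_one₀ two_ne_zero] at h1
      have h2 : (2 : ℝ) ^ (-k) < 16 * ((M : ℝ) + 1) * r := by linarith
      have h3 := norm_le_of_mem_bigConeBox hq
      have h4 : dist x x₀ < r := hx.1.1
      have h5 : ‖(2 : ℝ) ^ (-k) • q‖ ≤ 16 * ((M : ℝ) + 1) * r * (36 * ((M : ℝ) + 1)) := by
        rw [norm_smul, Real.norm_of_nonneg (by positivity)]
        gcongr
      rw [Metric.mem_ball]
      calc dist (x - (2 : ℝ) ^ (-k) • q) x₀
          ≤ dist (x - (2 : ℝ) ^ (-k) • q) x + dist x x₀ := dist_triangle _ _ _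
        _ < 16 * ((M : ℝ) + 1) * r * (36 * ((M : ℝ) + 1)) + r := by
            refine add_lt_add_of_le_of_lt ?_ h4
            rw [dist_eq_norm]
            simpa using h5
        _ = _ := by ring
    · push Not at hA
      obtain ⟨x₁, hx₁, hbig⟩ := hA
      obtain ⟨k₁, hk₁, hr₁⟩ := exists_mem_scaleRegion F K x₁
      have hl₁ := hkK k₁ hk₁ x₁ ⟨hx₁, hr₁⟩
      refine hc F hF ψ hψ n N u hu hin K Sb hSbm (3 * Λ) fun q hq =>
        ⟨Metric.ball (x₀ - (2 : ℝ) ^ (-(k₁ - 1)) • q) r ∪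
          (Metric.ball (x₀ - (2 : ℝ) ^ (-k₁) • q) r ∪
            Metric.ball (x₀ - (2 : ℝ) ^ (-(k₁ + 1)) • q) r),
          measurableSet_ball.union (measurableSet_ball.union measurableSet_ball),
          fun k hk x hx => ?_, ?_⟩
      · have hd : ‖x - x₁‖ < 2 * r := by
          rw [← dist_eq_norm]
          have h1 : dist x x₀ < r := hx.1.1
          have h2 : dist x₁ x₀ < r := hx₁.1
          have := dist_triangle_right x x₁ x₀
          linarith
        have hh := abs_le.1 (abs_height_sub_height_le hF x x₁)
        -- Heights on the ball differ from that of `x₁` by at most `2 (M + 1) r`, less than a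
        -- quarter of the height of `x₁`. Hence only the scale of `x₁` and its two neighbours occur.
        have hb2 : ((M : ℝ) + 1) * ‖x - x₁‖ ≤ ((M : ℝ) + 1) * (2 * r) := by gcongr
        have e1 : (2 : ℝ) ^ (-k₁ + 1) = 2 * 2 ^ (-k₁) := by
          rw [zpow_add_one₀ two_ne_zero]; ring
        have e2 : (2 : ℝ) ^ (-k₁ - 1) = 2 * 2 ^ (-k₁ - 2) := by
          rw [show -k₁ - 1 = (-k₁ - 2) + 1 by ring, zpow_add_one₀ two_ne_zero]; ring
        have hlx := hkK k hk x hx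
        have a1 := hr₁.1
        have a2 : (2 : ℝ) ^ (-k - 1) < 2 ^ (-k₁ + 1) := by rw [e1]; linarith [hh.2]
        have a3 : (2 : ℝ) ^ (-k₁ - 2) < 2 ^ (-k) := by
          have := hx.2.1
          have h4 : (0 : ℝ) < 2 ^ (-k₁ - 2) := by positivity
          linarith [hh.1]
        have b1 := two_zpow_lt.1 a2
        have b2 := two_zpow_lt.1 a3
        have hk3 : k = k₁ - 1 ∨ k = k₁ ∨ k = k₁ + 1 := by omega
        rcases hk3 with rfl | rfl | rfl
        · exact Or.inl (hball _ q x hx.1.1)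
        · exact Or.inr (Or.inl (hball _ q x hx.1.1))
        · exact Or.inr (Or.inr (hball _ q x hx.1.1))
      · refine (lintegral_union_le _ _ _).trans ?_
        refine (add_le_add (hsmall _) ((lintegral_union_le _ _ _).trans
          (add_le_add (hsmall _) (hsmall _)))).trans (le_of_eq ?_)
        ring
  calc ∫⁻ x in Metric.ball x₀ r, ‖iteratedFDeriv ℝ i (approxExt ρ u ψ K) x‖ₑ ^ p
      ≤ _ := (lintegral_mono_set hun).trans (lintegral_union_le _ _ _)
    _ ≤ c * Λ + c * (3 * Λ) := add_le_add ha hb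
    _ = _ := by push_cast; ring

/-! ### Convergence of the truncated extensions in the mean. -/

theorem volume_graph (hF : LipschitzWith M F) : volume {x : E m | height F x = 0} = 0 := by
  set e : E m := EuclideanSpace.single (Fin.last m) 1 with he
  have hb : ∀ c : ℝ, bar (c • e) = 0 := by
    intro c; ext i; simp [bar, he]
  have hl : ∀ c : ℝ, lastCoord (c • e) = c := by
    intro c; simp [lastCoord, he]
  have hh : ∀ (c : ℝ) (x : E m), height F (c • e + x) = c + height F x := by
    intro c x
    simp only [height, bar_add, lastCoord_add, hb, hl, zero_add]; ring
  -- Infinitely many vertical translates of the graph by a bounded sequence are pairwise disjoint,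
  -- which forces measure zero.
  refine Measure.addHaar_eq_zero_of_disjoint_translates volume
    (fun n : ℕ => (1 / ((n : ℝ) + 1)) • e) ?_ ?_
    (measurableSet_eq_fun (measurable_height hF) measurable_const)
  · refine (Metric.isBounded_closedBall (x := (0 : E m)) (r := 1)).subset ?_
    rintro _ ⟨n, rfl⟩
    rw [mem_closedBall_zero_iff, norm_smul, he, norm_single_one, mul_one,
      Real.norm_of_nonneg (by positivity), div_le_one (by positivity)]
    linarith [(Nat.cast_nonneg n : (0 : ℝ) ≤ n)]
  · intro a b hab
    rw [Function.onFun, Set.disjoint_left]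
    rintro _ ⟨_, rfl, x, hx, rfl⟩ ⟨_, rfl, y, hy, hxy⟩
    have h1 := congrArg (height F) hxy
    simp only [hh] at h1
    rw [show height F x = 0 from hx, show height F y = 0 from hy] at h1
    apply hab
    simp only [add_zero] at h1
    rw [one_div, one_div, inv_inj, add_left_inj] at h1
    exact_mod_cast h1.symm

theorem tendsto_two_zpow_neg :
    Filter.Tendsto (fun K : ℕ => (2 : ℝ) ^ (-(K : ℤ))) Filter.atTop (nhdsWithin 0 (Ioi 0)) := by
  refine tendsto_nhdsWithin_iff.2 ⟨?_, Filter.Eventually.of_forall fun K => ?_⟩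
  · have := tendsto_pow_atTop_nhds_zero_of_lt_one (r := (1 / 2 : ℝ)) (by norm_num) (by norm_num)
    refine this.congr fun K => ?_
    rw [zpow_neg, zpow_natCast, one_div, inv_pow]
  · exact mem_Ioi.2 (by positivity)

theorem tendsto_lintegral_dyadicMol (hρ : IsConeKernel M l ρ) {u : E m → ℝ} (hu : Integrable u) :
    Filter.Tendsto (fun K : ℕ => ∫⁻ x, ‖dyadicMol ρ u K x - u x‖ₑ) Filter.atTop (nhds 0) :=
  (tendsto_mol hρ hu).comp tendsto_two_zpow_neg

/-- On and below the graph, derivatives of mollifications are mollifications of weak derivatives, so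
convergence in the mean passes inductively to all orders. -/
theorem tendsto_lintegral_dyadicMol_sub (hρ : IsConeKernel M l ρ) (hF : LipschitzWith M F)
    {n i : ℕ} {N : ℕ → E m → ℝ≥0∞} {u : E m → ℝ} (hu : FiniteBound (subgraph F) n N u)
    (hi : i ≤ n) :
    Filter.Tendsto (fun K : ℕ × ℕ => ∫⁻ x in {x | height F x ≤ 0},
      ‖iteratedFDeriv ℝ i (dyadicMol ρ u K.1 - dyadicMol ρ u K.2) x‖ₑ) Filter.atTop (nhds 0) := by
  have hΩ := (isOpen_subgraph hF).measurableSet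
  induction i generalizing n N u with
  | zero =>
    have hui := hu.integrable hΩ
    have h1 := tendsto_lintegral_dyadicMol hρ hui
    have h2 : Filter.Tendsto (fun K : ℕ × ℕ => (∫⁻ x, ‖dyadicMol ρ u K.1 x - u x‖ₑ) +
        ∫⁻ x, ‖dyadicMol ρ u K.2 x - u x‖ₑ) Filter.atTop (nhds (0 + 0)) := by
      rw [← Filter.prod_atTop_atTop_eq]
      exact (h1.comp Filter.tendsto_fst).add (h1.comp Filter.tendsto_snd)
    rw [add_zero] at h2
    refine tendsto_of_tendsto_of_tendsto_of_le_of_le tendsto_const_nhds h2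
      (fun _ => zero_le) fun K => ?_
    refine (setLIntegral_le_lintegral _ _).trans ?_
    have hint : Integrable (dyadicMol ρ u K.1) := integrable_mol hρ hui (by positivity)
    rw [← lintegral_add_left' (f := fun x => ‖dyadicMol ρ u K.1 x - u x‖ₑ)
      (hint.1.sub hui.1).enorm]
    refine lintegral_mono fun x => ?_
    rw [← ofReal_norm, norm_iteratedFDeriv_zero, ofReal_norm]
    have e : (dyadicMol ρ u K.1 - dyadicMol ρ u K.2) x =
        (dyadicMol ρ u K.1 x - u x) - (dyadicMol ρ u K.2 x - u x) := by
      simp only [Pi.sub_apply]; ring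
    rw [e]
    exact enorm_sub_le
  | succ i ih =>
    obtain ⟨n, rfl⟩ : ∃ n', n = n' + 1 := ⟨n - 1, by omega⟩
    have hui := hu.integrable hΩ
    choose g hg hgF using fun c : Fin (m + 1) => hu.exists_deriv hΩ
      (v := EuclideanSpace.single c 1) (norm_single_one c).le
    have h1 := tendsto_finsetSum Finset.univ fun (c : Fin (m + 1)) _ =>
      ih (hgF c) (show i ≤ n by omega)
    rw [Finset.sum_const_zero] at h1
    refine tendsto_of_tendsto_of_tendsto_of_le_of_le tendsto_const_nhds h1
      (fun _ => zero_le) fun K => ?_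
    have hs := fun k => contDiff_dyadicMol hρ hui k
    have hsg := fun c k => contDiff_dyadicMol hρ ((hgF c).integrable hΩ) k
    dsimp only
    rw [← lintegral_finsetSum _ fun c _ => measurable_iteratedFDeriv_enorm
      (f := dyadicMol ρ (g c) K.1 - dyadicMol ρ (g c) K.2) ((hsg c _).sub (hsg c _)) i]
    refine setLIntegral_mono' (measurableSet_le (measurable_height hF) measurable_const)
      fun x hx => ?_
    refine (enorm_iteratedFDeriv_succ_le (f := dyadicMol ρ u K.1 - dyadicMol ρ u K.2)
      ((hs _).sub (hs _)) i x).trans (Finset.sum_le_sum fun c _ => ?_)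
    have hev : ∀ k : ℤ, partialD c (dyadicMol ρ u k) =ᶠ[nhds x] dyadicMol ρ (g c) k := fun k =>
      eventually_partialD_mol hρ hF hui (hg c) (by positivity)
        (lt_of_le_of_lt hx (by positivity))
    rw [partialD_sub (hs _) (hs _), (((hev _).sub (hev _)).iteratedFDeriv ℝ i).eq_of_nhds]

/-- The points just below the graph. -/
def strip (F : EuclideanSpace ℝ (Fin m) → ℝ) (h : ℝ) : Set (E m) :=
  {y | height F y < 0 ∧ -h ≤ height F y}

/-- The strips decrease to the empty set, and `N` has finite integral. -/
theorem tendsto_lintegral_strip (hF : LipschitzWith M F) {N : E m → ℝ≥0∞}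
    (hfin : ∫⁻ x, N x ≠ ∞) {h : ℕ → ℝ} (hanti : Antitone h)
    (hlim : Filter.Tendsto h Filter.atTop (nhds 0)) :
    Filter.Tendsto (fun K => ∫⁻ x in strip F (h K), N x) Filter.atTop (nhds 0) := by
  have hm := measurable_height hF
  have hsm : ∀ K, MeasurableSet (strip F (h K)) := fun K =>
    (measurableSet_lt hm measurable_const).inter (measurableSet_le measurable_const hm)
  have h1 := tendsto_measure_iInter_atTop (μ := volume.withDensity N)
    (s := fun K => strip F (h K)) (fun K => (hsm K).nullMeasurableSet)
    (fun a b hab x hx => ⟨hx.1, by linarith [hx.2, hanti hab]⟩)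
    ⟨0, by
      rw [withDensity_apply _ (hsm 0)]
      exact ((setLIntegral_le_lintegral _ _).trans_lt (lt_top_iff_ne_top.2 hfin)).ne⟩
  have h2 : ⋂ K, strip F (h K) = ∅ := by
    rw [eq_empty_iff_forall_notMem]
    intro x hx
    have hx1 : height F x < 0 := (mem_iInter.1 hx 0).1
    obtain ⟨K, hK⟩ := (hlim.eventually_lt_const (u := -height F x) (by linarith)).exists
    have := (mem_iInter.1 hx K).2
    linarith
  rw [h2, measure_empty] at h1
  refine h1.congr fun K => ?_
  rw [Function.comp_apply, withDensity_apply _ (hsm K)]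

/-- Three regions are distinguished. Up to the graph both functions are mollifications. Far enough
above it they coincide. In the thin zone between, each is bounded by the integral of the majorant
over a strip just below the graph, and that integral tends to zero. -/
theorem tendsto_lintegral_approxExt_sub (hρ : IsConeKernel M l ρ) (hF : LipschitzWith M F)
    (hψ : IsLayerPartition F C ψ) {n i : ℕ} {N : ℕ → E m → ℝ≥0∞} {u : E m → ℝ}
    (hu : FiniteBound (subgraph F) n N u) (hi : i ≤ n) (hil : i ≤ l) :
    Filter.Tendsto (fun K : ℕ × ℕ => ∫⁻ x,
      ‖iteratedFDeriv ℝ i (approxExt ρ u ψ K.1 - approxExt ρ u ψ K.2) x‖ₑ)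
      Filter.atTop (nhds 0) := by
  have hΩ := (isOpen_subgraph hF).measurableSet
  have hui := hu.integrable hΩ
  have hm := measurable_height hF
  obtain ⟨c, hc⟩ := setLIntegral_approxExt_le hρ C hil le_rfl
  -- In the thin zone the scales are at most `2 · 2^{-K}`; by `le_height_sub_of_mem_bigConeBox` they
  -- reach depth at most `35 (M + 1)` times that.
  set h : ℕ → ℝ := fun K => 35 * ((M : ℝ) + 1) * (2 * 2 ^ (-(K : ℤ))) with hh
  have hz := tendsto_nhds_of_tendsto_nhdsWithin tendsto_two_zpow_neg
  have hhl : Filter.Tendsto h Filter.atTop (nhds 0) := by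
    have := (hz.const_mul 2).const_mul (35 * ((M : ℝ) + 1))
    simpa only [mul_zero] using this
  have hha : Antitone h := by
    intro a b hab
    have h0 : (0 : ℝ) ≤ M := M.2
    simp only [hh]
    gcongr
    · norm_num
  have hstrip := tendsto_lintegral_strip hF (hu.finite i hi) hha hhl
  have hs := fun K => contDiff_approxExt hρ hF hψ hui K
  have hlow := tendsto_lintegral_dyadicMol_sub hρ hF hu hi
  have hup : Filter.Tendsto (fun K : ℕ × ℕ =>
      (c : ℝ≥0∞) * (∫⁻ x in strip F (h (min K.1 K.2)), N i x) +
      (c : ℝ≥0∞) * (∫⁻ x in strip F (h (min K.1 K.2)), N i x)) Filter.atTop (nhds 0) := by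
    have h1 : Filter.Tendsto (fun K : ℕ × ℕ => min K.1 K.2) Filter.atTop Filter.atTop := by
      refine Filter.tendsto_atTop.2 fun b => ?_
      filter_upwards [Filter.eventually_ge_atTop (b, b)] with K hK
      exact le_min hK.1 hK.2
    have h2 := ENNReal.Tendsto.const_mul (hstrip.comp h1) (a := (c : ℝ≥0∞))
      (Or.inr ENNReal.coe_ne_top)
    have h3 := h2.add h2
    simp only [mul_zero, add_zero] at h3
    exact h3
  have hsum := hlow.add hup
  rw [add_zero] at hsum
  refine tendsto_of_tendsto_of_tendsto_of_le_of_le tendsto_const_nhds hsum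
    (fun _ => zero_le) fun K => ?_
  have hlm : MeasurableSet {x : E m | height F x ≤ 0} := measurableSet_le hm measurable_const
  dsimp only
  rw [← lintegral_add_compl _ hlm]
  set K₀ := min K.1 K.2 with hK₀
  have hpow : (2 : ℝ) ^ (-(K₀ : ℤ) + 1) = 2 * 2 ^ (-(K₀ : ℤ)) := by
    rw [zpow_add_one₀ two_ne_zero]; ring
  set S : Set (E m) := {x | 0 < height F x ∧ height F x ≤ 2 ^ (-(K₀ : ℤ) + 1)} with hS
  have hSm : MeasurableSet S :=
    (measurableSet_lt measurable_const hm).inter (measurableSet_le hm measurable_const)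
  have hpart : ∀ K' : ℕ, K₀ ≤ K' → ∫⁻ x in S, ‖iteratedFDeriv ℝ i (approxExt ρ u ψ K') x‖ₑ ≤
      c * ∫⁻ x in strip F (h K₀), N i x := by
    intro K' hK'
    have := hc F hF ψ hψ n N u hu hi K' S hSm (∫⁻ x in strip F (h K₀), N i x) fun q hq =>
      ⟨strip F (h K₀), (measurableSet_lt hm measurable_const).inter
        (measurableSet_le measurable_const hm), fun k hk x hx => ?_, by simp⟩
    · simpa using this
    · have hτ : (0 : ℝ) < 2 ^ (-k) := by positivity
      have h0 : (0 : ℝ) ≤ M := M.2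
      have h1 := height_sub_le_of_mem_bigConeBox hF hτ.le hx.2.1 hq
      have h2 := le_height_sub_of_mem_bigConeBox hF (x := x) hτ.le hq
      have hkK : (2 : ℝ) ^ (-k) ≤ 2 ^ (-(K₀ : ℤ) + 1) := by
        refine zpow_le_zpow_right₀ one_le_two ?_
        rcases hk.lt_or_eq with hlt | heq
        · have := two_zpow_lt.1 ((hx.2.2 hlt).trans_le hx.1.2)
          omega
        · omega
      refine ⟨lt_of_le_of_lt h1 (neg_lt_zero.2 (by positivity)), ?_⟩
      have h3 : 35 * ((M : ℝ) + 1) * 2 ^ (-k) ≤ 35 * ((M : ℝ) + 1) * 2 ^ (-(K₀ : ℤ) + 1) := by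
        gcongr
      rw [hpow] at h3
      have h4 := hx.1.1
      simp only [hh]
      linarith
  have hile : ((i : ℕ∞) : WithTop ℕ∞) ≤ ((⊤ : ℕ∞) : WithTop ℕ∞) := by exact_mod_cast le_top
  refine add_le_add ?_ ?_
  · refine le_of_eq (setLIntegral_congr_fun hlm fun x hx => ?_)
    have hx' : ∀ k : ℤ, approxExt ρ u ψ k =ᶠ[nhds x] dyadicMol ρ u k := fun k =>
      approxExt_eventuallyEq_mol hF hψ u k (lt_of_le_of_lt hx (by positivity))
    rw [(((hx' _).sub (hx' _)).iteratedFDeriv ℝ i).eq_of_nhds]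
  · calc ∫⁻ x in {x | height F x ≤ 0}ᶜ,
        ‖iteratedFDeriv ℝ i (approxExt ρ u ψ K.1 - approxExt ρ u ψ K.2) x‖ₑ
        ≤ ∫⁻ x in S, (‖iteratedFDeriv ℝ i (approxExt ρ u ψ K.1) x‖ₑ +
            ‖iteratedFDeriv ℝ i (approxExt ρ u ψ K.2) x‖ₑ) := by
          rw [← lintegral_indicator hlm.compl, ← lintegral_indicator hSm]
          refine lintegral_mono fun x => ?_
          by_cases hx : x ∈ {x : E m | height F x ≤ 0}ᶜ
          · rw [indicator_of_mem hx]
            have hx0 : 0 < height F x := not_le.1 hx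
            by_cases hxS : x ∈ S
            · rw [indicator_of_mem hxS, iteratedFDeriv_sub_apply
                ((hs _).of_le hile).contDiffAt ((hs _).of_le hile).contDiffAt]
              exact enorm_sub_le
            · obtain ⟨k₀, hk₀⟩ := exists_mem_layer hx0
              -- Above the thin zone the layer index satisfies `k₀ + 2 ≤ K₀`, so no index that
              -- matters near `x` is affected by either truncation.
              have h1 : (2 : ℝ) ^ (-(K₀ : ℤ) + 1) < height F x := by
                by_contra hle
                exact hxS ⟨hx0, not_lt.1 hle⟩
              have h2 := two_zpow_lt.1 (h1.trans_le hk₀.2)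
              have h3 := approxExt_eventuallyEq_approxExt (ρ := ρ) hF hψ u hk₀
                (K := K.1) (K' := K.2) (by omega) (by omega)
              have h4 : approxExt ρ u ψ K.1 - approxExt ρ u ψ K.2 =ᶠ[nhds x] fun _ => 0 := by
                filter_upwards [h3] with y hy
                rw [Pi.sub_apply, hy, sub_self]
              rw [(h4.iteratedFDeriv ℝ i).eq_of_nhds]
              simp
          · rw [indicator_of_notMem hx]; exact zero_le
      _ ≤ _ := by
          rw [lintegral_add_left (measurable_iteratedFDeriv_enorm (hs _) i)]
          exact add_le_add (hpart _ (min_le_left _ _)) (hpart _ (min_le_right _ _))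

/-- The approximations converge in `L¹` to the extension from the subgraph. -/
theorem tendsto_lintegral_approxExt (hρ : IsConeKernel M l ρ) (hF : LipschitzWith M F)
    (hψ : IsLayerPartition F C ψ) {n : ℕ} {N : ℕ → E m → ℝ≥0∞} {u : E m → ℝ}
    (hu : FiniteBound (subgraph F) n N u) {A : ℝ} {ω : E m → ℝ}
    (hω : ∀ (u : E m → ℝ) (k : ℤ), mollified A ω u k = mol ((2 : ℝ) ^ (-k)) ρ u) :
    Filter.Tendsto (fun K : ℕ => ∫⁻ x, ‖approxExt ρ u ψ K x - subgraphExt A ω F ψ u x‖ₑ)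
      Filter.atTop (nhds 0) := by
  have hΩ := (isOpen_subgraph hF).measurableSet
  have hui := hu.integrable hΩ
  have hm := measurable_height hF
  have hs := fun K => contDiff_approxExt hρ hF hψ hui K
  have hC := tendsto_lintegral_approxExt_sub hρ hF hψ hu (i := 0) (Nat.zero_le _) (Nat.zero_le _)
  have hL := tendsto_lintegral_dyadicMol hρ hui
  have habm : MeasurableSet {x : E m | 0 < height F x} := measurableSet_lt measurable_const hm
  have hup : Filter.Tendsto (fun K : ℕ => ∫⁻ x in {x | 0 < height F x},
      ‖approxExt ρ u ψ K x - subgraphExt A ω F ψ u x‖ₑ) Filter.atTop (nhds 0) := by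
    rw [ENNReal.tendsto_nhds_zero] at hC ⊢
    intro ε hε
    obtain ⟨⟨a, b⟩, hab⟩ := Filter.eventually_atTop.1 (hC ε hε)
    filter_upwards [Filter.eventually_ge_atTop a] with K hK
    -- At a fixed point above the graph the truncated extensions are eventually equal to the true
    -- one, so the Cauchy property and Fatou give the convergence.
    have hlim : ∀ x ∈ {x : E m | 0 < height F x},
        ‖approxExt ρ u ψ K x - subgraphExt A ω F ψ u x‖ₑ = Filter.liminf (fun K' : ℕ =>
          ‖iteratedFDeriv ℝ 0 (approxExt ρ u ψ K - approxExt ρ u ψ K') x‖ₑ) Filter.atTop := by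
      intro x hx
      obtain ⟨k₀, hk₀⟩ := exists_mem_layer hx
      symm
      refine Filter.Tendsto.liminf_eq (tendsto_const_nhds.congr' ?_)
      filter_upwards [Filter.eventually_ge_atTop (k₀ + 2).toNat] with K' hK'
      rw [← ofReal_norm (iteratedFDeriv ℝ 0 _ x), norm_iteratedFDeriv_zero, ofReal_norm,
        Pi.sub_apply, approxExt_eq_tsum hF hψ u hk₀ (K := K') (by omega)]
      have hx' : x ∉ subgraph F := by
        rw [mem_subgraph_iff]
        exact not_lt.2 (le_of_lt hx)
      rw [subgraphExt, if_neg hx']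
      simp only [hω]
      rfl
    rw [setLIntegral_congr_fun habm hlim]
    refine (setLIntegral_le_lintegral _ _).trans ?_
    refine (lintegral_liminf_le fun K' => measurable_iteratedFDeriv_enorm
      ((hs _).sub (hs _)) 0).trans ?_
    refine Filter.liminf_le_of_frequently_le' ?_
    refine Filter.Eventually.frequently ?_
    filter_upwards [Filter.eventually_ge_atTop b] with K' hK'
    exact hab (K, K') ⟨hK, hK'⟩
  have hsum := hL.add hup
  rw [add_zero] at hsum
  refine tendsto_of_tendsto_of_tendsto_of_le_of_le tendsto_const_nhds hsum
    (fun _ => zero_le) fun K => ?_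
  dsimp only
  have hcov : (univ : Set (E m)) ⊆ ({x | height F x < 0} ∪ {x | height F x = 0}) ∪
      {x | 0 < height F x} := by
    intro x _
    rcases lt_trichotomy (height F x) 0 with h | h | h
    · exact Or.inl (Or.inl h)
    · exact Or.inl (Or.inr h)
    · exact Or.inr h
  rw [← setLIntegral_univ]
  refine (lintegral_mono_set hcov).trans ((lintegral_union_le _ _ _).trans
    (add_le_add ?_ le_rfl))
  refine (lintegral_union_le _ _ _).trans ?_
  rw [setLIntegral_measure_zero _ _ (volume_graph hF), add_zero]
  refine le_trans (le_of_eq ?_) (setLIntegral_le_lintegral {x | height F x < 0} _)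
  refine setLIntegral_congr_fun (measurableSet_lt hm measurable_const) fun x hx => ?_
  have hx' : x ∈ subgraph F := mem_subgraph_iff.2 hx
  rw [(approxExt_eventuallyEq_mol hF hψ u K (lt_trans hx (by positivity))).eq_of_nhds,
    subgraphExt, if_pos hx']

end BurenkovMorrey

end

noncomputable section

namespace BurenkovMorrey

/-! ### Limits of smooth functions -/

variable {m : ℕ}

/-- A sequence that is Cauchy in the mean converges in the mean, and almost everywhere along a
subsequence. -/
theorem exists_tendsto_lintegral {f : ℕ → E m → ℝ} (hf : ∀ n, Integrable (f n))
    (hc : Filter.Tendsto (fun K : ℕ × ℕ => ∫⁻ x, ‖f K.1 x - f K.2 x‖ₑ) Filter.atTop (nhds 0)) :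
    ∃ g, Integrable g ∧
      Filter.Tendsto (fun n => ∫⁻ x, ‖f n x - g x‖ₑ) Filter.atTop (nhds 0) := by
  have hf' : ∀ n, MemLp (f n) 1 volume := fun n => memLp_one_iff_integrable.2 (hf n)
  have he : ∀ a b, edist ((hf' a).toLp (f a)) ((hf' b).toLp (f b)) = ∫⁻ x, ‖f a x - f b x‖ₑ := by
    intro a b
    rw [Lp.edist_toLp_toLp, eLpNorm_one_eq_lintegral_enorm]
    rfl
  have hC : CauchySeq fun n => (hf' n).toLp (f n) := by
    rw [EMetric.cauchySeq_iff]
    intro ε hε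
    obtain ⟨⟨a, b⟩, hab⟩ := Filter.eventually_atTop.1 (hc.eventually_lt_const hε)
    refine ⟨max a b, fun j hj k hk => ?_⟩
    rw [he]
    exact hab (j, k) ⟨(le_max_left _ _).trans hj, (le_max_right _ _).trans hk⟩
  obtain ⟨G, hG⟩ := cauchySeq_tendsto_of_complete hC
  refine ⟨G, memLp_one_iff_integrable.1 (Lp.memLp G), ?_⟩
  rw [tendsto_iff_edist_tendsto_0] at hG
  refine hG.congr fun n => ?_
  conv_lhs => rw [← Lp.toLp_coeFn G (Lp.memLp G)]
  rw [Lp.edist_toLp_toLp, eLpNorm_one_eq_lintegral_enorm]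
  rfl

theorem exists_subseq_tendsto_ae {f : ℕ → E m → ℝ} {g : E m → ℝ}
    (hf : ∀ n, AEStronglyMeasurable (f n) volume) (hg : AEStronglyMeasurable g volume)
    (h : Filter.Tendsto (fun n => ∫⁻ x, ‖f n x - g x‖ₑ) Filter.atTop (nhds 0)) :
    ∃ ns : ℕ → ℕ, StrictMono ns ∧
      ∀ᵐ x, Filter.Tendsto (fun i => f (ns i) x) Filter.atTop (nhds (g x)) := by
  refine (tendstoInMeasure_of_tendsto_eLpNorm one_ne_zero hf hg ?_).exists_seq_tendsto_ae
  refine h.congr fun n => ?_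
  rw [eLpNorm_one_eq_lintegral_enorm]
  rfl

/-- Convergence in the mean gives a subsequence converging almost everywhere, and Fatou applies to
the `p`-th powers. Thus `L¹` convergence is enough to keep `L^p` bounds. -/
theorem setLIntegral_rpow_le_of_tendsto {f : ℕ → E m → ℝ} {g : E m → ℝ}
    (hf : ∀ n, AEStronglyMeasurable (f n) volume) (hg : AEStronglyMeasurable g volume)
    (h : Filter.Tendsto (fun n => ∫⁻ x, ‖f n x - g x‖ₑ) Filter.atTop (nhds 0)) {p : ℝ}
    {T : Set (E m)} {B : ℝ≥0∞} (hB : ∀ n, ∫⁻ x in T, ‖f n x‖ₑ ^ p ≤ B) :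
    ∫⁻ x in T, ‖g x‖ₑ ^ p ≤ B := by
  obtain ⟨ns, -, hns⟩ := exists_subseq_tendsto_ae hf hg h
  calc ∫⁻ x in T, ‖g x‖ₑ ^ p
      = ∫⁻ x in T, Filter.liminf (fun i => ‖f (ns i) x‖ₑ ^ p) Filter.atTop := by
        refine lintegral_congr_ae ?_
        filter_upwards [ae_restrict_of_ae hns] with x hx
        exact (((ENNReal.continuous_rpow_const (y := p)).tendsto _).comp
          (hx.enorm)).liminf_eq.symm
    _ ≤ Filter.liminf (fun i => ∫⁻ x in T, ‖f (ns i) x‖ₑ ^ p) Filter.atTop :=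
        lintegral_liminf_le' fun i => ((hf (ns i)).restrict.enorm.pow_const p)
    _ ≤ B := Filter.liminf_le_of_frequently_le'
        (Filter.Frequently.of_forall fun i => hB _)

theorem integral_mul_classicalD {f η : E m → ℝ} (hf : ContDiff ℝ (⊤ : ℕ∞) f)
    (hη : IsTest univ η) (α : MultiIndex m) :
    ∫ x, f x * classicalD α η x = (-1 : ℝ) ^ α.order * ∫ x, classicalD α f x * η x := by
  induction α using multiIndex_induction generalizing f with
  | h0 => simp [classicalD_zero, order_zero]
  | hs α i ih =>
    have hfi := contDiff_partialD hf i
    rw [classicalD_add_single hη.smooth, classicalD_add_single' hf, order_add_single, pow_succ,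
      mul_assoc, neg_one_mul, mul_neg, ← ih hfi]
    have hg := hη.classicalD α
    have hint : ∀ {u : E m → ℝ} {v : E m → ℝ}, Continuous u → IsTest univ v →
        Integrable fun x => u x * v x := fun hu hv =>
      hv.integrable_mul (hu.locallyIntegrable.locallyIntegrableOn _)
    exact integral_mul_fderiv_eq_neg_fderiv_mul_of_integrable
      (hint hfi.continuous hg) (hint hf.continuous (hg.fderiv _)) (hint hf.continuous hg)
      (fun x _ => hf.differentiable (by simp) x)
      (fun x _ => hg.smooth.differentiable (by simp) x)

theorem tendsto_integral_mul_of_tendsto {f : ℕ → E m → ℝ} {g η : E m → ℝ}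
    (hf : ∀ n, Integrable (f n)) (hg : Integrable g) (hη : IsTest univ η)
    (h : Filter.Tendsto (fun n => ∫⁻ x, ‖f n x - g x‖ₑ) Filter.atTop (nhds 0)) :
    Filter.Tendsto (fun n => ∫ x, f n x * η x) Filter.atTop (nhds (∫ x, g x * η x)) := by
  have hloc : ∀ {u : E m → ℝ}, Integrable u → Integrable fun x => u x * η x := fun hu =>
    hη.integrable_mul (hu.locallyIntegrable.locallyIntegrableOn _)
  obtain ⟨c, hc⟩ := hη.smooth.continuous.bounded_above_of_compact_support hη.compact
  refine tendsto_integral_of_L1 _ (hloc hg).1 (Filter.Eventually.of_forall fun n => hloc (hf n)) ?_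
  have h2 := ENNReal.Tendsto.const_mul h (a := ENNReal.ofReal c) (Or.inr ENNReal.ofReal_ne_top)
  rw [mul_zero] at h2
  refine tendsto_of_tendsto_of_tendsto_of_le_of_le tendsto_const_nhds h2 (fun _ => zero_le)
    fun n => ?_
  dsimp only
  rw [← lintegral_const_mul' _ _ ENNReal.ofReal_ne_top]
  refine lintegral_mono fun x => ?_
  rw [← sub_mul, enorm_mul, mul_comm]
  refine mul_le_mul' ?_ le_rfl
  rw [← ofReal_norm]
  exact ENNReal.ofReal_le_ofReal (hc x)

/-- Smooth functions with compact support whose derivatives are Cauchy in the mean have a limit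
with weak derivatives, for which integral bounds persist. -/
theorem exists_hasWeakDeriv_of_tendsto {W : ℕ → E m → ℝ} {w : E m → ℝ}
    (hW : ∀ K, IsTest univ (W K)) (hwm : AEStronglyMeasurable w volume)
    (hw : Filter.Tendsto (fun K => ∫⁻ x, ‖W K x - w x‖ₑ) Filter.atTop (nhds 0))
    (α : MultiIndex m)
    (hc : Filter.Tendsto (fun K : ℕ × ℕ =>
      ∫⁻ x, ‖iteratedFDeriv ℝ α.order (W K.1 - W K.2) x‖ₑ) Filter.atTop (nhds 0)) :
    ∃ h, HasWeakDeriv univ α w h ∧ ∀ (p : ℝ) (T : Set (E m)) (B : ℝ≥0∞), 0 ≤ p →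
      (∀ K, ∫⁻ x in T, ‖iteratedFDeriv ℝ α.order (W K) x‖ₑ ^ p ≤ B) →
      ∫⁻ x in T, ‖h x‖ₑ ^ p ≤ B := by
  have hWi : ∀ {v : E m → ℝ}, IsTest univ v → Integrable v := fun hv =>
    hv.smooth.continuous.integrable_of_hasCompactSupport hv.compact
  have hbd : ∀ {v : E m → ℝ}, ContDiff ℝ (⊤ : ℕ∞) v → ∀ x,
      ‖classicalD α v x‖ₑ ≤ ‖iteratedFDeriv ℝ α.order v x‖ₑ := by
    intro v hv x
    rw [← ofReal_norm, ← ofReal_norm]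
    exact ENNReal.ofReal_le_ofReal (abs_classicalD_le hv α x)
  have hD := fun K => (hW K).classicalD α
  obtain ⟨h, hhi, hh⟩ := exists_tendsto_lintegral (f := fun K => classicalD α (W K))
    (fun K => hWi (hD K)) (by
      refine tendsto_of_tendsto_of_tendsto_of_le_of_le tendsto_const_nhds hc (fun _ => zero_le)
        fun K => lintegral_mono fun x => ?_
      have := hbd ((hW K.1).smooth.sub (hW K.2).smooth) x
      rwa [← Pi.sub_def, classicalD_sub (hW K.1).smooth (hW K.2).smooth] at this)
  -- A single `W K` at finite `L¹` distance from `w` already makes `w` integrable.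
  have hwi : Integrable w := by
    obtain ⟨K, hK⟩ := (hw.eventually_lt_const zero_lt_one).exists
    have h1 : Integrable (W K - w) := ⟨(hWi (hW K)).1.sub hwm, hK.trans ENNReal.one_lt_top⟩
    have := (hWi (hW K)).sub h1
    rwa [sub_sub_cancel] at this
  refine ⟨h, ⟨hwi.locallyIntegrable.locallyIntegrableOn _,
    hhi.locallyIntegrable.locallyIntegrableOn _, fun η h1 h2 h3 => ?_⟩, fun p T B hp hB => ?_⟩
  · have hη : IsTest univ η := ⟨h1, h2, h3⟩
    rw [setIntegral_univ, setIntegral_univ]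
    have t1 := tendsto_integral_mul_of_tendsto (fun K => hWi (hW K)) hwi (hη.classicalD α) hw
    have t2 := (tendsto_integral_mul_of_tendsto (fun K => hWi (hD K)) hhi hη hh).const_mul
      ((-1 : ℝ) ^ α.order)
    refine tendsto_nhds_unique t1 (t2.congr fun K => ?_)
    exact (integral_mul_classicalD (hW K).smooth hη α).symm
  · refine setLIntegral_rpow_le_of_tendsto (fun K => (hWi (hD K)).1) hhi.1 hh fun K => ?_
    exact (lintegral_mono fun x => ENNReal.rpow_le_rpow (hbd (hW K).smooth x) hp).trans (hB K)

variable {M : ℝ≥0} {F : EuclideanSpace ℝ (Fin m) → ℝ} {C : MultiIndex m → ℝ}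
  {ψ : ℤ → E m → ℝ} {l : ℕ} {ρ : E m → ℝ}

/-- Above the graph the extension is a pointwise limit of smooth functions, below it is `u`, and the
graph is null. -/
theorem aestronglyMeasurable_subgraphExt (hρ : IsConeKernel M l ρ) (hF : LipschitzWith M F)
    (hψ : IsLayerPartition F C ψ) {u : E m → ℝ} (hu : Integrable u) {A : ℝ} {ω : E m → ℝ}
    (hω : ∀ (u : E m → ℝ) (k : ℤ), mollified A ω u k = mol ((2 : ℝ) ^ (-k)) ρ u) :
    AEStronglyMeasurable (subgraphExt A ω F ψ u) volume := by
  have hΩ := (isOpen_subgraph hF).measurableSet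
  have hm := measurable_height hF
  have habm : MeasurableSet {x : E m | 0 < height F x} := measurableSet_lt measurable_const hm
  have h1 : AEStronglyMeasurable (subgraphExt A ω F ψ u) (volume.restrict (subgraph F)) :=
    hu.1.restrict.congr (by
      filter_upwards [ae_restrict_mem hΩ] with x hx
      rw [subgraphExt, if_pos hx])
  have h2 : AEStronglyMeasurable (subgraphExt A ω F ψ u)
      (volume.restrict {x | 0 < height F x}) := by
    refine aestronglyMeasurable_of_tendsto_ae Filter.atTop
      (f := fun K : ℕ => approxExt ρ u ψ K)
      (fun K => (contDiff_approxExt hρ hF hψ hu K).continuous.aestronglyMeasurable) ?_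
    filter_upwards [ae_restrict_mem habm] with x hx
    obtain ⟨k₀, hk₀⟩ := exists_mem_layer hx
    refine tendsto_const_nhds.congr' ?_
    filter_upwards [Filter.eventually_ge_atTop (k₀ + 2).toNat] with K hK
    have hx' : x ∉ subgraph F := by
      rw [mem_subgraph_iff]
      exact not_lt.2 (le_of_lt hx)
    rw [approxExt_eq_tsum hF hψ u hk₀ (K := K) (by omega), subgraphExt, if_neg hx']
    simp only [hω]
    rfl
  have h3 := (aestronglyMeasurable_union_iff (s := subgraph F)
    (t := {x | 0 < height F x})).2 ⟨h1, h2⟩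
  have h4 : (subgraph F ∪ {x | 0 < height F x} : Set (E m)) =ᵐ[volume] univ := by
    rw [ae_eq_univ]
    refine measure_mono_null (fun x hx => ?_) (volume_graph hF)
    simp only [mem_compl_iff, mem_union, mem_subgraph_iff, mem_ofPred_eq, not_or, not_lt] at hx
    exact le_antisymm hx.2 hx.1
  rwa [Measure.restrict_congr_set h4, Measure.restrict_univ] at h3

end BurenkovMorrey

end

noncomputable section

namespace BurenkovMorrey

/-! ### The local extensions -/

variable {m : ℕ} {𝒜 : Atlas m} {M : ℝ≥0} {l : ℕ} {C : MultiIndex m → ℝ} {P : ℝ} {Ω : Set (E m)}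

theorem isOpen_box (a b : Fin (m + 1) → ℝ) : IsOpen (box a b : Set (E m)) := by
  have : (box a b : Set (E m)) = ⋂ i, ({x : E m | a i < x i} ∩ {x | x i < b i}) := by
    ext x; simp [box]
  rw [this]
  refine isOpen_iInter_of_finite fun i => ?_
  have hc : Continuous fun x : E m => x i := by fun_prop
  exact (isOpen_lt continuous_const hc).inter (isOpen_lt hc continuous_const)

theorem convex_box (a b : Fin (m + 1) → ℝ) : Convex ℝ (box a b : Set (E m)) := by
  have : (box a b : Set (E m)) = ⋂ i, ({x : E m | a i < x i} ∩ {x | x i < b i}) := by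
    ext x; simp [box]
  rw [this]
  refine convex_iInter fun i => ?_
  have hl : IsLinearMap ℝ fun x : E m => x i := ⟨fun _ _ => rfl, fun _ _ => rfl⟩
  exact (convex_halfSpace_gt hl _).inter (convex_halfSpace_lt hl _)

/-! ### Topology of the cuboids. -/

namespace Atlas

theorem V_eq_preimage (j : 𝒜.Idx) : 𝒜.V j = 𝒜.lam j ⁻¹' box (𝒜.a j) (𝒜.b j) := by
  rw [← 𝒜.image_eq, preimage_image_eq _ (𝒜.lam j).injective]

theorem isOpen_V (j : 𝒜.Idx) : IsOpen (𝒜.V j) := by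
  rw [V_eq_preimage]
  exact (isOpen_box _ _).preimage (𝒜.lam j).continuous

theorem isPreconnected_V (j : 𝒜.Idx) : IsPreconnected (𝒜.V j) := by
  have h1 := (convex_box (𝒜.a j) (𝒜.b j)).isPreconnected.image (𝒜.lam j).symm
    (𝒜.lam j).symm.continuous.continuousOn
  rwa [← 𝒜.image_eq, ← image_comp, (𝒜.lam j).symm_comp_self, image_id] at h1

theorem isBounded_box (a b : Fin (m + 1) → ℝ) : Bornology.IsBounded (box a b : Set (E m)) := by
  have h : Bornology.IsBounded (univ.pi fun i => Icc (a i) (b i)) :=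
    (isCompact_univ_pi fun i => isCompact_Icc).isBounded
  have h2 := (EuclideanSpace.equiv (Fin (m + 1)) ℝ).symm.lipschitz.isBounded_image h
  refine h2.subset fun x hx => ⟨fun i => x i, fun i _ => ⟨(hx i).1.le, (hx i).2.le⟩, ?_⟩
  ext i; rfl

theorem isBounded_V (j : 𝒜.Idx) : Bornology.IsBounded (𝒜.V j) := by
  have h1 := (𝒜.lam j).symm.isometry.lipschitz.isBounded_image (isBounded_box (𝒜.a j) (𝒜.b j))
  rwa [← 𝒜.image_eq, ← image_comp, (𝒜.lam j).symm_comp_self, image_id] at h1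

end Atlas

/-- A cuboid is connected and meets `Ω`. If it avoids the boundary it is covered by the disjoint
open sets `Ω` and the exterior of `Ω`, hence lies in `Ω`. -/
theorem subset_of_not_meets (hΩ : IsLipschitzClass 𝒜 M Ω) {j : 𝒜.Idx}
    (h : ¬ (𝒜.V j ∩ frontier Ω).Nonempty) : 𝒜.V j ⊆ Ω := by
  by_contra hs
  obtain ⟨x, hx, hx'⟩ := not_subset.1 hs
  obtain ⟨y, hy, hy'⟩ := hΩ.meets j
  have hcov : 𝒜.V j ⊆ Ω ∪ (closure Ω)ᶜ := by
    intro z hz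
    by_contra hz'
    simp only [mem_union, mem_compl_iff, not_or, not_not] at hz'
    exact h ⟨z, hz, hΩ.isOpen.frontier_eq ▸ ⟨hz'.2, hz'.1⟩⟩
  obtain ⟨z, -, hz, hz'⟩ := Atlas.isPreconnected_V j Ω (closure Ω)ᶜ hΩ.isOpen
    isClosed_closure.isOpen_compl hcov ⟨y, hy'.1, hy⟩ ⟨x, hx, (hcov hx).resolve_left hx'⟩
  exact hz' (subset_closure hz)

/-! ### Sums of derivatives and their integrals. -/

/-- The sum of the absolute values of the derivatives of order at most `j`. -/
def lowerSum (F : MultiIndex m → E m → ℝ) (j : ℕ) (x : E m) : ℝ≥0∞ :=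
  ∑ β ∈ multiIndexLE m j, ‖F β x‖ₑ

/-- The sum of the integrals of the `p`-th powers of the derivatives of order at most `j`. -/
def energy (F : MultiIndex m → E m → ℝ) (p : ℝ) (j : ℕ) (S : Set (E m)) : ℝ≥0∞ :=
  ∑ β ∈ multiIndexLE m j, ∫⁻ x in S, ‖F β x‖ₑ ^ p

theorem multiIndexLE_subset {i j : ℕ} (h : i ≤ j) : multiIndexLE m i ⊆ multiIndexLE m j :=
  fun β hβ => (mem_multiIndexLE β).2 (((mem_multiIndexLE β).1 hβ).trans h)

theorem energy_mono (F : MultiIndex m → E m → ℝ) (p : ℝ) {i j : ℕ} (h : i ≤ j) {S T : Set (E m)}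
    (hST : S ⊆ T) : energy F p i S ≤ energy F p j T :=
  (Finset.sum_le_sum fun _ _ => lintegral_mono_set hST).trans
    (Finset.sum_le_sum_of_subset (multiIndexLE_subset h))

theorem sum_orderSum_le (F : MultiIndex m → E m → ℝ) (j : ℕ) (x : E m) :
    ∑ i ∈ Finset.range (j + 1), orderSum F i x ≤ lowerSum F j x := by
  have h : ∀ i ∈ Finset.range (j + 1), orderSum F i x =
      ∑ β ∈ (multiIndexLE m j).filter (fun β => β.order = i), ‖F β x‖ₑ := by
    intro i hi
    have hij : i ≤ j := Nat.lt_succ_iff.1 (Finset.mem_range.1 hi)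
    refine Finset.sum_congr ?_ fun _ _ => rfl
    ext β
    simp only [Finset.mem_filter, mem_multiIndexLE]
    omega
  rw [Finset.sum_congr rfl h]
  exact (Finset.sum_fiberwise_of_maps_to (g := fun β : MultiIndex m => β.order) (fun β hβ =>
    Finset.mem_range.2 (Nat.lt_succ_iff.2 ((mem_multiIndexLE β).1 hβ))) _).le

theorem measurable_lowerSum {F : MultiIndex m → E m → ℝ} (hF : ∀ β, Measurable (F β)) (j : ℕ) :
    Measurable (lowerSum F j) := by
  unfold lowerSum
  exact Finset.measurable_fun_sum _ fun β _ => (hF β).enorm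

theorem setLIntegral_lowerSum_rpow_le {F : MultiIndex m → E m → ℝ} (hF : ∀ β, Measurable (F β))
    {p : ℝ} (hp : 1 ≤ p) (j : ℕ) (S : Set (E m)) :
    ∫⁻ x in S, lowerSum F j x ^ p ≤
      ((multiIndexLE m j).card : ℝ≥0∞) ^ (p - 1) * energy F p j S := by
  rw [energy, ← lintegral_finsetSum _ fun β _ => (hF β).enorm.pow_const p,
    ← lintegral_const_mul _ (Finset.measurable_fun_sum _ fun β _ => (hF β).enorm.pow_const p)]
  exact lintegral_mono fun x => ENNReal.rpow_sum_le_const_mul_sum_rpow _ _ hp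

/-- Measurable representatives of the weak derivatives of a Sobolev function, with finite
integrals. -/
structure IsDerivFamily (l : ℕ) (p : ℝ) (Ω : Set (E m)) (f : E m → ℝ)
    (F : MultiIndex m → E m → ℝ) : Prop where
  meas : ∀ β, Measurable (F β)
  weak : ∀ β : MultiIndex m, β.order ≤ l → HasWeakDeriv Ω β f (F β)
  finite : ∀ β : MultiIndex m, β.order ≤ l → ∫⁻ x in Ω, ‖F β x‖ₑ ^ p ≠ ∞
  ae_eq : ∀ᵐ x, x ∈ Ω → f x = F 0 x

theorem IsDerivFamily.weakBound {p : ℝ} {f : E m → ℝ} {F : MultiIndex m → E m → ℝ}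
    (hF : IsDerivFamily l p Ω f F) (hΩ : IsOpen Ω) :
    WeakBound Ω l (fun j x => (m + 1 : ℝ≥0∞) ^ j * orderSum F j x) f := by
  have h := weakBound_of_hasWeakDeriv hF.weak l 0 (by rw [order_zero, zero_add])
  simp only [order_zero, zero_add] at h
  exact h.congr hΩ.measurableSet hF.ae_eq

/-- Restriction to `V`, transport by the chart and the product rule in one statement. The target
`Ω'` is left open: it is the whole space for a cuboid inside the domain and a subgraph for a cuboid
at the boundary. -/
theorem IsDerivFamily.weakBound_mul {p : ℝ} {f : E m → ℝ} {F : MultiIndex m → E m → ℝ}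
    (hF : IsDerivFamily l p Ω f F) (hΩ : IsOpen Ω) {V Ω' : Set (E m)} (hV : IsOpen V)
    (lam : E m ≃ᵢ E m) {χ : E m → ℝ} (hχ : ContDiff ℝ (⊤ : ℕ∞) χ) {Q : ℝ≥0}
    (hs : tsupport (fun y => χ (lam.symm y)) ∩ Ω' ⊆ lam '' (Ω ∩ V))
    (hQ : ∀ i ≤ l, ∀ x, ‖iteratedFDeriv ℝ i χ x‖ ≤ Q) :
    WeakBound Ω' l (fun j y => 2 ^ j * Q * (m + 1 : ℝ≥0∞) ^ j *
        (Ω ∩ V).indicator (lowerSum F j) (lam.symm y))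
      ((lam '' (Ω ∩ V)).indicator fun y => f (lam.symm y) * χ (lam.symm y)) := by
  have h1 := (((hF.weakBound hΩ).mono (inter_subset_left (t := V))
    (fun j => Filter.Eventually.of_forall fun x _ => le_rfl)).comp_isometry lam)
  have h2 := h1.indicator_mul
    (show IsOpen (lam '' (Ω ∩ V)) from lam.toHomeomorph.isOpenMap _ (hΩ.inter hV))
    (χ := fun y => χ (lam.symm y)) (hχ.comp (contDiff_isometryEquiv _)) hs (P := Q) (fun i hi x => by
      rw [norm_iteratedFDeriv_comp_isometryEquiv]; exact hQ i hi _)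
  refine h2.mono subset_rfl fun j => Filter.Eventually.of_forall fun y _ => ?_
  by_cases hy : lam.symm y ∈ Ω ∩ V
  · have hy' : y ∈ lam '' (Ω ∩ V) := ⟨_, hy, lam.apply_symm_apply y⟩
    rw [indicator_of_mem hy', indicator_of_mem hy, mul_assoc (2 ^ j * (Q : ℝ≥0∞))]
    refine mul_le_mul' le_rfl ?_
    refine le_trans ?_ (mul_le_mul' le_rfl (sum_orderSum_le F j _))
    rw [Finset.mul_sum]
    refine Finset.sum_le_sum fun i hi => mul_le_mul' ?_ le_rfl
    exact pow_le_pow_right₀ (by simp) (Nat.lt_succ_iff.1 (Finset.mem_range.1 hi))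
  · have hy' : y ∉ lam '' (Ω ∩ V) := by
      rintro ⟨z, hz, rfl⟩
      rw [lam.symm_apply_apply] at hy
      exact hy hz
    rw [indicator_of_notMem hy']
    exact zero_le

theorem lintegral_comp_symm (lam : E m ≃ᵢ E m) {g : E m → ℝ≥0∞} (hg : Measurable g)
    {S : Set (E m)} (hS : MeasurableSet S) :
    ∫⁻ y in S, g (lam.symm y) = ∫⁻ x in lam ⁻¹' S, g x := by
  have h := (measurePreserving_isometryEquiv lam.symm).setLIntegral_comp_preimage
    (s := lam ⁻¹' S) (lam.continuous.measurable hS) hg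
  rwa [← preimage_comp, lam.self_comp_symm, preimage_id] at h

theorem setLIntegral_bound_rpow_le {F : MultiIndex m → E m → ℝ} (hF : ∀ β, Measurable (F β))
    {p : ℝ} (hp : 1 ≤ p) (c : ℝ≥0∞) (j : ℕ) {U : Set (E m)} (hU : MeasurableSet U)
    (lam : E m ≃ᵢ E m) {S : Set (E m)} (hS : MeasurableSet S) :
    ∫⁻ y in S, (c * U.indicator (lowerSum F j) (lam.symm y)) ^ p ≤
      c ^ p * ((multiIndexLE m j).card : ℝ≥0∞) ^ (p - 1) * energy F p j (lam ⁻¹' S ∩ U) := by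
  have hp0 : 0 < p := by linarith
  have hm := measurable_lowerSum hF j
  have h1 := lintegral_comp_symm lam (g := fun x => (c * U.indicator (lowerSum F j) x) ^ p)
    (((hm.indicator hU).const_mul c).pow_const p) hS
  rw [h1]
  have h2 : ∀ x, (c * U.indicator (lowerSum F j) x) ^ p =
      c ^ p * U.indicator (fun x => lowerSum F j x ^ p) x := by
    intro x
    rw [ENNReal.mul_rpow_of_nonneg _ _ hp0.le]
    by_cases hx : x ∈ U
    · rw [indicator_of_mem hx, indicator_of_mem hx]
    · rw [indicator_of_notMem hx, indicator_of_notMem hx, ENNReal.zero_rpow_of_pos hp0]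
  simp only [h2]
  rw [lintegral_const_mul _ ((hm.pow_const p).indicator hU), setLIntegral_indicator hU,
    inter_comm, mul_assoc]
  exact mul_le_mul' le_rfl (setLIntegral_lowerSum_rpow_le hF hp j _)

end BurenkovMorrey

end

noncomputable section

namespace BurenkovMorrey

/-! ### Estimates for one cuboid -/

variable {m : ℕ} {𝒜 : Atlas m} {M : ℝ≥0} {l : ℕ} {C : MultiIndex m → ℝ} {P : ℝ} {Ω : Set (E m)}

theorem ExtensionData.norm_iteratedFDeriv_le (B : ExtensionData 𝒜 M l C P Ω) (j : 𝒜.Idx) {i : ℕ}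
    (hi : i ≤ l) (x : E m) :
    ‖iteratedFDeriv ℝ i (B.χ j) x‖ ≤ (((m + 1 : ℝ≥0) ^ l * ‖P‖₊ : ℝ≥0) : ℝ) := by
  refine (norm_iteratedFDeriv_le_of_classicalD (B.χ_smooth j) i x (c := ‖P‖) fun α hα =>
    (B.χ_deriv j α (hα.trans_le hi) x).trans (Real.le_norm_self P)).trans ?_
  push_cast
  refine mul_le_mul_of_nonneg_right ?_ (norm_nonneg _)
  exact pow_le_pow_right₀ (by linarith [(Nat.cast_nonneg m : (0 : ℝ) ≤ m)]) hi

/-- Leibniz estimate for the product of a cut-off function and a function in moved coordinates. -/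
theorem enorm_iteratedFDeriv_mul_comp_le {χ v : E m → ℝ} (hχ : ContDiff ℝ (⊤ : ℕ∞) χ)
    (hv : ContDiff ℝ (⊤ : ℕ∞) v) {Q : ℝ≥0} (hQ : ∀ i ≤ l, ∀ x, ‖iteratedFDeriv ℝ i χ x‖ ≤ Q)
    (lam : E m ≃ᵢ E m) {i : ℕ} (hi : i ≤ l) (x : E m) :
    ‖iteratedFDeriv ℝ i (fun y => χ y * v (lam y)) x‖ₑ ≤
      2 ^ i * Q * ∑ b ∈ Finset.range (i + 1), ‖iteratedFDeriv ℝ b v (lam x)‖ₑ := by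
  have h := enorm_iteratedFDeriv_mul_le (hv.comp (contDiff_isometryEquiv lam)) hχ i x
  have e : (fun y => (v ∘ lam) y * χ y) = fun y => χ y * v (lam y) := by
    funext y; simp only [Function.comp_apply]; ring
  rw [e] at h
  refine h.trans ?_
  rw [Finset.mul_sum]
  refine Finset.sum_le_sum fun b hb => ?_
  have h1 : ‖iteratedFDeriv ℝ b (v ∘ lam) x‖ₑ = ‖iteratedFDeriv ℝ b v (lam x)‖ₑ := by
    rw [← ofReal_norm, ← ofReal_norm, ← norm_iteratedFDeriv_comp_isometryEquiv lam b x]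
    rfl
  have h2 : ‖iteratedFDeriv ℝ (i - b) χ x‖ₑ ≤ Q := by
    rw [← ofReal_norm, ← ENNReal.ofReal_coe_nnreal]
    exact ENNReal.ofReal_le_ofReal (hQ _ (by omega) x)
  have h3 : (i.choose b : ℝ≥0∞) ≤ 2 ^ i := by
    exact_mod_cast Nat.choose_le_two_pow i b
  rw [h1]
  calc (i.choose b : ℝ≥0∞) * ‖iteratedFDeriv ℝ b v (lam x)‖ₑ * ‖iteratedFDeriv ℝ (i - b) χ x‖ₑ
      ≤ 2 ^ i * ‖iteratedFDeriv ℝ b v (lam x)‖ₑ * Q := by gcongr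
    _ = _ := by ring

theorem setLIntegral_mul_comp_rpow_le {χ v : E m → ℝ} (hχ : ContDiff ℝ (⊤ : ℕ∞) χ)
    (hv : ContDiff ℝ (⊤ : ℕ∞) v) {Q : ℝ≥0} (hQ : ∀ i ≤ l, ∀ x, ‖iteratedFDeriv ℝ i χ x‖ ≤ Q)
    (lam : E m ≃ᵢ E m) {i : ℕ} (hi : i ≤ l) {p : ℝ} (hp : 1 ≤ p) {S : Set (E m)}
    (hS : MeasurableSet S) :
    ∫⁻ x in S, ‖iteratedFDeriv ℝ i (fun y => χ y * v (lam y)) x‖ₑ ^ p ≤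
      (2 ^ i * Q) ^ p * (i + 1 : ℝ≥0∞) ^ (p - 1) * ∑ b ∈ Finset.range (i + 1),
        ∫⁻ y in lam.symm ⁻¹' S, ‖iteratedFDeriv ℝ b v y‖ₑ ^ p := by
  have hp0 : 0 ≤ p := by linarith
  have hm : ∀ b, Measurable fun y => ‖iteratedFDeriv ℝ b v y‖ₑ ^ p := fun b =>
    (measurable_iteratedFDeriv_enorm hv b).pow_const p
  have hm' : ∀ b, Measurable fun y => ‖iteratedFDeriv ℝ b v (lam y)‖ₑ ^ p := fun b =>
    (hm b).comp lam.continuous.measurable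
  calc ∫⁻ x in S, ‖iteratedFDeriv ℝ i (fun y => χ y * v (lam y)) x‖ₑ ^ p
      ≤ ∫⁻ x in S, (2 ^ i * Q) ^ p * (i + 1 : ℝ≥0∞) ^ (p - 1) * ∑ b ∈ Finset.range (i + 1),
          ‖iteratedFDeriv ℝ b v (lam x)‖ₑ ^ p := by
        refine lintegral_mono fun x => ?_
        refine (ENNReal.rpow_le_rpow
          (enorm_iteratedFDeriv_mul_comp_le hχ hv hQ lam hi x) hp0).trans ?_
        rw [ENNReal.mul_rpow_of_nonneg _ _ hp0, mul_assoc]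
        refine mul_le_mul' le_rfl ?_
        have := ENNReal.rpow_sum_le_const_mul_sum_rpow (Finset.range (i + 1))
          (fun b => ‖iteratedFDeriv ℝ b v (lam x)‖ₑ) hp
        rwa [Finset.card_range, Nat.cast_add, Nat.cast_one] at this
    _ = _ := by
        rw [lintegral_const_mul _ (Finset.measurable_fun_sum _ fun b _ => hm' b),
          lintegral_finsetSum _ fun b _ => hm' b]
        congr 1
        refine Finset.sum_congr rfl fun b _ => ?_
        have := lintegral_comp_symm lam.symm (hm b) hS
        rwa [IsometryEquiv.symm_symm] at this

/-- The factor by which balls are enlarged. -/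
def enlarge (M : ℝ≥0) : ℝ := 1 + 576 * ((M : ℝ) + 1) ^ 2

theorem one_le_enlarge (M : ℝ≥0) : 1 ≤ enlarge M := by
  have h0 : (0 : ℝ) ≤ M := M.2
  unfold enlarge
  nlinarith [sq_nonneg ((M : ℝ) + 1)]

/-- The estimates for a derivative `h` of order `i` of a local extension. -/
structure IsLocalDeriv (M : ℝ≥0) (V Ω : Set (E m)) (F : MultiIndex m → E m → ℝ) (p : ℝ) (i : ℕ)
    (c : ℝ≥0) (h : E m → ℝ) : Prop where
  zero : ∀ᵐ x, x ∉ V → h x = 0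
  global : ∫⁻ x, ‖h x‖ₑ ^ p ≤ c * energy F p i (Ω ∩ V)
  ball : ∀ x r, 0 < r → ∀ Λ : ℝ≥0∞,
    (∀ y, energy F p i (Metric.ball y (enlarge M * r) ∩ Ω) ≤ Λ) →
    ∫⁻ z in Metric.ball x r, ‖h z‖ₑ ^ p ≤ c * Λ

theorem IsLocalDeriv.mono {V : Set (E m)} {F : MultiIndex m → E m → ℝ} {p : ℝ} {i : ℕ}
    {c c' : ℝ≥0} {h : E m → ℝ} (hh : IsLocalDeriv M V Ω F p i c h) (hc : c ≤ c') :
    IsLocalDeriv M V Ω F p i c' h where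
  zero := hh.zero
  global := hh.global.trans (mul_le_mul' (by exact_mod_cast hc) le_rfl)
  ball := fun x r hr Λ hΛ => (hh.ball x r hr Λ hΛ).trans
    (mul_le_mul' (by exact_mod_cast hc) le_rfl)

theorem mul_pushZero_eq (j : 𝒜.Idx) (f χ : E m → ℝ) (x : E m) :
    χ x * pushZero 𝒜 Ω j (fun y => f y * χ y) (𝒜.lam j x) =
      (Ω ∩ 𝒜.V j).indicator (fun y => f y * (χ y * χ y)) x := by
  by_cases hx : x ∈ Ω ∩ 𝒜.V j
  · have h1 : 𝒜.lam j x ∈ 𝒜.H Ω j := mem_image_of_mem _ hx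
    rw [pushZero, indicator_of_mem h1, indicator_of_mem hx, IsometryEquiv.symm_apply_apply]
    ring
  · have h1 : 𝒜.lam j x ∉ 𝒜.H Ω j := fun h => hx ((𝒜.lam j).injective.mem_set_image.1 h)
    rw [pushZero, indicator_of_notMem h1, indicator_of_notMem hx, mul_zero]

/-- The estimate for a cuboid inside of the domain. -/
theorem exists_isLocalDeriv_of_subset (m : ℕ) (M : ℝ≥0) (l : ℕ) (P : ℝ) {p : ℝ} (hp : 1 ≤ p)
    (i : ℕ) (hil : i ≤ l) : ∃ c : ℝ≥0, ∀ (𝒜 : Atlas m) (C : MultiIndex m → ℝ) (Ω : Set (E m)),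
      IsLipschitzClass 𝒜 M Ω → ∀ (B : ExtensionData 𝒜 M l C P Ω) (ω f : E m → ℝ)
      (F : MultiIndex m → E m → ℝ), IsDerivFamily l p Ω f F → ∀ j : 𝒜.Idx,
      ¬ (𝒜.V j ∩ frontier Ω).Nonempty → ∀ α : MultiIndex m, α.order = i →
      ∃ h, HasWeakDeriv univ α (fun x => B.χ j x * B.localExt ω j (fun y => f y * B.χ j y) x) h ∧
        IsLocalDeriv M (𝒜.V j) Ω F p i c h := by
  have hp0 : 0 < p := by linarith
  set Q : ℝ≥0 := (m + 1 : ℝ≥0) ^ l * ‖P‖₊ with hQ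
  -- A bound for the derivatives of `χ_j^2` by the Leibniz rule: inside the domain the local
  -- extension is the identity, and the two factors `χ_j` combine.
  set Q' : ℝ≥0 := 2 ^ l * Q * ((l + 1 : ℕ) * Q) with hQ'
  set k : ℝ≥0∞ := 2 ^ i * Q' * (m + 1 : ℝ≥0∞) ^ i with hk
  have hkt : k ≠ ∞ := by finiteness
  have hct : k ^ p * ((multiIndexLE m i).card : ℝ≥0∞) ^ (p - 1) ≠ ∞ :=
    ENNReal.mul_ne_top (ENNReal.rpow_ne_top_of_nonneg hp0.le hkt)
      (ENNReal.rpow_ne_top_of_nonneg (by linarith) (by simp))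
  refine ⟨(k ^ p * ((multiIndexLE m i).card : ℝ≥0∞) ^ (p - 1)).toNNReal,
    fun 𝒜 C Ω hΩ B ω f F hF j hj α hα => ?_⟩
  have hV := Atlas.isOpen_V j
  have hsub : Ω ∩ 𝒜.V j = 𝒜.V j := inter_eq_self_of_subset_right (subset_of_not_meets hΩ hj)
  have hχ := B.χ_smooth j
  have hB := fun i (hi : i ≤ l) x => B.norm_iteratedFDeriv_le j hi x
  have hsq : ∀ i ≤ l, ∀ x, ‖iteratedFDeriv ℝ i (fun y => B.χ j y * B.χ j y) x‖ ≤ Q' := by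
    intro i hi x
    have h1 := enorm_iteratedFDeriv_mul_comp_le hχ hχ hB (IsometryEquiv.refl _) hi x
    have h2 : ∀ b ∈ Finset.range (i + 1), ‖iteratedFDeriv ℝ b (B.χ j) x‖ₑ ≤ Q := by
      intro b hb
      rw [← ofReal_norm, ← ENNReal.ofReal_coe_nnreal]
      exact ENNReal.ofReal_le_ofReal (hB b (by have := Finset.mem_range.1 hb; omega) x)
    have h3 : ‖iteratedFDeriv ℝ i (fun y => B.χ j y * B.χ j y) x‖ₑ ≤ Q' := by
      refine h1.trans ?_
      rw [hQ']
      push_cast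
      refine mul_le_mul' (mul_le_mul' (pow_le_pow_right₀ (by norm_num) hi) ?_) ?_
      · rw [hQ]; push_cast; exact le_rfl
      · refine (Finset.sum_le_sum h2).trans ?_
        rw [Finset.sum_const, Finset.card_range, nsmul_eq_mul]
        refine mul_le_mul' ?_ le_rfl
        exact_mod_cast Nat.succ_le_succ hi
    rw [← ofReal_norm, ENNReal.ofReal_le_iff_le_toReal ENNReal.coe_ne_top] at h3
    exact h3
  have hts : tsupport (fun y => B.χ j y * B.χ j y) ⊆ Ω ∩ 𝒜.V j := by
    rw [hsub]
    exact (tsupport_mul_subset_left).trans (B.χ_supp j)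
  -- No boundary is involved here: the support of `χ_j` lies in `V_j ⊆ Ω`, so the product extended
  -- by zero is weakly differentiable on the whole space.
  have hw := hF.weakBound_mul hΩ.isOpen hV (IsometryEquiv.refl _) (Ω' := univ) (hχ.mul hχ) (Q := Q')
    (by
      rw [inter_univ]
      intro y hy
      exact ⟨y, hts hy, rfl⟩) hsq
  obtain ⟨h, hh, hhb⟩ := hw.exists_hasWeakDeriv α (hα.trans_le hil)
  rw [hα] at hhb
  have e1 : (fun x => B.χ j x * B.localExt ω j (fun y => f y * B.χ j y) x) =
      (Ω ∩ 𝒜.V j).indicator fun y => f y * (B.χ j y * B.χ j y) := by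
    funext x
    rw [ExtensionData.localExt, if_neg hj, mul_pushZero_eq]
  have e2 : ((IsometryEquiv.refl (E m)) '' (Ω ∩ 𝒜.V j)).indicator
      (fun y => f ((IsometryEquiv.refl (E m)).symm y) *
        (B.χ j ((IsometryEquiv.refl (E m)).symm y) * B.χ j ((IsometryEquiv.refl (E m)).symm y))) =
      (Ω ∩ 𝒜.V j).indicator fun y => f y * (B.χ j y * B.χ j y) := by
    rw [show (IsometryEquiv.refl (E m)) '' (Ω ∩ 𝒜.V j) = Ω ∩ 𝒜.V j from image_id _]
    rfl
  rw [e2] at hh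
  have hint : ∀ S : Set (E m), MeasurableSet S → ∫⁻ x in S, ‖h x‖ₑ ^ p ≤
      k ^ p * ((multiIndexLE m i).card : ℝ≥0∞) ^ (p - 1) * energy F p i (S ∩ (Ω ∩ 𝒜.V j)) := by
    intro S hS
    refine le_trans (lintegral_mono_ae ?_) (setLIntegral_bound_rpow_le hF.meas hp k i
      (hΩ.isOpen.inter hV).measurableSet (IsometryEquiv.refl _) hS)
    filter_upwards [ae_restrict_of_ae hhb] with x hx
    exact ENNReal.rpow_le_rpow (hx (mem_univ x)) hp0.le
  refine ⟨h, e1 ▸ hh, ?_, ?_, fun x r hr Λ hΛ => ?_⟩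
  · filter_upwards [hhb] with x hx hxV
    have h1 := hx (mem_univ x)
    rw [indicator_of_notMem (fun h' => hxV h'.2), mul_zero] at h1
    simpa using h1
  · rw [ENNReal.coe_toNNReal hct]
    have := hint univ MeasurableSet.univ
    rwa [setLIntegral_univ, univ_inter] at this
  · rw [ENNReal.coe_toNNReal hct]
    refine (hint _ measurableSet_ball).trans (mul_le_mul' le_rfl ?_)
    refine le_trans (energy_mono F p le_rfl ?_) (hΛ x)
    refine inter_subset_inter (Metric.ball_subset_ball ?_) inter_subset_left
    nlinarith [one_le_enlarge M]

end BurenkovMorrey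

end

noncomputable section

namespace BurenkovMorrey

/-! ### Estimates for a cuboid that meets the boundary -/

variable {m : ℕ} {𝒜 : Atlas m} {M : ℝ≥0} {l : ℕ} {C : MultiIndex m → ℝ} {P : ℝ} {Ω : Set (E m)}

theorem ExtensionData.lipschitzWith (B : ExtensionData 𝒜 M l C P Ω) {j : 𝒜.Idx}
    (hj : (𝒜.V j ∩ frontier Ω).Nonempty) : LipschitzWith M (B.F j) :=
  B.same_lipschitz j hj M (B.elementary j hj).lipschitz

theorem ExtensionData.H_subset (B : ExtensionData 𝒜 M l C P Ω) {j : 𝒜.Idx}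
    (hj : (𝒜.V j ∩ frontier Ω).Nonempty) : 𝒜.H Ω j ⊆ subgraph (B.F j) := by
  rw [(B.elementary j hj).eq]
  exact fun x hx => hx.2.2

/-- Inside the box the subgraph of `F j` is contained in `H_j`. Since the cut-off is supported in
the box, the localized function extended by zero is weakly differentiable on the entire subgraph and
not only on `H_j`. -/
theorem ExtensionData.box_inter_subset (B : ExtensionData 𝒜 M l C P Ω) {j : 𝒜.Idx}
    (hj : (𝒜.V j ∩ frontier Ω).Nonempty) :
    box (𝒜.a j) (𝒜.b j) ∩ subgraph (B.F j) ⊆ 𝒜.H Ω j := by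
  rw [(B.elementary j hj).eq]
  exact fun x hx => ⟨fun i => hx.1 i.castSucc, (hx.1 (Fin.last m)).1, hx.2⟩

theorem tsupport_comp_symm_subset {χ : E m → ℝ} {j : 𝒜.Idx} (h : tsupport χ ⊆ 𝒜.V j) :
    tsupport (fun y => χ ((𝒜.lam j).symm y)) ⊆ box (𝒜.a j) (𝒜.b j) := by
  have h1 : tsupport (fun y => χ ((𝒜.lam j).symm y)) ⊆ (𝒜.lam j).symm ⁻¹' tsupport χ :=
    tsupport_comp_subset_preimage χ (𝒜.lam j).symm.continuous
  intro y hy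
  have h2 := h (h1 hy)
  rwa [Atlas.V_eq_preimage, mem_preimage, IsometryEquiv.apply_symm_apply] at h2

/-- The constant in the pointwise bound of the localized function. -/
def localConst (m l : ℕ) (P : ℝ) (i : ℕ) : ℝ≥0 :=
  2 ^ i * ((m + 1 : ℝ≥0) ^ l * ‖P‖₊) * (m + 1) ^ i

/-- On sets of finite volume `L^p` embeds into `L¹`. Cuboids are bounded, so the localized data are
integrable, as the approximation in the mean requires. -/
theorem IsDerivFamily.lintegral_lowerSum_ne_top {p : ℝ} (hp : 1 ≤ p) {f : E m → ℝ}
    {F : MultiIndex m → E m → ℝ} (hF : IsDerivFamily l p Ω f F) {U : Set (E m)} (hU : U ⊆ Ω)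
    (hUt : volume U ≠ ∞) {i : ℕ} (hi : i ≤ l) : ∫⁻ x in U, lowerSum F i x ≠ ∞ := by
  have hp0 : 0 < p := by linarith
  unfold lowerSum
  rw [lintegral_finsetSum _ fun β _ => (hF.meas β).enorm]
  refine ENNReal.sum_ne_top.2 fun β hβ => ?_
  have h1 := rpow_lintegral_le (volume.restrict U) (hF.meas β).enorm hp
  rw [Measure.restrict_apply_univ] at h1
  have h2 : volume U ^ (p - 1) * ∫⁻ x in U, ‖F β x‖ₑ ^ p ≠ ∞ :=
    ENNReal.mul_ne_top (ENNReal.rpow_ne_top_of_nonneg (by linarith) hUt)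
      (ne_top_of_le_ne_top (hF.finite β (((mem_multiIndexLE β).1 hβ).trans hi))
        (lintegral_mono_set hU))
  intro h3
  rw [h3, ENNReal.top_rpow_of_pos hp0] at h1
  exact h2 (top_le_iff.1 h1)

theorem ExtensionData.finiteBound (B : ExtensionData 𝒜 M l C P Ω) (hΩ : IsOpen Ω) {p : ℝ}
    (hp : 1 ≤ p) {f : E m → ℝ} {F : MultiIndex m → E m → ℝ} (hF : IsDerivFamily l p Ω f F)
    {j : 𝒜.Idx} (hj : (𝒜.V j ∩ frontier Ω).Nonempty) :
    FiniteBound (subgraph (B.F j)) l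
      (fun i y => localConst m l P i * (Ω ∩ 𝒜.V j).indicator (lowerSum F i) ((𝒜.lam j).symm y))
      (pushZero 𝒜 Ω j fun y => f y * B.χ j y) := by
  have hV := Atlas.isOpen_V j
  have hUm := (hΩ.inter hV).measurableSet
  have hm : ∀ i, Measurable ((Ω ∩ 𝒜.V j).indicator (lowerSum F i)) := fun i =>
    (measurable_lowerSum hF.meas i).indicator hUm
  refine ⟨?_, fun i => ((hm i).comp (𝒜.lam j).symm.continuous.measurable).const_mul _,
    fun i hi => ?_, fun x hx => indicator_of_notMem (fun h => hx (B.H_subset hj h)) _⟩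
  · have h1 := hF.weakBound_mul hΩ hV (𝒜.lam j) (Ω' := subgraph (B.F j)) (B.χ_smooth j)
      (fun y hy => B.box_inter_subset hj ⟨tsupport_comp_symm_subset (B.χ_supp j) hy.1, hy.2⟩)
      (fun i hi x => B.norm_iteratedFDeriv_le j hi x)
    simp only [localConst, ENNReal.coe_mul, ENNReal.coe_pow, ENNReal.coe_add, ENNReal.coe_natCast,
      ENNReal.coe_one, ENNReal.coe_ofNat] at h1 ⊢
    exact h1
  · have h1 := lintegral_comp_symm (𝒜.lam j)
      (g := fun x => localConst m l P i * (Ω ∩ 𝒜.V j).indicator (lowerSum F i) x)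
      ((hm i).const_mul _) MeasurableSet.univ
    rw [setLIntegral_univ, preimage_univ, setLIntegral_univ, lintegral_const_mul _ (hm i),
      lintegral_indicator hUm] at h1
    rw [h1]
    exact ENNReal.mul_ne_top ENNReal.coe_ne_top (hF.lintegral_lowerSum_ne_top hp inter_subset_left
      (ne_top_of_le_ne_top (Atlas.isBounded_V j).measure_lt_top.ne
        (measure_mono inter_subset_right)) hi)

/-- The estimate for a cuboid that meets the boundary. -/
theorem exists_isLocalDeriv_of_meets {ω : E m → ℝ} (hω : IsKernel l ω) (M : ℝ≥0)
    (C : MultiIndex m → ℝ) (P : ℝ) {p : ℝ} (hp : 1 ≤ p) (i : ℕ) (hil : i ≤ l) :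
    ∃ c : ℝ≥0, ∀ (𝒜 : Atlas m) (Ω : Set (E m)), IsOpen Ω →
      ∀ (B : ExtensionData 𝒜 M l C P Ω) (f : E m → ℝ)
      (F : MultiIndex m → E m → ℝ), IsDerivFamily l p Ω f F → ∀ j : 𝒜.Idx,
      (𝒜.V j ∩ frontier Ω).Nonempty → ∀ α : MultiIndex m, α.order = i →
      ∃ h, HasWeakDeriv univ α (fun x => B.χ j x * B.localExt ω j (fun y => f y * B.χ j y) x) h ∧
        IsLocalDeriv M (𝒜.V j) Ω F p i c h := by
  have hp0 : 0 < p := by linarith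
  obtain ⟨ρ, hρ, hωρ⟩ := hω.exists_coneKernel M
  choose cg hcg using fun b : Fin (l + 1) =>
    lintegral_approxExt_le hρ C (Nat.lt_succ_iff.1 b.2) hp
  choose cb hcb using fun b : Fin (l + 1) =>
    lintegral_ball_approxExt_le hρ C (Nat.lt_succ_iff.1 b.2) hp
  set Q : ℝ≥0 := (m + 1 : ℝ≥0) ^ l * ‖P‖₊ with hQ
  set k : ℕ → ℝ≥0∞ := fun b =>
    (localConst m l P b : ℝ≥0∞) ^ p * ((multiIndexLE m b).card : ℝ≥0∞) ^ (p - 1) with hk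
  have hkt : ∀ b, k b ≠ ∞ := fun b =>
    ENNReal.mul_ne_top (ENNReal.rpow_ne_top_of_nonneg hp0.le ENNReal.coe_ne_top)
      (ENNReal.rpow_ne_top_of_nonneg (by linarith) (by simp))
  set s : ℝ≥0∞ := ∑ b : Fin (l + 1), ((cg b : ℝ≥0∞) + cb b) * k b with hs
  have hst : s ≠ ∞ := ENNReal.sum_ne_top.2 fun b _ =>
    ENNReal.mul_ne_top (by finiteness) (hkt b)
  set q : ℝ≥0∞ := (2 ^ i * (Q : ℝ≥0∞)) ^ p * (i + 1 : ℝ≥0∞) ^ (p - 1) with hq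
  have hqt : q ≠ ∞ :=
    ENNReal.mul_ne_top (ENNReal.rpow_ne_top_of_nonneg hp0.le (by finiteness))
      (ENNReal.rpow_ne_top_of_nonneg (by linarith) (by finiteness))
  have hct : q * ((i + 1 : ℕ) * s) ≠ ∞ := by finiteness
  refine ⟨(q * ((i + 1 : ℕ) * s)).toNNReal, fun 𝒜 Ω hΩ B f F hF j hj α hα => ?_⟩
  have hLip := B.lipschitzWith hj
  have hψ := B.partition j hj
  have hχ := B.χ_smooth j
  have hB := fun i (hi : i ≤ l) x => B.norm_iteratedFDeriv_le j hi x
  have hfb := B.finiteBound hΩ hp hF hj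
  set u := pushZero 𝒜 Ω j fun y => f y * B.χ j y with hu
  set N : ℕ → E m → ℝ≥0∞ := fun i y =>
    localConst m l P i * (Ω ∩ 𝒜.V j).indicator (lowerSum F i) ((𝒜.lam j).symm y) with hN
  have hui := hfb.integrable (isOpen_subgraph hLip).measurableSet
  have hUm := (hΩ.inter (Atlas.isOpen_V j)).measurableSet
  set v : ℕ → E m → ℝ := fun K => approxExt ρ u (B.ψ j) K with hv
  have hvs : ∀ K, ContDiff ℝ (⊤ : ℕ∞) (v K) := fun K => contDiff_approxExt hρ hLip hψ hui K
  -- Truncated extensions pulled back and multiplied by the cut-off: smooth with compact support on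
  -- the whole space.
  set W : ℕ → E m → ℝ := fun K x => B.χ j x * v K (𝒜.lam j x) with hW
  have hWt : ∀ K, IsTest univ (W K) := fun K =>
    ⟨hχ.mul ((hvs K).comp (contDiff_isometryEquiv _)), (B.χ_compact j).mul_right, subset_univ _⟩
  set e := subgraphExt (16 * ((M : ℝ) + 1)) ω (B.F j) (B.ψ j) u with he
  have hem := aestronglyMeasurable_subgraphExt hρ hLip hψ hui (hωρ)
  set w : E m → ℝ := fun x => B.χ j x * e (𝒜.lam j x) with hw
  have hw' : (fun x => B.χ j x * B.localExt ω j (fun y => f y * B.χ j y) x) = w := by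
    funext x
    rw [ExtensionData.localExt, if_pos hj]
  have hmp := measurePreserving_isometryEquiv (𝒜.lam j)
  have hwm : AEStronglyMeasurable w volume :=
    hχ.continuous.aestronglyMeasurable.mul (hem.comp_measurePreserving hmp)
  have hWw : Filter.Tendsto (fun K => ∫⁻ x, ‖W K x - w x‖ₑ) Filter.atTop (nhds 0) := by
    have h1 := tendsto_lintegral_approxExt hρ hLip hψ hfb hωρ
    refine tendsto_of_tendsto_of_tendsto_of_le_of_le tendsto_const_nhds h1 (fun _ => zero_le)
      fun K => ?_
    dsimp only
    refine le_of_le_of_eq (lintegral_mono fun x => ?_)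
      (hmp.lintegral_comp_emb (𝒜.lam j).toHomeomorph.measurableEmbedding
        fun y => ‖v K y - e y‖ₑ)
    simp only [hW, hw, ← mul_sub, enorm_mul]
    refine (mul_le_mul' ?_ le_rfl).trans (one_mul _).le
    rw [Real.enorm_eq_ofReal (B.χ_nonneg j x)]
    exact (ENNReal.ofReal_le_ofReal (B.χ_le_one j x)).trans ENNReal.ofReal_one.le
  have hWc : Filter.Tendsto (fun K : ℕ × ℕ =>
      ∫⁻ x, ‖iteratedFDeriv ℝ α.order (W K.1 - W K.2) x‖ₑ) Filter.atTop (nhds 0) := by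
    have h1 := tendsto_finsetSum (Finset.range (i + 1)) fun b hb =>
      tendsto_lintegral_approxExt_sub hρ hLip hψ hfb (i := b)
        ((Nat.lt_succ_iff.1 (Finset.mem_range.1 hb)).trans hil)
        ((Nat.lt_succ_iff.1 (Finset.mem_range.1 hb)).trans hil)
    rw [Finset.sum_const_zero] at h1
    have h2 := ENNReal.Tendsto.const_mul h1
      (a := (2 ^ i * (Q : ℝ≥0∞)) ^ (1 : ℝ) * (i + 1 : ℝ≥0∞) ^ ((1 : ℝ) - 1))
      (Or.inr (by rw [sub_self, ENNReal.rpow_zero, ENNReal.rpow_one]; finiteness))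
    rw [mul_zero] at h2
    refine tendsto_of_tendsto_of_tendsto_of_le_of_le tendsto_const_nhds h2 (fun _ => zero_le)
      fun K => ?_
    -- The case of exponent one reduces the Cauchy property of the `W K` to that of the truncated
    -- extensions.
    have h3 := setLIntegral_mul_comp_rpow_le hχ ((hvs K.1).sub (hvs K.2)) hB (𝒜.lam j) hil
      le_rfl MeasurableSet.univ
    simp only [setLIntegral_univ, preimage_univ, ENNReal.rpow_one] at h3 ⊢
    have h4 : (fun y => B.χ j y * (v K.1 (𝒜.lam j y) - v K.2 (𝒜.lam j y))) = W K.1 - W K.2 := by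
      funext x; simp only [hW, Pi.sub_apply]; ring
    rw [h4] at h3
    rw [hα]
    exact h3
  obtain ⟨h, hh, hhb⟩ := exists_hasWeakDeriv_of_tendsto hWt hwm hWw α hWc
  rw [hα] at hhb
  have hNint : ∀ (b : ℕ) (S : Set (E m)), MeasurableSet S → ∫⁻ y in S, N b y ^ p ≤
      k b * energy F p b ((𝒜.lam j) ⁻¹' S ∩ (Ω ∩ 𝒜.V j)) := fun b S hS =>
    setLIntegral_bound_rpow_le hF.meas hp _ b hUm (𝒜.lam j) hS
  have hsle : ∀ b : Fin (l + 1), ((cg b : ℝ≥0∞) + cb b) * k b ≤ s := fun b =>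
    Finset.single_le_sum (f := fun b : Fin (l + 1) => ((cg b : ℝ≥0∞) + cb b) * k b)
      (fun _ _ => zero_le) (Finset.mem_univ b)
  have hfinal : ∀ (S : Set (E m)) (Λ : ℝ≥0∞), MeasurableSet S → (∀ b ≤ i, ∀ K : ℕ,
      ∫⁻ y in (𝒜.lam j).symm ⁻¹' S, ‖iteratedFDeriv ℝ b (v K) y‖ₑ ^ p ≤ s * Λ) →
      ∫⁻ x in S, ‖h x‖ₑ ^ p ≤ q * ((i + 1 : ℕ) * s) * Λ := by
    intro S Λ hS hb
    refine hhb p S _ hp0.le fun K => ?_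
    refine (setLIntegral_mul_comp_rpow_le hχ (hvs K) hB (𝒜.lam j) hil hp hS).trans ?_
    rw [mul_assoc q]
    refine mul_le_mul' le_rfl ?_
    refine (Finset.sum_le_sum fun b hb' =>
      hb b (Nat.lt_succ_iff.1 (Finset.mem_range.1 hb')) K).trans ?_
    rw [Finset.sum_const, Finset.card_range, nsmul_eq_mul, mul_assoc]
  refine ⟨h, hw' ▸ hh, ?_, ?_, fun x r hr Λ hΛ => ?_⟩
  · have hVm : MeasurableSet (𝒜.V j)ᶜ := (Atlas.isOpen_V j).measurableSet.compl
    -- Vanishing outside the cuboid passes to the limit as an integral bound with right-hand side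
    -- zero.
    have h0 : ∫⁻ x in (𝒜.V j)ᶜ, ‖h x‖ₑ ^ p ≤ 0 := by
      refine hhb p _ 0 hp0.le fun K => le_of_eq ?_
      rw [setLIntegral_eq_zero_iff hVm
        ((measurable_iteratedFDeriv_enorm (hWt K).smooth i).pow_const p)]
      refine Filter.Eventually.of_forall fun x hx => ?_
      have : iteratedFDeriv ℝ i (W K) x = 0 :=
        iteratedFDeriv_mul_eq_zero i fun hx' => hx (B.χ_supp j hx')
      rw [this, enorm_zero, ENNReal.zero_rpow_of_pos hp0]
    have hhm : AEMeasurable (fun x => ‖h x‖ₑ ^ p) (volume.restrict (𝒜.V j)ᶜ) := by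
      have := (locallyIntegrableOn_univ.1 hh.2.1).aestronglyMeasurable
      exact (this.enorm.pow_const p).restrict
    have h1 := (lintegral_eq_zero_iff' hhm).1 (le_antisymm h0 zero_le)
    filter_upwards [(ae_restrict_iff' hVm).1 h1] with x hx hxV
    have h2 := hx hxV
    simpa [hp0, hp0.not_gt] using h2
  · rw [ENNReal.coe_toNNReal hct]
    have := hfinal univ (energy F p i (Ω ∩ 𝒜.V j)) MeasurableSet.univ fun b hb K => ?_
    · rwa [setLIntegral_univ] at this
    rw [preimage_univ, setLIntegral_univ]
    have h1 := hcg ⟨b, by omega⟩ _ hLip _ hψ l N u hfb (hb.trans hil) K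
    have h2 := hNint b univ MeasurableSet.univ
    rw [setLIntegral_univ, preimage_univ, univ_inter] at h2
    refine h1.trans ((mul_le_mul' le_rfl h2).trans ?_)
    rw [← mul_assoc]
    refine mul_le_mul' (le_trans ?_ (hsle ⟨b, by omega⟩)) (energy_mono F p hb subset_rfl)
    exact mul_le_mul' le_self_add le_rfl
  · rw [ENNReal.coe_toNNReal hct]
    refine hfinal _ Λ measurableSet_ball fun b hb K => ?_
    rw [IsometryEquiv.preimage_ball, IsometryEquiv.symm_symm]
    refine (hcb ⟨b, by omega⟩ _ hLip _ hψ l N u hfb (hb.trans hil) K _ r hr (k b * Λ)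
      fun y => ?_).trans ?_
    · refine (hNint b _ measurableSet_ball).trans (mul_le_mul' le_rfl ?_)
      rw [IsometryEquiv.preimage_ball]
      exact (energy_mono F p hb (inter_subset_inter_right _ inter_subset_left)).trans (hΛ _)
    · rw [← mul_assoc]
      refine mul_le_mul' (le_trans ?_ (hsle ⟨b, by omega⟩)) le_rfl
      exact mul_le_mul' le_add_self le_rfl

end BurenkovMorrey

end

noncomputable section

namespace BurenkovMorrey

/-! ### Coverings and counting -/

variable {m : ℕ} {𝒜 : Atlas m} {M : ℝ≥0} {l : ℕ} {C : MultiIndex m → ℝ} {P : ℝ} {Ω : Set (E m)}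

/-- By scaling, a ball of radius `R r` is covered by a number of balls of radius `r / 2` that
depends only on `R` and the dimension. A small ball that meets `Ω` lies in a ball of radius `r`
centred at a point of `Ω`; the passage from `r / 2` to `r` is needed because the Morrey norm admits
only centres in `Ω`. -/
theorem exists_measure_ball_inter_le (m : ℕ) (R : ℝ) : ∃ N : ℕ, ∀ (ν : Measure (E m))
    (Ω : Set (E m)) (y : E m) (r : ℝ), 0 < r →
    ν (Metric.ball y (R * r) ∩ Ω) ≤ N * ⨆ x ∈ Ω, ν (Metric.ball x r ∩ Ω) := by
  obtain ⟨t, -, htf, ht⟩ := (isCompact_closedBall (0 : E m) R).finite_cover_balls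
    (e := 1 / 2) (by norm_num)
  refine ⟨htf.toFinset.card, fun ν Ω y r hr => ?_⟩
  have hcov : Metric.ball y (R * r) ∩ Ω ⊆
      ⋃ c ∈ htf.toFinset, Metric.ball (y + r • c) (r / 2) ∩ Ω := by
    rintro z ⟨hz, hzΩ⟩
    have h1 : r⁻¹ • (z - y) ∈ Metric.closedBall (0 : E m) R := by
      rw [mem_closedBall_zero_iff, norm_smul, norm_inv, Real.norm_of_nonneg hr.le,
        inv_mul_le_iff₀ hr, mul_comm, ← dist_eq_norm]
      exact (Metric.mem_ball.1 hz).le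
    obtain ⟨c, hc, hzc⟩ := mem_iUnion₂.1 (ht h1)
    refine mem_iUnion₂.2 ⟨c, htf.mem_toFinset.2 hc, ?_, hzΩ⟩
    rw [Metric.mem_ball, dist_eq_norm] at hzc ⊢
    have h2 : z - (y + r • c) = r • (r⁻¹ • (z - y) - c) := by
      rw [smul_sub, smul_inv_smul₀ hr.ne']; abel
    rw [h2, norm_smul, Real.norm_of_nonneg hr.le]
    nlinarith
  refine (measure_mono hcov).trans ((measure_biUnion_finset_le _ _).trans ?_)
  rw [← nsmul_eq_mul, ← Finset.sum_const]
  refine Finset.sum_le_sum fun c _ => ?_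
  rcases (Metric.ball (y + r • c) (r / 2) ∩ Ω).eq_empty_or_nonempty with he | ⟨x, hx, hxΩ⟩
  · rw [he, measure_empty]; exact zero_le
  · refine le_trans (measure_mono (inter_subset_inter_left _ fun z hz => ?_))
      (le_iSup₂ (f := fun x (_ : x ∈ Ω) => ν (Metric.ball x r ∩ Ω)) x hxΩ)
    rw [Metric.mem_ball] at hx hz ⊢
    have := dist_triangle_right z x (y + r • c)
    linarith

/-- The sum over the derivatives of order at most `i` of the largest integral over the
intersections of `Ω` with balls of radius `r` centred in `Ω`. -/
def ballEnergy (Ω : Set (E m)) (F : MultiIndex m → E m → ℝ) (p : ℝ) (i : ℕ) (r : ℝ) : ℝ≥0∞ :=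
  ∑ β ∈ multiIndexLE m i, ⨆ x ∈ Ω, ∫⁻ y in Metric.ball x r ∩ Ω, ‖F β y‖ₑ ^ p

theorem exists_energy_ball_inter_le (m : ℕ) (R : ℝ) : ∃ N : ℕ,
    ∀ (F : MultiIndex m → E m → ℝ) (p : ℝ) (i : ℕ) (Ω : Set (E m)) (y : E m) (r : ℝ), 0 < r →
    energy F p i (Metric.ball y (R * r) ∩ Ω) ≤ N * ballEnergy Ω F p i r := by
  obtain ⟨N, hN⟩ := exists_measure_ball_inter_le m R
  refine ⟨N, fun F p i Ω y r hr => ?_⟩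
  rw [energy, ballEnergy, Finset.mul_sum]
  refine Finset.sum_le_sum fun β _ => ?_
  have := hN (volume.withDensity fun y => ‖F β y‖ₑ ^ p) Ω y r hr
  simpa only [withDensity_apply'] using this

/-- The indicators of the sets add up to at most `κ` at each point. -/
theorem sum_setLIntegral_le {ι : Type*} (T : Finset ι) {A : ι → Set (E m)} {κ : ℕ}
    (hA : ∀ j ∈ T, MeasurableSet (A j)) (hκ : ∀ x, {j | x ∈ A j}.encard ≤ κ) {S : Set (E m)}
    (hS : MeasurableSet S) (hAS : ∀ j ∈ T, A j ⊆ S) {g : E m → ℝ≥0∞} (hg : Measurable g) :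
    ∑ j ∈ T, ∫⁻ x in A j, g x ≤ κ * ∫⁻ x in S, g x := by
  classical
  have e : ∀ j ∈ T, ∫⁻ x in A j, g x = ∫⁻ x, (A j).indicator g x := fun j hj =>
    (lintegral_indicator (hA j hj) _).symm
  rw [Finset.sum_congr rfl e, ← lintegral_finsetSum' _ fun j hj =>
    (hg.indicator (hA j hj)).aemeasurable, ← lintegral_indicator hS,
    ← lintegral_const_mul _ (hg.indicator hS)]
  refine lintegral_mono fun x => ?_
  have hcard : ((T.filter fun j => x ∈ A j).card : ℕ∞) ≤ κ := by
    refine le_trans ?_ (hκ x)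
    rw [← encard_coe_eq_coe_finsetCard]
    refine encard_le_encard fun j hj => ?_
    exact (Finset.mem_filter.1 hj).2
  have hcard' : ((T.filter fun j => x ∈ A j).card : ℝ≥0∞) ≤ κ := by
    exact_mod_cast (Nat.cast_le.1 hcard : _ ≤ κ)
  calc ∑ j ∈ T, (A j).indicator g x
      = ∑ j ∈ T.filter fun j => x ∈ A j, g x := by
        rw [Finset.sum_filter]
        exact Finset.sum_congr rfl fun j _ => by rw [indicator_apply]
    _ = ∑ j ∈ T.filter fun j => x ∈ A j, S.indicator g x := by
        refine Finset.sum_congr rfl fun j hj => ?_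
        rw [indicator_of_mem (hAS j (Finset.mem_filter.1 hj).1 (Finset.mem_filter.1 hj).2)]
    _ ≤ κ * S.indicator g x := by
        rw [Finset.sum_const, nsmul_eq_mul]
        exact mul_le_mul' hcard' le_rfl

/-! ### Cuboids near a ball. -/

namespace Atlas

theorem dist_le_D {j : 𝒜.Idx} {x y : E m} (hx : x ∈ 𝒜.V j) (hy : y ∈ 𝒜.V j) :
    dist x y ≤ 𝒜.D :=
  (Metric.dist_le_diam_of_mem (isBounded_V j) hx hy).trans (le_ciSup 𝒜.bddAbove_diam j)

theorem exists_ball_subset_V (j : 𝒜.Idx) : ∃ c, Metric.ball c (𝒜.d / 2) ⊆ 𝒜.V j := by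
  set c : E m := WithLp.toLp 2 fun i => (𝒜.a j i + 𝒜.b j i) / 2 with hc
  refine ⟨(𝒜.lam j).symm c, ?_⟩
  rw [V_eq_preimage, ← IsometryEquiv.preimage_ball]
  refine preimage_mono fun x hx i => ?_
  rw [Metric.mem_ball, dist_eq_norm] at hx
  have h1 := abs_lt.1 ((PiLp.norm_apply_le (x - c) i).trans_lt hx)
  have h2 := 𝒜.a_add_lt j i
  simp only [hc, PiLp.sub_apply] at h1
  constructor <;> linarith [h1.1, h1.2]

theorem subset_ball_of_meets {j : 𝒜.Idx} {x : E m} {R : ℝ}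
    (h : (𝒜.V j ∩ Metric.ball x R).Nonempty) : 𝒜.V j ⊆ Metric.ball x (R + 𝒜.D) := by
  obtain ⟨y, hy, hyx⟩ := h
  intro z hz
  rw [Metric.mem_ball] at hyx ⊢
  have := dist_triangle z y x
  have := dist_le_D hz hy
  linarith

/-- A packing argument: every cuboid that meets the ball contains a ball of radius `d / 2` and lies
in the concentric ball of radius `R + D`. Comparison of volumes with multiplicity `κ` bounds their
number independently of the centre. -/
theorem exists_finset_meets (𝒜 : Atlas m) (R : ℝ) : ∃ N : ℕ, ∀ x : E m, ∃ T : Finset 𝒜.Idx,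
    T.card ≤ N ∧ ∀ j, j ∈ T ↔ (𝒜.V j ∩ Metric.ball x R).Nonempty := by
  obtain ⟨κ, hκ⟩ := 𝒜.finite_multiplicity
  set v := volume (Metric.ball (0 : E m) (𝒜.d / 2)) with hv
  have hv0 : v ≠ 0 := (Metric.measure_ball_pos _ _ (half_pos 𝒜.d_pos)).ne'
  set w := volume (Metric.ball (0 : E m) (R + 𝒜.D)) with hw
  have hwt : (κ * w) / v ≠ ∞ :=
    ENNReal.div_ne_top (ENNReal.mul_ne_top (by simp) measure_ball_lt_top.ne) hv0
  obtain ⟨N, hN⟩ := ENNReal.exists_nat_gt hwt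
  have key : ∀ (x : E m) (T : Finset 𝒜.Idx),
      (∀ j ∈ T, (𝒜.V j ∩ Metric.ball x R).Nonempty) → T.card ≤ N := by
    intro x T hT
    have h1 := sum_setLIntegral_le T (A := 𝒜.V) (fun j _ => (isOpen_V j).measurableSet) hκ
      (measurableSet_ball (x := x) (ε := R + 𝒜.D)) (fun j hj => subset_ball_of_meets (hT j hj))
      (g := fun _ => 1) measurable_const
    simp only [setLIntegral_one] at h1
    rw [Measure.addHaar_ball_center] at h1
    have h2 : (T.card : ℝ≥0∞) * v ≤ κ * w := by
      refine le_trans ?_ h1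
      rw [← nsmul_eq_mul, ← Finset.sum_const]
      refine Finset.sum_le_sum fun j _ => ?_
      obtain ⟨c, hc⟩ := exists_ball_subset_V j
      rw [hv, ← Measure.addHaar_ball_center volume c]
      exact measure_mono hc
    have h3 := ((ENNReal.le_div_iff_mul_le (Or.inl hv0)
      (Or.inl measure_ball_lt_top.ne)).2 h2).trans hN.le
    exact_mod_cast h3
  refine ⟨N, fun x => ?_⟩
  have hfin : {j | (𝒜.V j ∩ Metric.ball x R).Nonempty}.Finite := by
    by_contra hinf
    obtain ⟨T, hT, hTc⟩ := Set.Infinite.exists_subset_card_eq hinf (N + 1)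
    have := key x T fun j hj => hT hj
    omega
  exact ⟨hfin.toFinset, key x _ fun j hj => hfin.mem_toFinset.1 hj, fun j => hfin.mem_toFinset⟩

end Atlas

/-- The estimate for all cuboids. -/
theorem exists_isLocalDeriv {ω : E m → ℝ} (hω : IsKernel l ω) (M : ℝ≥0)
    (C : MultiIndex m → ℝ) (P : ℝ) {p : ℝ} (hp : 1 ≤ p) :
    ∃ c : ℝ≥0, ∀ (𝒜 : Atlas m) (Ω : Set (E m)), IsLipschitzClass 𝒜 M Ω →
      ∀ (B : ExtensionData 𝒜 M l C P Ω) (f : E m → ℝ)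
      (F : MultiIndex m → E m → ℝ), IsDerivFamily l p Ω f F → ∀ (j : 𝒜.Idx)
      (α : MultiIndex m), α.order ≤ l →
      ∃ h, HasWeakDeriv univ α (fun x => B.χ j x * B.localExt ω j (fun y => f y * B.χ j y) x) h ∧
        IsLocalDeriv M (𝒜.V j) Ω F p α.order c h := by
  choose c₁ h₁ using fun i : Fin (l + 1) =>
    exists_isLocalDeriv_of_subset m M l P hp i (Nat.lt_succ_iff.1 i.2)
  choose c₂ h₂ using fun i : Fin (l + 1) =>
    exists_isLocalDeriv_of_meets hω M C P hp i (Nat.lt_succ_iff.1 i.2)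
  refine ⟨∑ i, (c₁ i + c₂ i), fun 𝒜 Ω hΩ B f F hF j α hα => ?_⟩
  set i : Fin (l + 1) := ⟨α.order, Nat.lt_succ_iff.2 hα⟩ with hi
  have hle : c₁ i + c₂ i ≤ ∑ i, (c₁ i + c₂ i) :=
    Finset.single_le_sum (f := fun i => c₁ i + c₂ i) (fun _ _ => zero_le) (Finset.mem_univ i)
  by_cases hj : (𝒜.V j ∩ frontier Ω).Nonempty
  · obtain ⟨h, hw, hh⟩ := h₂ i 𝒜 Ω hΩ.isOpen B f F hF j hj α rfl
    exact ⟨h, hw, hh.mono (le_add_self.trans hle)⟩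
  · obtain ⟨h, hw, hh⟩ := h₁ i 𝒜 C Ω hΩ B ω f F hF j hj α rfl
    exact ⟨h, hw, hh.mono (le_self_add.trans hle)⟩

end BurenkovMorrey

end

noncomputable section

namespace BurenkovMorrey

/-! ### The global estimate -/

variable {m : ℕ} {𝒜 : Atlas m} {M : ℝ≥0} {l : ℕ} {C : MultiIndex m → ℝ} {P : ℝ} {Ω : Set (E m)}

theorem HasWeakDeriv.congr_right {α : MultiIndex m} {f g g' : E m → ℝ} (hΩ : MeasurableSet Ω)
    (h : HasWeakDeriv Ω α f g) (hg : ∀ᵐ x, x ∈ Ω → g' x = g x) : HasWeakDeriv Ω α f g' := by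
  refine ⟨h.1, locallyIntegrableOn_congr hΩ h.2.1 hg, fun η h1 h2 h3 => ?_⟩
  have hη : IsTest Ω η := ⟨h1, h2, h3⟩
  rw [h.2.2 η h1 h2 h3, hη.setIntegral_mul, hη.setIntegral_mul, hη.integral_congr hg]

theorem hasWeakDeriv_zero {f : E m → ℝ} (hf : LocallyIntegrableOn f Ω) :
    HasWeakDeriv Ω 0 f f :=
  ⟨hf, hf, fun η _ _ _ => by rw [classicalD_zero, order_zero]; simp⟩

theorem HasWeakDeriv.finset_sum {ι : Type*} (T : Finset ι) {α : MultiIndex m}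
    {f g : ι → E m → ℝ} (h : ∀ j ∈ T, HasWeakDeriv univ α (f j) (g j)) :
    HasWeakDeriv univ α (∑ j ∈ T, f j) (∑ j ∈ T, g j) := by
  classical
  induction T using Finset.induction_on with
  | empty =>
    have h0 : LocallyIntegrableOn (0 : E m → ℝ) univ :=
      (integrable_zero _ _ _).locallyIntegrable.locallyIntegrableOn _
    exact ⟨h0, h0, fun η _ _ _ => by simp⟩
  | insert a T ha ih =>
    rw [Finset.sum_insert ha, Finset.sum_insert ha]
    have h1 := h a (Finset.mem_insert_self _ _)
    have h2 := ih fun j hj => h j (Finset.mem_insert_of_mem hj)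
    refine ⟨h1.1.add h2.1, h1.2.1.add h2.2.1, fun η e1 e2 e3 => ?_⟩
    have hη : IsTest univ η := ⟨e1, e2, e3⟩
    have hη' := hη.classicalD α
    have i1 := h1.2.2 η e1 e2 e3
    have i2 := h2.2.2 η e1 e2 e3
    simp only [setIntegral_univ, Pi.add_apply, add_mul] at i1 i2 ⊢
    rw [integral_add (hη'.integrable_mul h1.1) (hη'.integrable_mul h2.1),
      integral_add (hη.integrable_mul h1.2.1) (hη.integrable_mul h2.2.1), i1, i2, mul_add]

/-- Weak differentiability is a local property. -/
theorem hasWeakDeriv_of_forall_ball {α : MultiIndex m} {f g : E m → ℝ}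
    (h : ∀ R : ℝ, ∃ f' g', HasWeakDeriv univ α f' g' ∧ (∀ x ∈ Metric.ball 0 R, f x = f' x) ∧
      ∀ᵐ x, x ∈ Metric.ball (0 : E m) R → g x = g' x) : HasWeakDeriv univ α f g := by
  have hloc : ∀ {u : E m → ℝ}, (∀ R : ℝ, ∃ u', LocallyIntegrableOn u' univ ∧
      ∀ᵐ x, x ∈ Metric.ball (0 : E m) R → u x = u' x) → LocallyIntegrableOn u univ := by
    intro u hu
    rw [locallyIntegrableOn_univ]
    intro x
    obtain ⟨u', hu', huu⟩ := hu (‖x‖ + 1)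
    have hb : LocallyIntegrableOn u (Metric.ball (0 : E m) (‖x‖ + 1)) :=
      locallyIntegrableOn_congr measurableSet_ball (hu'.mono_set (subset_univ _)) huu
    have hx : x ∈ Metric.ball (0 : E m) (‖x‖ + 1) := by simp
    have := hb x hx
    rwa [Metric.isOpen_ball.nhdsWithin_eq hx] at this
  refine ⟨hloc fun R => ?_, hloc fun R => ?_, fun η h1 h2 h3 => ?_⟩
  · obtain ⟨f', g', hw, hf, hg⟩ := h R
    exact ⟨f', hw.1, Filter.Eventually.of_forall hf⟩
  · obtain ⟨f', g', hw, hf, hg⟩ := h R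
    exact ⟨g', hw.2.1, hg⟩
  · obtain ⟨R, hR⟩ := (h2.isCompact.isBounded).subset_ball (0 : E m)
    obtain ⟨f', g', hw, hf, hg⟩ := h R
    have hη : IsTest (Metric.ball 0 R) η := ⟨h1, h2, hR⟩
    have := hw.2.2 η h1 h2 h3
    simp only [setIntegral_univ] at this ⊢
    rw [(hη.classicalD α).integral_congr (Filter.Eventually.of_forall hf),
      hη.integral_congr hg, this]

theorem MemSobolev.exists_isDerivFamily {p : ℝ} (hp : 1 ≤ p) (hΩ : IsOpen Ω) {f : E m → ℝ}
    (hf : MemSobolev l p Ω f) : ∃ F : MultiIndex m → E m → ℝ, IsDerivFamily l p Ω f F ∧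
      ∀ β : MultiIndex m, β.order ≤ l → ∀ᵐ x, x ∈ Ω → F β x = weakD Ω β f x := by
  classical
  have hp0 : 0 < p := by linarith
  have hD : ∀ β : MultiIndex m, β.order ≤ l → HasWeakDeriv Ω β f (weakD Ω β f) := fun β hβ => by
    obtain ⟨g, hg, -⟩ := hf.2 β hβ
    exact hg.weakD
  have hex : ∀ β : MultiIndex m, ∃ G : E m → ℝ, Measurable G ∧
      (β.order ≤ l → ∀ᵐ x, x ∈ Ω → G x = weakD Ω β f x) := by
    intro β
    by_cases hβ : β.order ≤ l
    · have hm := (hD β hβ).2.1.aestronglyMeasurable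
      refine ⟨hm.mk, hm.stronglyMeasurable_mk.measurable, fun _ => ?_⟩
      filter_upwards [(ae_restrict_iff' hΩ.measurableSet).1 hm.ae_eq_mk] with x hx hxΩ
      exact (hx hxΩ).symm
    · exact ⟨0, measurable_zero, fun h => absurd h hβ⟩
  choose F hFm hF using hex
  have hw : ∀ β : MultiIndex m, β.order ≤ l → HasWeakDeriv Ω β f (F β) := fun β hβ =>
    (hD β hβ).congr_right hΩ.measurableSet (hF β hβ)
  refine ⟨F, ⟨hFm, hw, fun β hβ => ?_, ?_⟩, hF⟩
  · obtain ⟨g, hg, hgp⟩ := hf.2 β hβ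
    have h1 := lintegral_rpow_enorm_lt_top_of_eLpNorm_lt_top
      (by simpa using hp0) ENNReal.ofReal_ne_top hgp.2
    rw [ENNReal.toReal_ofReal hp0.le] at h1
    refine (lt_of_eq_of_lt (lintegral_congr_ae ?_) h1).ne
    filter_upwards [(ae_restrict_iff' hΩ.measurableSet).2 ((hw β hβ).ae_unique hΩ hg)] with x hx
    rw [hx]
  · exact (hasWeakDeriv_zero (hw 0 (by simp [order_zero])).1).ae_unique hΩ
      (hw 0 (by simp [order_zero]))

/-- At each point at most `κ` terms are nonzero, so the power of the sum costs `κ^{p-1}` however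
many cuboids there are in `T`. -/
theorem enorm_tsum_rpow_le {κ : ℕ} {p : ℝ} (hp : 1 ≤ p) {h : 𝒜.Idx → ℝ} {x : E m}
    (hκ : {j | x ∈ 𝒜.V j}.encard ≤ κ) (h0 : ∀ j, x ∉ 𝒜.V j → h j = 0) (T : Finset 𝒜.Idx)
    (hT : ∀ j, x ∈ 𝒜.V j → j ∈ T) :
    ‖∑' j, h j‖ₑ ^ p ≤ (κ : ℝ≥0∞) ^ (p - 1) * ∑ j ∈ T, ‖h j‖ₑ ^ p := by
  classical
  have hp0 : 0 ≤ p := by linarith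
  set S := T.filter fun j => x ∈ 𝒜.V j with hS
  have hz : ∀ j ∉ S, h j = 0 := fun j hj => h0 j fun hx =>
    hj (Finset.mem_filter.2 ⟨hT j hx, hx⟩)
  have hcard : (S.card : ℕ∞) ≤ κ := by
    refine le_trans ?_ hκ
    rw [← encard_coe_eq_coe_finsetCard]
    exact encard_le_encard fun j hj => (Finset.mem_filter.1 hj).2
  have hcard' : (S.card : ℝ≥0∞) ≤ κ := by
    exact_mod_cast (Nat.cast_le.1 hcard : _ ≤ κ)
  rw [tsum_eq_sum hz]
  refine (ENNReal.rpow_le_rpow (enorm_sum_le _ _) hp0).trans ?_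
  refine (ENNReal.rpow_sum_le_const_mul_sum_rpow _ _ hp).trans ?_
  refine mul_le_mul' (ENNReal.rpow_le_rpow hcard' (by linarith)) ?_
  exact Finset.sum_le_sum_of_subset (Finset.filter_subset _ _)

/-- The weak derivatives of the extension exist and satisfy the integral estimates. -/
theorem exists_hasWeakDeriv_extension {ω : E m → ℝ} (hω : IsKernel l ω) (𝒜 : Atlas m) (M : ℝ≥0)
    (C : MultiIndex m → ℝ) (P : ℝ) {p : ℝ} (hp : 1 ≤ p) :
    ∃ c : ℝ≥0, ∀ Ω : Set (E m), IsLipschitzClass 𝒜 M Ω →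
      ∀ (B : ExtensionData 𝒜 M l C P Ω) (f : E m → ℝ)
      (F : MultiIndex m → E m → ℝ), IsDerivFamily l p Ω f F →
      ∀ α : MultiIndex m, α.order ≤ l → ∃ h, HasWeakDeriv univ α (B.T ω f) h ∧
        ∫⁻ x, ‖h x‖ₑ ^ p ≠ ∞ ∧ ∀ x r, 0 < r →
          ∫⁻ z in Metric.ball x r, ‖h z‖ₑ ^ p ≤ c * ballEnergy Ω F p α.order r := by
  have hp0 : 0 < p := by linarith
  obtain ⟨c, hc⟩ := exists_isLocalDeriv hω M C P hp
  obtain ⟨κ, hκ⟩ := 𝒜.finite_multiplicity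
  set D := max 𝒜.D 1 with hD
  obtain ⟨n₀, hn₀⟩ := 𝒜.exists_finset_meets D
  obtain ⟨n₁, hn₁⟩ := exists_energy_ball_inter_le m (enlarge M)
  obtain ⟨n₂, hn₂⟩ := exists_energy_ball_inter_le m 2
  set k : ℝ≥0∞ := (κ : ℝ≥0∞) ^ (p - 1) with hk
  have hkt : k ≠ ∞ := ENNReal.rpow_ne_top_of_nonneg (by linarith) (by simp)
  -- The two summands are the constants for small and for large radii; neither depends on `r`.
  set s : ℝ≥0∞ := k * (n₀ * (c * n₁) + c * (κ * n₂)) with hs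
  have hst : s ≠ ∞ := by finiteness
  refine ⟨s.toNNReal, fun Ω hΩ B f F hF α hα => ?_⟩
  rw [ENNReal.coe_toNNReal hst]
  choose h hw hh using fun j => hc 𝒜 Ω hΩ B f F hF j α hα
  have hz : ∀ᵐ x, ∀ j, x ∉ 𝒜.V j → h j x = 0 := ae_all_iff.2 fun j => (hh j).zero
  have hUm : ∀ j, MeasurableSet (Ω ∩ 𝒜.V j) := fun j =>
    (hΩ.isOpen.inter (Atlas.isOpen_V j)).measurableSet
  have hκ' : ∀ x, {j | x ∈ Ω ∩ 𝒜.V j}.encard ≤ κ := fun x =>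
    (encard_le_encard fun j hj => hj.2).trans (hκ x)
  have henergy : ∀ (T : Finset 𝒜.Idx) (S : Set (E m)), MeasurableSet S →
      (∀ j ∈ T, Ω ∩ 𝒜.V j ⊆ S) →
      ∑ j ∈ T, energy F p α.order (Ω ∩ 𝒜.V j) ≤ κ * energy F p α.order S := by
    intro T S hS hTS
    simp only [energy]
    rw [Finset.sum_comm, Finset.mul_sum]
    exact Finset.sum_le_sum fun β _ => sum_setLIntegral_le T (fun j _ => hUm j) hκ' hS hTS
      ((hF.meas β).enorm.pow_const p)
  have hball : ∀ (x : E m) (r : ℝ) (T : Finset 𝒜.Idx),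
      (∀ j, j ∈ T ↔ (𝒜.V j ∩ Metric.ball x r).Nonempty) →
      ∫⁻ z in Metric.ball x r, ‖∑' j, h j z‖ₑ ^ p ≤
        k * ∑ j ∈ T, ∫⁻ z in Metric.ball x r, ‖h j z‖ₑ ^ p := by
    intro x r T hT
    have hm : ∀ j, AEMeasurable (fun z => ‖h j z‖ₑ ^ p) (volume.restrict (Metric.ball x r)) := by
      intro j
      have := (locallyIntegrableOn_univ.1 (hw j).2.1).aestronglyMeasurable
      exact (this.enorm.pow_const p).restrict
    rw [← lintegral_finsetSum' _ fun j _ => hm j, ← lintegral_const_mul' _ _ hkt]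
    refine lintegral_mono_ae ?_
    filter_upwards [ae_restrict_of_ae hz, ae_restrict_mem measurableSet_ball] with z hz hzb
    exact enorm_tsum_rpow_le hp (hκ z) hz T fun j hj => (hT j).2 ⟨z, hj, hzb⟩
  have hglob : ∀ (x : E m) (r : ℝ) (T : Finset 𝒜.Idx) (S : Set (E m)), MeasurableSet S →
      (∀ j ∈ T, Ω ∩ 𝒜.V j ⊆ S) →
      ∑ j ∈ T, ∫⁻ z in Metric.ball x r, ‖h j z‖ₑ ^ p ≤ c * (κ * energy F p α.order S) := by
    intro x r T S hS hTS
    refine (Finset.sum_le_sum fun j _ =>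
      (setLIntegral_le_lintegral _ _).trans (hh j).global).trans ?_
    rw [← Finset.mul_sum]
    exact mul_le_mul' le_rfl (henergy T S hS hTS)
  refine ⟨fun x => ∑' j, h j x, ?_, ?_, fun x r hr => ?_⟩
  -- Only finitely many cuboids meet a given ball, so both series are finite sums there.
  · refine hasWeakDeriv_of_forall_ball fun R => ?_
    obtain ⟨N, hN⟩ := 𝒜.exists_finset_meets R
    obtain ⟨T, -, hT⟩ := hN 0
    refine ⟨_, _, HasWeakDeriv.finset_sum T fun j _ => hw j, fun x hx => ?_, ?_⟩
    · rw [ExtensionData.T, Finset.sum_apply]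
      refine tsum_eq_sum fun j hj => ?_
      have hxV : x ∉ 𝒜.V j := fun h' => hj ((hT j).2 ⟨x, h', hx⟩)
      rw [image_eq_zero_of_notMem_tsupport fun h' => hxV (B.χ_supp j h'), zero_mul]
    · filter_upwards [hz] with x hx hxb
      rw [Finset.sum_apply]
      exact tsum_eq_sum fun j hj => hx j fun h' => hj ((hT j).2 ⟨x, h', hxb⟩)
  -- The atlas may be infinite, so finiteness is proved on balls exhausting the space, with a bound
  -- independent of the ball.
  · have hfin : k * (c * (κ * energy F p α.order Ω)) ≠ ∞ := by
      have : energy F p α.order Ω ≠ ∞ := ENNReal.sum_ne_top.2 fun β hβ =>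
        hF.finite β (((mem_multiIndexLE β).1 hβ).trans hα)
      finiteness
    refine ne_top_of_le_ne_top hfin ?_
    have hmono : Directed (· ⊆ ·) fun n : ℕ => Metric.ball (0 : E m) n :=
      (monotone_nat_of_le_succ fun n => Metric.ball_subset_ball (by simp)).directed_le
    rw [← setLIntegral_univ, ← Metric.iUnion_ball_nat (0 : E m),
      setLIntegral_iUnion_of_directed _ hmono]
    refine iSup_le fun n => ?_
    obtain ⟨N, hN⟩ := 𝒜.exists_finset_meets n
    obtain ⟨T, -, hT⟩ := hN 0
    exact (hball 0 n T hT).trans (mul_le_mul' le_rfl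
      (hglob 0 n T Ω hΩ.isOpen.measurableSet fun j _ => inter_subset_left))
  · obtain ⟨N, hN⟩ := 𝒜.exists_finset_meets r
    obtain ⟨T, -, hT⟩ := hN x
    refine (hball x r T hT).trans ?_
    rw [hs, mul_assoc k]
    refine mul_le_mul' le_rfl ?_
    rw [add_mul]
    -- For `r ≤ D` at most `n₀` cuboids meet the ball, and the local ball estimate is used for each.
    -- For `r > D` their number is not bounded uniformly in `r`, but all of them lie in the ball of
    -- radius `2 r`, and the global local estimates are summed by multiplicity.
    rcases le_or_gt r D with hrD | hrD
    · refine le_trans ?_ le_self_add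
      obtain ⟨T', hT'c, hT'⟩ := hn₀ x
      have hTT : T ⊆ T' := fun j hj => (hT' j).2
        (((hT j).1 hj).mono (inter_subset_inter_right _ (Metric.ball_subset_ball hrD)))
      have hcard : (T.card : ℝ≥0∞) ≤ n₀ := by
        exact_mod_cast (Finset.card_le_card hTT).trans hT'c
      refine (Finset.sum_le_sum fun j _ => (hh j).ball x r hr _
        fun y => hn₁ F p α.order Ω y r hr).trans ?_
      rw [Finset.sum_const, nsmul_eq_mul, mul_assoc, mul_assoc (c : ℝ≥0∞)]
      exact mul_le_mul' hcard le_rfl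
    · refine le_trans ?_ le_add_self
      refine (hglob x r T (Metric.ball x (2 * r) ∩ Ω)
        (measurableSet_ball.inter hΩ.isOpen.measurableSet) fun j hj z hz => ⟨?_, hz.1⟩).trans ?_
      · refine Metric.ball_subset_ball ?_ (Atlas.subset_ball_of_meets ((hT j).1 hj) hz.2)
        have := le_max_left 𝒜.D 1
        linarith
      · rw [mul_assoc, mul_assoc]
        exact mul_le_mul' le_rfl (mul_le_mul' le_rfl (hn₂ F p α.order Ω x r hr))

end BurenkovMorrey

end

noncomputable section

namespace BurenkovMorrey

/-! ### From integral estimates to Morrey norms -/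

variable {m : ℕ} {𝒜 : Atlas m} {M : ℝ≥0} {l : ℕ} {C : MultiIndex m → ℝ} {P : ℝ} {Ω : Set (E m)}

theorem memLp_of_lintegral_rpow {p : ℝ} (hp : 1 ≤ p) {g : E m → ℝ}
    (hg : AEStronglyMeasurable g volume) (h : ∫⁻ x, ‖g x‖ₑ ^ p ≠ ∞) :
    MemLp g (ENNReal.ofReal p) (volume.restrict univ) := by
  have hp0 : 0 < p := by linarith
  rw [Measure.restrict_univ]
  refine ⟨hg, (eLpNorm_lt_top_iff_lintegral_rpow_enorm_lt_top (by simpa using hp0)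
    ENNReal.ofReal_ne_top).2 ?_⟩
  rw [ENNReal.toReal_ofReal hp0.le]
  exact h.lt_top

/-- Subadditivity of `x ↦ x^{1/p}`: the estimate for `p`-th powers of all derivatives together
becomes a sum of Morrey norms of single derivatives. -/
theorem sum_rpow_le {ι : Type*} (s : Finset ι) (f : ι → ℝ≥0∞) {q : ℝ} (hq : 0 < q) (hq1 : q ≤ 1) :
    (∑ i ∈ s, f i) ^ q ≤ ∑ i ∈ s, f i ^ q := by
  classical
  induction s using Finset.induction_on with
  | empty => simp [hq]
  | insert a s ha ih =>
    rw [Finset.sum_insert ha, Finset.sum_insert ha]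
    exact (ENNReal.rpow_add_le_add_rpow _ _ hq.le hq1).trans (add_le_add le_rfl ih)

/-- Both sides of the ball estimate have the same radius, so multiplication by `1 / φ r` is harmless
for any `φ`, and the range `r < δ` is the same on both sides. Enlarged radii would instead have
required a doubling condition on `φ`. -/
theorem morreyNorm_le_of_lintegral_ball_le {p : ℝ} (hp : 1 ≤ p) {c : ℝ≥0} {i : ℕ} {h : E m → ℝ}
    {F G : MultiIndex m → E m → ℝ}
    (hFG : ∀ β ∈ multiIndexLE m i, ∀ᵐ x, x ∈ Ω → F β x = G β x) (hΩ : MeasurableSet Ω)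
    (hh : ∀ x r, 0 < r → ∫⁻ z in Metric.ball x r, ‖h z‖ₑ ^ p ≤ c * ballEnergy Ω F p i r)
    (φ : ℝ → ℝ) (δ : ℝ≥0∞) :
    morreyNorm φ δ p univ h ≤
      (c : ℝ≥0∞) ^ (1 / p) * ∑ β ∈ multiIndexLE m i, morreyNorm φ δ p Ω (G β) := by
  have hp0 : 0 < p := by linarith
  have hq0 : 0 < 1 / p := by positivity
  have hq1 : 1 / p ≤ 1 := (div_le_one hp0).2 hp
  refine iSup₂_le fun x _ => iSup₂_le fun r hr => ?_
  have h1 : ENNReal.ofReal (1 / φ r) * ∫⁻ y in Metric.ball x r ∩ univ, ‖h y‖ₑ ^ p ≤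
      c * ∑ β ∈ multiIndexLE m i, ENNReal.ofReal (1 / φ r) *
        ⨆ x ∈ Ω, ∫⁻ y in Metric.ball x r ∩ Ω, ‖F β y‖ₑ ^ p := by
    rw [inter_univ, ← Finset.mul_sum, mul_left_comm]
    exact mul_le_mul' le_rfl (hh x r hr.1)
  refine (ENNReal.rpow_le_rpow h1 hq0.le).trans ?_
  rw [ENNReal.mul_rpow_of_nonneg _ _ hq0.le]
  refine mul_le_mul' le_rfl ((sum_rpow_le _ _ hq0 hq1).trans (Finset.sum_le_sum fun β hβ => ?_))
  rw [one_div p, ENNReal.rpow_inv_le_iff hp0]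
  simp only [ENNReal.mul_iSup]
  refine iSup₂_le fun y hy => ?_
  rw [← ENNReal.rpow_inv_le_iff hp0, ← one_div p]
  have h2 : ∫⁻ z in Metric.ball y r ∩ Ω, ‖F β z‖ₑ ^ p =
      ∫⁻ z in Metric.ball y r ∩ Ω, ‖G β z‖ₑ ^ p := by
    refine lintegral_congr_ae ?_
    filter_upwards [ae_restrict_of_ae (hFG β hβ),
      ae_restrict_mem (measurableSet_ball.inter hΩ)] with z hz hzm
    rw [hz hzm.2]
  rw [h2]
  exact le_iSup₂_of_le y hy (le_iSup₂_of_le r hr le_rfl)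

theorem morreyNorm_congr_ae {φ : ℝ → ℝ} {δ : ℝ≥0∞} {p : ℝ} {f g : E m → ℝ}
    (h : ∀ᵐ x, f x = g x) : morreyNorm φ δ p univ f = morreyNorm φ δ p univ g := by
  have e : ∀ S : Set (E m), ∫⁻ y in S, ‖f y‖ₑ ^ p = ∫⁻ y in S, ‖g y‖ₑ ^ p := fun S => by
    refine lintegral_congr_ae ?_
    filter_upwards [ae_restrict_of_ae h] with y hy
    rw [hy]
  simp only [morreyNorm, e]

/-- The extension operator preserves Sobolev regularity, and is bounded in all Morrey norms with
a common constant. -/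
theorem exists_extension_estimate {ω : E m → ℝ} (hω : IsKernel l ω) (𝒜 : Atlas m) (M : ℝ≥0)
    (C : MultiIndex m → ℝ) (P : ℝ) {p : ℝ} (hp : 1 ≤ p) :
    ∃ c : ℝ≥0, 0 < c ∧ ∀ Ω : Set (E m), IsLipschitzClass 𝒜 M Ω →
      ∀ (B : ExtensionData 𝒜 M l C P Ω) (f : E m → ℝ), MemSobolev l p Ω f →
      MemSobolev l p univ (B.T ω f) ∧
      ∀ (φ : ℝ → ℝ) (δ : ℝ≥0∞) (α : MultiIndex m), α.order ≤ l →
        morreyNorm φ δ p univ (weakD univ α (B.T ω f)) ≤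
          c * ∑ β ∈ multiIndexLE m α.order, morreyNorm φ δ p Ω (weakD Ω β f) := by
  have hp0 : 0 < p := by linarith
  obtain ⟨c, hc⟩ := exists_hasWeakDeriv_extension hω 𝒜 M C P hp
  -- The added one only makes the constant positive.
  refine ⟨c ^ (1 / p) + 1, by positivity, fun Ω hΩ B f hf => ?_⟩
  obtain ⟨F, hF, hFD⟩ := hf.exists_isDerivFamily hp hΩ.isOpen
  choose! h hw hfin hball using hc Ω hΩ B f F hF
  have hmem : ∀ α : MultiIndex m, α.order ≤ l →
      MemLp (h α) (ENNReal.ofReal p) (volume.restrict univ) := fun α hα =>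
    memLp_of_lintegral_rpow hp
      (locallyIntegrableOn_univ.1 (hw α hα).2.1).aestronglyMeasurable (hfin α hα)
  refine ⟨⟨?_, fun α hα => ⟨h α, hw α hα, hmem α hα⟩⟩, fun φ δ α hα => ?_⟩
  · have h0 : (0 : MultiIndex m).order ≤ l := by simp [order_zero]
    refine (memLp_congr_ae ?_).2 (hmem 0 h0)
    rw [Measure.restrict_univ]
    filter_upwards [(hasWeakDeriv_zero (hw 0 h0).1).ae_unique isOpen_univ (hw 0 h0)] with x hx
    exact hx (mem_univ x)
  · have e : ∀ᵐ x, weakD univ α (B.T ω f) x = h α x := by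
      filter_upwards [(hw α hα).weakD.ae_unique isOpen_univ (hw α hα)] with x hx
      exact hx (mem_univ x)
    rw [morreyNorm_congr_ae e]
    refine (morreyNorm_le_of_lintegral_ball_le hp (G := fun β => weakD Ω β f)
      (fun β hβ => hFD β (((mem_multiIndexLE β).1 hβ).trans hα)) hΩ.isOpen.measurableSet
      (hball α hα) φ δ).trans (mul_le_mul' ?_ le_rfl)
    rw [← ENNReal.coe_rpow_of_nonneg _ (by positivity)]
    exact_mod_cast le_self_add

end BurenkovMorrey

end
theorem theorem3p3 (m : ℕ) (𝒜 : BurenkovMorrey.Atlas m) (M : ℝ≥0) (hM : 0 < M)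
    (l : ℕ) (hl : 1 ≤ l) (p : ℝ) (hp : 1 ≤ p)
    (ω : BurenkovMorrey.E m → ℝ) (hω : BurenkovMorrey.IsKernel l ω)
    (C : BurenkovMorrey.MultiIndex m → ℝ) (P : ℝ) :
    -- `T` maps `W^{l,p}(Ω)` into `W^{l,p}(ℝⁿ)`, so that the derivatives below make sense
    (∀ (Ω : Set (BurenkovMorrey.E m)), BurenkovMorrey.IsLipschitzClass 𝒜 M Ω →
      ∀ (B : BurenkovMorrey.ExtensionData 𝒜 M l C P Ω) (f : BurenkovMorrey.E m → ℝ),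
        BurenkovMorrey.MemSobolev l p Ω f →
        BurenkovMorrey.MemSobolev l p Set.univ (B.T ω f)) ∧
    -- the estimate for finite `δ`
    (∀ δ : ℝ≥0∞, 0 < δ → δ ≠ ∞ → ∃ c : ℝ≥0, 0 < c ∧
      ∀ (φ : ℝ → ℝ), (∀ r, 0 < r → 0 < φ r) →
      ∀ (Ω : Set (BurenkovMorrey.E m)), BurenkovMorrey.IsLipschitzClass 𝒜 M Ω →
      ∀ (B : BurenkovMorrey.ExtensionData 𝒜 M l C P Ω) (f : BurenkovMorrey.E m → ℝ),
        BurenkovMorrey.MemSobolev l p Ω f →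
      ∀ α : BurenkovMorrey.MultiIndex m, α.order ≤ l →
        BurenkovMorrey.morreyNorm φ δ p Set.univ
            (BurenkovMorrey.weakD Set.univ α (B.T ω f)) ≤
          c * ∑ β ∈ BurenkovMorrey.multiIndexLE m α.order,
            BurenkovMorrey.morreyNorm φ δ p Ω (BurenkovMorrey.weakD Ω β f)) ∧
    -- for bounded `Ω` the constant does not depend on `δ`, and `δ = ∞` is allowed
    (∃ c : ℝ≥0, 0 < c ∧
      ∀ (δ : ℝ≥0∞), 0 < δ →
      ∀ (φ : ℝ → ℝ), (∀ r, 0 < r → 0 < φ r) →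
      ∀ (Ω : Set (BurenkovMorrey.E m)), BurenkovMorrey.IsLipschitzClass 𝒜 M Ω →
        Bornology.IsBounded Ω →
      ∀ (B : BurenkovMorrey.ExtensionData 𝒜 M l C P Ω) (f : BurenkovMorrey.E m → ℝ),
        BurenkovMorrey.MemSobolev l p Ω f →
      ∀ α : BurenkovMorrey.MultiIndex m, α.order ≤ l →
        BurenkovMorrey.morreyNorm φ δ p Set.univ
            (BurenkovMorrey.weakD Set.univ α (B.T ω f)) ≤
          c * ∑ β ∈ BurenkovMorrey.multiIndexLE m α.order,
            BurenkovMorrey.morreyNorm φ δ p Ω (BurenkovMorrey.weakD Ω β f)) := by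
  -- The constant is uniform in the radius, hence in `δ`, including `δ = ∞`; both estimates are
  -- instances of the same inequality.
  obtain ⟨c, hc, h⟩ := BurenkovMorrey.exists_extension_estimate hω 𝒜 M C P hp
  exact ⟨fun Ω hΩ B f hf => (h Ω hΩ B f hf).1,
    fun δ _ _ => ⟨c, hc, fun φ _ Ω hΩ B f hf => (h Ω hΩ B f hf).2 φ δ⟩,
    ⟨c, hc, fun δ _ φ _ Ω hΩ _ B f hf => (h Ω hΩ B f hf).2 φ δ⟩⟩
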